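/- **Definitions.** A *Lie group of Iwasawa type* is a simply connected solvable Lie group $S$ with a left-invariant Riemannian metric $g$ whose Lie algebra $\mathfrak s$ satisfies: (1) $\mathfrak s=\mathfrak a\oplus\mathfrak n$, where $\mathfrak n=[\mathfrak s,\mathfrak s]$ and $\mathfrak a=\mathfrak n^{\perp}$ is abelian; (2) $\mathrm{ad}(H)|_{\mathfrak n}$ is symmetric for all $H\in\mathfrak a$; (3) $\mathrm{ad}(H)|_{\mathfrak n}$ is positive definite for some $H\in\mathfrak a$. Its *rank* is $\dim\mathfrak a$. Let $S$ be of Iwasawa type, of rank one, with $\mathfrak n\neq0$. Let $A\in\mathfrak a$ be the unit vector with $\mathrm{ad}(A)|_{\mathfrak n}$ positive definite, let $0<\lambda_1<\dots<\lambda_m$ be the eigenvalues of $\mathrm{ad}(A)|_{\mathfrak n}$, and for each $i$ let $X^i_1,\dots,X^i_{n_i}$ be an orthonormal basis of the eigenspace $\mathfrak n_i$ of $\lambda_i$. Put $$A^{ik\alpha}_{j\ell\beta}=\langle[X^i_j,X^k_\ell],X^\alpha_\beta\rangle ,\qquad n=n_1\lambda_1+\dots+n_m\lambda_m .$$ For $t>0$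 and $x=(x^i_j)\in\mathbb R^{n_1+\dots+n_m}$ let $$\Phi(t,x)=\exp\Big(\sum_{i,j}x^i_jX^i_j\Big)\exp\big((\log t)A\big)\in S,$$ where $\exp:\mathfrak s\to S$ is the exponential map. (Under the identification $S=\mathbb R^+\ltimes N$, where $N$ is the simply connected Lie group with Lie algebra $\mathfrak n$, this is the point $(t,\exp_{\mathfrak n}(\sum x^i_jX^i_j))$.) Write $x^i=(x^i_1,\dots,x^i_{n_i})$ and $\Delta_{x^i}=\sum_{j=1}^{n_i}\partial^2/(\partial x^i_j)^2$. Define $$p^{i\alpha}_{j\beta}(x,1)=\sum_{k=1}^{\alpha-1}\sum_{\ell=1}^{n_k}A^{ki\alpha}_{\ell j\beta}\,x^k_\ell,\qquad p^{i\alpha}_{j\beta}(x,r)=\sum_{k=1}^{\alpha-1}\sum_{\ell=1}^{n_k}p^{ik}_{j\ell}(x,r-1)\,p^{k\alpha}_{\ell\beta}(x,1)\quad(r\ge2),$$ $$P^{i\alpha}_{j\beta}(x)=\delta_{i\alpha}\delta_{j\beta}\ \text{ if } i\ge\alpha,\qquad P^{i\alpha}_{j\beta}(x)=\sum_{r=1}^{m-1}\frac{B_r}{r!}\,p^{i\alpha}_{j\beta}(x,r)\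 \text{ if } i<\alpha,$$ where $B_r$ are the Bernoulli numbers with the convention $B_1=1/2$. Let $\tau$ be the Laplace–Beltrami operator $\operatorname{div}\operatorname{grad}$ of $(S,g)$, extended complex-linearly to complex-valued functions. **Theorem.** $\Phi$ is a diffeomorphism from $(0,\infty)\times\mathbb R^{n_1+\dots+n_m}$ onto $S$, so that $(t,x)$ are global coordinates on $S$. Each $p^{i\alpha}_{j\beta}(\cdot,r)$ is a homogeneous polynomial of degree $r$ (possibly zero), and each $P^{i\alpha}_{j\beta}$ is a polynomial of degree less than $m$. In the coordinates $(t,x)$ the following formulas hold. For every $C^2$ function $\phi:S\to\mathbb C$, $$\tau(\phi)=t^2\frac{\partial^2\phi}{\partial t^2}+(1-n)\,t\,\frac{\partial\phi}{\partial t}+\sum_{i,k,\alpha=1}^m\ \sum_{j,\ell,\beta=1}^{n_i,n_k,n_\alpha}t^{2\lambda_i}P^{ik}_{j\ell}(x)\frac{\partial}{\partial x^k_\ell}\Big(P^{i\alpha}_{j\beta}(x)\frac{\partial\phi}{\partial x^\alpha_\beta}\Big).$$ (i) If $h:S\to\mathbb C$ is a $C^2$ function depending only on $x^1$, then $\tau(h)=t^{2\lambda_1}\Delta_{x^1}h$.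 (ii) If $m\ge2$ and $h:S\to\mathbb C$ is a $C^2$ function depending only on $x^1$ and $x^2$, then $$\tau(h)=t^{2\lambda_1}\Delta_{x^1}h+t^{2\lambda_1}\sum_{j,\ell=1}^{n_1}\sum_{\beta=1}^{n_2}A^{112}_{j\ell\beta}\,x^1_j\,\frac{\partial^2h}{\partial x^1_\ell\,\partial x^2_\beta}+t^{2\lambda_2}\Delta_{x^2}h+\frac{t^{2\lambda_1}}4\sum_{j,r,s=1}^{n_1}\sum_{\ell,\beta=1}^{n_2}A^{112}_{rj\ell}A^{112}_{sj\beta}\,x^1_rx^1_s\,\frac{\partial^2h}{\partial x^2_\ell\,\partial x^2_\beta}.$$ -/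

import Mathlib

open Bundle Manifold ContDiff

noncomputable section

/-! ### The Laplace-Beltrami operator of a Riemannian manifold -/

section LaplaceBeltrami

variable {E : Type*} [NormedAddCommGroup E] [NormedSpace ℝ E]
  {M : Type*} [TopologicalSpace M] [ChartedSpace E M] [IsManifold 𝓘(ℝ, E) ∞ M]

/-- Smooth Riemannian metrics on the manifold `M` (modelled on `E`, without boundary). -/
abbrev RiemMetric (E : Type*) [NormedAddCommGroup E] [NormedSpace ℝ E]
    (M : Type*) [TopologicalSpace M] [ChartedSpace E M] [IsManifold 𝓘(ℝ, E) ∞ M] :=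
  ContMDiffRiemannianMetric 𝓘(ℝ, E) ∞ E (fun p : M => TangentSpace 𝓘(ℝ, E) p)

/-- `cov` is the Levi-Civita connection of `g`: it is compatible with the metric,
`v⟨Y, Z⟩ = ⟨∇_v Y, Z⟩ + ⟨Y, ∇_v Z⟩`, and torsion-free, `∇_Y Z - ∇_Z Y = [Y, Z]`.
In Mathlib's convention `cov Y p v` is `∇_v Y` at `p`. -/
def IsLeviCivita (g : RiemMetric E M)
    (cov : CovariantDerivative 𝓘(ℝ, E) E (fun p : M => TangentSpace 𝓘(ℝ, E) p)) : Prop :=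
  ∀ (p : M) (Y Z : (q : M) → TangentSpace 𝓘(ℝ, E) q),
    MDiffAt (T% Y) p → MDiffAt (T% Z) p →
      (∀ v : TangentSpace 𝓘(ℝ, E) p,
        mvfderiv 𝓘(ℝ, E) (fun q => g.inner q (Y q) (Z q)) p v =
          g.inner p (cov Y p v) (Z p) + g.inner p (Y p) (cov Z p v)) ∧
      cov Z p (Y p) - cov Y p (Z p) = VectorField.mlieBracket 𝓘(ℝ, E) Y Z p

/-- The gradient of a real function `f`: the inverse of the isomorphism
`T_p M → (T_p M)*`, `v ↦ ⟨v, ·⟩`, applied to the differential of `f`. -/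
def riemGradient (g : RiemMetric E M) (f : M → ℝ) (p : M) : TangentSpace 𝓘(ℝ, E) p :=
  (g.inner p).inverse (mvfderiv 𝓘(ℝ, E) f p)

open Classical in
/-- The Laplace-Beltrami operator `div grad f = tr (v ↦ ∇_v grad f)` on real functions, where `∇` is
the Levi-Civita connection of `g` (which exists on every finite-dimensional manifold and is unique
on differentiable fields; the value `0` is never taken there for want of a connection). -/
def laplaceBeltramiReal (g : RiemMetric E M) (f : M → ℝ) (p : M) : ℝ :=
  if h : ∃ cov : CovariantDerivative 𝓘(ℝ, E) E (fun p : M => TangentSpace 𝓘(ℝ, E) p),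
      IsLeviCivita g cov then
    LinearMap.trace ℝ (TangentSpace 𝓘(ℝ, E) p)
      (h.choose (riemGradient g f) p : TangentSpace 𝓘(ℝ, E) p →ₗ[ℝ] TangentSpace 𝓘(ℝ, E) p)
  else 0

/-- The Laplace-Beltrami operator extended complex-linearly to complex-valued functions. -/
def laplaceBeltrami (g : RiemMetric E M) (φ : M → ℂ) (p : M) : ℂ :=
  (laplaceBeltramiReal g (fun q => (φ q).re) p : ℂ) +
    Complex.I * (laplaceBeltramiReal g (fun q => (φ q).im) p : ℂ)

end LaplaceBeltrami

/-! ### Lie groups of Iwasawa type -/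

section Iwasawa

variable {E : Type*} [NormedAddCommGroup E] [NormedSpace ℝ E]
  {S : Type*} [TopologicalSpace S] [ChartedSpace E S] [Group S]

/-- The derived algebra `[𝔰, 𝔰]` of the Lie algebra `𝔰 = T_1 S`, as a linear subspace. -/
def derivedSubspace (E : Type*) [NormedAddCommGroup E] [NormedSpace ℝ E]
    (S : Type*) [TopologicalSpace S] [ChartedSpace E S] [Group S] :
    Submodule ℝ (GroupLieAlgebra 𝓘(ℝ, E) S) :=
  Submodule.span ℝ {Z | ∃ X Y : GroupLieAlgebra 𝓘(ℝ, E) S, ⁅X, Y⁆ = Z}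

variable [LieGroup 𝓘(ℝ, E) ∞ S]

/-- A Riemannian metric on a Lie group is left-invariant if all left translations are isometric. -/
def IsLeftInvariant (g : RiemMetric E S) : Prop :=
  ∀ (a p : S) (v w : TangentSpace 𝓘(ℝ, E) p),
    g.inner (a * p) (mfderiv 𝓘(ℝ, E) 𝓘(ℝ, E) (a * ·) p v) (mfderiv 𝓘(ℝ, E) 𝓘(ℝ, E) (a * ·) p w)
      = g.inner p v w

/-- The orthogonal complement `𝔞 = 𝔫^⊥` of the derived algebra `𝔫 = [𝔰, 𝔰]`. -/
def derivedComplement (g : RiemMetric E S) : Submodule ℝ (GroupLieAlgebra 𝓘(ℝ, E) S) where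
  carrier := {H | ∀ X ∈ derivedSubspace E S, g.inner 1 H X = 0}
  add_mem' {a b} ha hb X hX := by
    have h := congrArg₂ (· + ·) (ha X hX) (hb X hX)
    simpa using h
  zero_mem' X _ := by simp
  smul_mem' c a ha X hX := by
    have h := congrArg (c * ·) (ha X hX)
    simpa using h

/-- A Lie group of Iwasawa type: a simply connected solvable Lie group `S` with a left-invariant
Riemannian metric such that, with `𝔫 = [𝔰, 𝔰]` and `𝔞 = 𝔫^⊥` (so `𝔰 = 𝔞 ⊕ 𝔫`), the subspace `𝔞` is
abelian, `ad H` is symmetric on `𝔫` for all `H ∈ 𝔞`, and positive definite on `𝔫` for some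
`H ∈ 𝔞`. -/
structure IsIwasawaType (g : RiemMetric E S) : Prop where
  simplyConnected : SimplyConnectedSpace S
  solvable : Group.IsSolvable S
  leftInvariant : IsLeftInvariant g
  abelian : ∀ H ∈ derivedComplement g, ∀ K ∈ derivedComplement g, ⁅H, K⁆ = 0
  symmetric : ∀ H ∈ derivedComplement g, ∀ X ∈ derivedSubspace E S, ∀ Y ∈ derivedSubspace E S,
    g.inner 1 ⁅H, X⁆ Y = g.inner 1 X ⁅H, Y⁆
  posDef : ∃ H ∈ derivedComplement g, ∀ X ∈ derivedSubspace E S, X ≠ 0 → 0 < g.inner 1 ⁅H, X⁆ X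

/-- The rank of a Lie group of Iwasawa type: the dimension of `𝔞`. -/
def iwasawaRank (g : RiemMetric E S) : ℕ := Module.finrank ℝ (derivedComplement g)

/-- Index set `{(i, j) : 1 ≤ i ≤ m, 1 ≤ j ≤ n_i}` of the coordinates `x^i_j` (both indices are
counted from `0`). -/
abbrev CoordIndex {m : ℕ} (d : Fin m → ℕ) := Σ i : Fin m, Fin (d i)

/-- The choices made on a rank-one group of Iwasawa type: the unit vector `A ∈ 𝔞` for which
`ad A` is positive definite on `𝔫`, the eigenvalues `λ_1 < ... < λ_m` of `ad A` on `𝔫`, and, for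
each `i`, an orthonormal basis `X^i_1, ..., X^i_{n_i}` (`n_i ≥ 1`) of the eigenspace of `λ_i`. -/
structure IsAdaptedFrame (g : RiemMetric E S) {m : ℕ} (d : Fin m → ℕ) (lam : Fin m → ℝ)
    (A : GroupLieAlgebra 𝓘(ℝ, E) S) (X : CoordIndex d → GroupLieAlgebra 𝓘(ℝ, E) S) : Prop where
  mem_compl : A ∈ derivedComplement g
  unit : g.inner 1 A A = 1
  posDef : ∀ Y ∈ derivedSubspace E S, Y ≠ 0 → 0 < g.inner 1 ⁅A, Y⁆ Y
  strictMono : StrictMono lam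
  dim_pos : ∀ i, 0 < d i
  eigen : ∀ a, ⁅A, X a⁆ = lam a.1 • X a
  orthonormal : ∀ a b, g.inner 1 (X a) (X b) = if a = b then 1 else 0
  span : Submodule.span ℝ (Set.range X) = derivedSubspace E S

/-- The structure constants `A^{ikα}_{jℓβ} = ⟨[X^i_j, X^k_ℓ], X^α_β⟩`, for `a = (i, j)`,
`b = (k, ℓ)`, `c = (α, β)`. -/
def structConst (g : RiemMetric E S) {m : ℕ} {d : Fin m → ℕ}
    (X : CoordIndex d → GroupLieAlgebra 𝓘(ℝ, E) S) (a b c : CoordIndex d) : ℝ :=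
  g.inner 1 ⁅X a, X b⁆ (X c)

open Classical in
/-- The exponential map of the Lie group `S`: `exp v = γ 1`, where `γ : ℝ → S` is the integral curve
through `1` of the left-invariant vector field defined by `v`. -/
def lieExp (v : GroupLieAlgebra 𝓘(ℝ, E) S) : S :=
  if h : ∃ γ : ℝ → S, γ 0 = 1 ∧
      IsMIntegralCurve (I := 𝓘(ℝ, E)) γ (fun p => mulInvariantVectorField v p) then
    h.choose 1
  else 1

/-- The point of `S` with coordinates `(t, x)`, `t > 0`. With `S = ℝ⁺ ⋉ N` it is
`(t, exp(∑ x^i_j X^i_j)) = (1, exp(∑ x^i_j X^i_j)) (t, 1)`, and `(t, 1) = exp((log t) A)`. -/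
def coordPoint {m : ℕ} {d : Fin m → ℕ} (A : GroupLieAlgebra 𝓘(ℝ, E) S)
    (X : CoordIndex d → GroupLieAlgebra 𝓘(ℝ, E) S) (t : ℝ) (x : CoordIndex d → ℝ) : S :=
  lieExp (∑ a, x a • X a) * lieExp (Real.log t • A)

end Iwasawa

/-! ### The polynomials and partial derivatives in the formula -/

section Polynomials

variable {m : ℕ} {d : Fin m → ℕ}

/-- The linear polynomials `p^{iα}_{jβ}(x, 1) = ∑_{k < α} ∑_ℓ A^{kiα}_{ℓjβ} x^k_ℓ`, where
`C a b c` are the structure constants, `a = (i, j)` and `b = (α, β)`. -/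
def linPoly (C : CoordIndex d → CoordIndex d → CoordIndex d → ℝ) (a b : CoordIndex d) :
    MvPolynomial (CoordIndex d) ℝ :=
  ∑ c : CoordIndex d with c.1 < b.1, MvPolynomial.C (C c a b) * MvPolynomial.X c

/-- `homPoly C r a b` is `p^{iα}_{jβ}(x, r + 1)`, where `a = (i, j)` and `b = (α, β)`:
`p^{iα}_{jβ}(x, r) = ∑_{k < α} ∑_ℓ p^{ik}_{jℓ}(x, r - 1) p^{kα}_{ℓβ}(x, 1)` for `r ≥ 2`. -/
def homPoly (C : CoordIndex d → CoordIndex d → CoordIndex d → ℝ) :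
    ℕ → CoordIndex d → CoordIndex d → MvPolynomial (CoordIndex d) ℝ
  | 0, a, b => linPoly C a b
  | r + 1, a, b => ∑ c : CoordIndex d with c.1 < b.1, homPoly C r a c * linPoly C c b

/-- The polynomials `P^{iα}_{jβ}`, for `a = (i, j)` and `b = (α, β)`: the Kronecker delta if
`i ≥ α`, and `∑_{r=1}^{m-1} (B_r / r!) p^{iα}_{jβ}(x, r)` if `i < α`. Mathlib's `bernoulli'` are the
Bernoulli numbers with `B_1 = 1/2`. -/
def structPoly (C : CoordIndex d → CoordIndex d → CoordIndex d → ℝ) (a b : CoordIndex d) :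
    MvPolynomial (CoordIndex d) ℝ :=
  if b.1 ≤ a.1 then (if a = b then 1 else 0)
  else ∑ r ∈ Finset.Icc 1 (m - 1),
    MvPolynomial.C ((bernoulli' r : ℝ) / (Nat.factorial r : ℝ)) * homPoly C (r - 1) a b

/-- The partial derivative `∂f/∂x_a`. -/
def coordPartial {ι : Type*} [Fintype ι] [DecidableEq ι] (a : ι) (f : (ι → ℝ) → ℂ) (x : ι → ℝ) : ℂ :=
  deriv (fun s : ℝ => f (Function.update x a s)) (x a)

end Polynomials

end

/-! For left-invariant orthonormal fields e_i, metric compatibility and vanishing torsion give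
⟨∇_{e_i} e_i, e_j⟩ = ⟨[e_j, e_i], e_i⟩. Hence τ(f) = ∑ e_i e_i f - ∑_j tr(ad e_j) e_j f
(`laplaceBeltramiReal_eq`). In the frame A, X_a only A contributes a trace, equal to n: as ad A is a
derivation, [X_a, X_b] has eigenvalue λ_a + λ_b, so every ad X_a is strictly triangular in the order
of the eigenvalues (`IsModelFrame.isGraded`, `IsModelFrame.trace_ad`).

It remains to write the frame in coordinates. With t = e^u, the field A is ∂_u = t ∂_t. The
Maurer-Cartan equation yields a linear differential equation whose solution is exp(x)⁻¹ d exp_x = (1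
- e^{-ad x}) / ad x (`dexp_apply_eq_sum`). Its inverse is ∑ (B_r / r!) (ad x)^r with B_1 = 1/2, a
finite sum because ad x is nilpotent, and the entries of (ad x)^r in the basis X_a are the p(x, r).
So X_a is ∑_b P_ab ∂_b at t = 1 (`IsModelFrame.dexp_structPoly`). Conjugation by exp(uA) rescales,
giving X_a = t^{λ_a} ∑_b P_ab ∂_b in general, and substitution gives the formula. Statements (i) and
(ii) need only P between the first two blocks, which is the linear B_1 term.

Smoothness of exp near 0 comes from the implicit function theorem for the integral equation of the
flow, and everywhere from exp(v) = exp(v/k)^k (`contMDiff_lieExp`). The computation above shows that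
the coordinate map is a local diffeomorphism. It is injective since a point determines its adjoint
action, from which u and then x are read off. It is surjective since its image is open and closed
under multiplication in a connected group (`IsModelFrame.coordMap_injective`,
`IsModelFrame.coordMap_surjective`). -/

noncomputable section

/-! ### Calculus in one chart at the identity; the Maurer-Cartan equation -/

section LieGroupLocal

open Filter Topology

variable (E : Type*) [NormedAddCommGroup E] [NormedSpace ℝ E]
  (S : Type*) [TopologicalSpace S] [ChartedSpace E S] [Group S]

/-- The preferred chart at the identity. -/
def oneChart : PartialEquiv S E := extChartAt 𝓘(ℝ, E) (1 : S)

/-- The image of the identity under its preferred chart. -/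
def onePt : E := oneChart E S 1

/-- The group multiplication read in the preferred chart at the identity. -/
def mulChart (q : E × E) : E :=
  oneChart E S ((oneChart E S).symm q.1 * (oneChart E S).symm q.2)

/-- The left-invariant vector fields read in the preferred chart at the identity. -/
def leftField (z : E) : E →L[ℝ] E := fderiv ℝ (fun w => mulChart E S (z, w)) (onePt E S)

/-- The Lie bracket of the Lie algebra, transported to the model space. -/
def modelBracket : E →L[ℝ] E →L[ℝ] E :=
  fderiv ℝ (leftField E S) (onePt E S) - (fderiv ℝ (leftField E S) (onePt E S)).flip

lemma modelBracket_apply (v w : E) : modelBracket E S v w =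
    fderiv ℝ (leftField E S) (onePt E S) v w - fderiv ℝ (leftField E S) (onePt E S) w v := rfl

lemma one_mem_oneChart_source : (1 : S) ∈ (oneChart E S).source := mem_extChartAt_source _

lemma oneChart_source_mem_nhds : (oneChart E S).source ∈ 𝓝 (1 : S) := extChartAt_source_mem_nhds _

lemma isOpen_oneChart_source : IsOpen (oneChart E S).source := isOpen_extChartAt_source _

lemma isOpen_oneChart_target : IsOpen (oneChart E S).target := isOpen_extChartAt_target _

lemma onePt_mem_target : onePt E S ∈ (oneChart E S).target := mem_extChartAt_target _

lemma oneChart_symm_onePt : (oneChart E S).symm (onePt E S) = 1 := extChartAt_to_inv _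

lemma oneChart_one : oneChart E S 1 = onePt E S := rfl

variable [LieGroup 𝓘(ℝ, E) ∞ S]

lemma contMDiffAt_oneChart {p : S} (hp : p ∈ (oneChart E S).source) :
    ContMDiffAt 𝓘(ℝ, E) 𝓘(ℝ, E) ∞ (oneChart E S) p :=
  contMDiffAt_extChartAt' (by simpa [oneChart] using hp)

lemma contMDiffAt_oneChart_symm {z : E} (hz : z ∈ (oneChart E S).target) :
    ContMDiffAt 𝓘(ℝ, E) 𝓘(ℝ, E) ∞ (oneChart E S).symm z :=
  (contMDiffOn_extChartAt_symm (1 : S)).contMDiffAt ((isOpen_oneChart_target E S).mem_nhds hz)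

lemma contDiffAt_mulChart {q : E × E} (h1 : q.1 ∈ (oneChart E S).target)
    (h2 : q.2 ∈ (oneChart E S).target)
    (h3 : (oneChart E S).symm q.1 * (oneChart E S).symm q.2 ∈ (oneChart E S).source) :
    ContDiffAt ℝ ∞ (mulChart E S) q := by
  rw [← contMDiffAt_iff_contDiffAt]
  have hA : ContMDiffAt 𝓘(ℝ, E × E) 𝓘(ℝ, E) ∞ (fun q : E × E => (oneChart E S).symm q.1) q :=
    (contMDiffAt_oneChart_symm E S h1).comp q contDiff_fst.contDiffAt.contMDiffAt
  have hB : ContMDiffAt 𝓘(ℝ, E × E) 𝓘(ℝ, E) ∞ (fun q : E × E => (oneChart E S).symm q.2) q :=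
    (contMDiffAt_oneChart_symm E S h2).comp q contDiff_snd.contDiffAt.contMDiffAt
  exact (contMDiffAt_oneChart E S h3).comp q (hA.mul hB)

lemma contDiffAt_leftField {z : E} (hz : z ∈ (oneChart E S).target) :
    ContDiffAt ℝ ∞ (leftField E S) z := by
  have h : ContDiffAt ℝ ∞ (Function.uncurry fun z w => mulChart E S (z, w)) (z, onePt E S) :=
    contDiffAt_mulChart E S hz (onePt_mem_target E S)
      (by simpa [oneChart_symm_onePt] using (oneChart E S).map_target hz)
  exact ContDiffAt.fderiv (g := fun _ => onePt E S) h contDiffAt_const (by simp)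

omit [LieGroup 𝓘(ℝ, E) ∞ S] in
lemma leftField_onePt : leftField E S (onePt E S) = ContinuousLinearMap.id ℝ E := by
  have h : (fun w => mulChart E S (onePt E S, w)) =ᶠ[𝓝 (onePt E S)] id := by
    filter_upwards [(isOpen_oneChart_target E S).mem_nhds (onePt_mem_target E S)] with w hw
    simp [mulChart, oneChart_symm_onePt, (oneChart E S).right_inv hw]
  rw [leftField, h.fderiv_eq, fderiv_id]

lemma hasFDerivAt_mulChart_right {z : E} (hz : z ∈ (oneChart E S).target) :
    HasFDerivAt (fun w => mulChart E S (z, w)) (leftField E S z) (onePt E S) := by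
  have h : ContDiffAt ℝ ∞ (fun w => mulChart E S (z, w)) (onePt E S) :=
    (contDiffAt_mulChart E S (q := (z, onePt E S)) hz (onePt_mem_target E S)
      (by simpa [oneChart_symm_onePt] using (oneChart E S).map_target hz)).comp _
      (contDiffAt_const.prodMk contDiffAt_id)
  exact (h.differentiableAt (by simp)).hasFDerivAt

variable {E S}
variable {F : Type*} [NormedAddCommGroup F] [NormedSpace ℝ F]

/-- `w` is the left logarithmic derivative of `c` at `q`: the derivative at `q` of
`q' ↦ c(q)⁻¹ c(q')`, read in the chart at the identity. -/
def HasLeftDeriv (c : F → S) (w : F →L[ℝ] E) (q : F) : Prop :=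
  ContinuousAt c q ∧ HasFDerivAt (fun q' => oneChart E S ((c q)⁻¹ * c q')) w q

/-- The left logarithmic derivative of a map into a Lie group. -/
def leftDeriv (E : Type*) [NormedAddCommGroup E] [NormedSpace ℝ E] {S : Type*} [TopologicalSpace S]
    [ChartedSpace E S] [Group S] (c : F → S) (q : F) : F →L[ℝ] E :=
  fderiv ℝ (fun q' => oneChart E S ((c q)⁻¹ * c q')) q

omit [LieGroup 𝓘(ℝ, E) ∞ S] in
lemma HasLeftDeriv.leftDeriv_eq {c : F → S} {w : F →L[ℝ] E} {q : F} (h : HasLeftDeriv c w q) :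
    leftDeriv E c q = w := h.2.fderiv

/-- The constant cancels in `(p * c q)⁻¹ * (p * c q')`. This invariance lets a single chart at the
identity serve the whole group. -/
lemma HasLeftDeriv.const_mul {c : F → S} {w : F →L[ℝ] E} {q : F} (h : HasLeftDeriv c w q) (p : S) :
    HasLeftDeriv (fun q => p * c q) w q := by
  have := topologicalGroup_of_lieGroup 𝓘(ℝ, E) ∞ (G := S)
  refine ⟨continuousAt_const.mul h.1, ?_⟩
  have : (fun q' => oneChart E S ((p * c q)⁻¹ * (p * c q'))) =
      fun q' => oneChart E S ((c q)⁻¹ * c q') := by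
    funext q'; congr 1; group
  rw [this]; exact h.2

omit [LieGroup 𝓘(ℝ, E) ∞ S] in
lemma HasLeftDeriv.comp {F' : Type*} [NormedAddCommGroup F'] [NormedSpace ℝ F'] {c : F → S}
    {w : F →L[ℝ] E} {f : F' → F} {f' : F' →L[ℝ] F} {q : F'} (h : HasLeftDeriv c w (f q))
    (hf : HasFDerivAt f f' q) : HasLeftDeriv (fun q => c (f q)) (w ∘L f') q :=
  ⟨ContinuousAt.comp (f := f) h.1 hf.continuousAt, HasFDerivAt.comp q h.2 hf⟩

lemma contDiffAt_oneChart_comp {c : F → S} {q : F} {n : WithTop ℕ∞} (hn : n ≤ ∞)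
    (hc : ContMDiffAt 𝓘(ℝ, F) 𝓘(ℝ, E) n c q) (hq : c q ∈ (oneChart E S).source) :
    ContDiffAt ℝ n (fun q => oneChart E S (c q)) q := by
  rw [← contMDiffAt_iff_contDiffAt]
  exact ((contMDiffAt_oneChart E S hq).of_le hn).comp q hc

lemma contDiff_leftDeriv {c : F → S} (hc : ContMDiff 𝓘(ℝ, F) 𝓘(ℝ, E) ∞ c) :
    ContDiff ℝ ∞ (leftDeriv E c) := by
  rw [contDiff_iff_contDiffAt]
  intro q
  have h : ContDiffAt ℝ ∞ (Function.uncurry fun q q' => oneChart E S ((c q)⁻¹ * c q')) (q, q) := by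
    apply contDiffAt_oneChart_comp (c := fun r : F × F => (c r.1)⁻¹ * c r.2) le_rfl
    · have hA : ContMDiffAt 𝓘(ℝ, F × F) 𝓘(ℝ, E) ∞ (fun r : F × F => c r.1) (q, q) :=
        (hc q).comp (q, q) contDiff_fst.contDiffAt.contMDiffAt
      have hB : ContMDiffAt 𝓘(ℝ, F × F) 𝓘(ℝ, E) ∞ (fun r : F × F => c r.2) (q, q) :=
        (hc q).comp (q, q) contDiff_snd.contDiffAt.contMDiffAt
      exact hA.inv.mul hB
    · simpa using one_mem_oneChart_source E S
  exact ContDiffAt.fderiv (g := fun q => q) h contDiffAt_id (by simp)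

lemma ContMDiffAt.hasLeftDeriv {c : F → S} {q : F} {n : WithTop ℕ∞} (hn : n ≤ ∞) (hn0 : n ≠ 0)
    (hc : ContMDiffAt 𝓘(ℝ, F) 𝓘(ℝ, E) n c q) :
    HasLeftDeriv c (leftDeriv E c q) q := by
  refine ⟨hc.continuousAt, ?_⟩
  have h : ContDiffAt ℝ n (fun q' => oneChart E S ((c q)⁻¹ * c q')) q := by
    apply contDiffAt_oneChart_comp (c := fun q' => (c q)⁻¹ * c q') hn
    · have : LieGroup 𝓘(ℝ, E) n S := LieGroup.of_le hn
      exact contMDiffAt_const.mul hc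
    · simpa using one_mem_oneChart_source E S
  exact (h.differentiableAt hn0).hasFDerivAt

lemma ContMDiff.hasLeftDeriv {c : F → S} (hc : ContMDiff 𝓘(ℝ, F) 𝓘(ℝ, E) ∞ c) (q : F) :
    HasLeftDeriv c (leftDeriv E c q) q :=
  ContMDiffAt.hasLeftDeriv le_rfl (by simp) (hc q)

/-- The derivative of a map into a Lie group, read in a translate of the chart at the identity,
in terms of its left logarithmic derivative. -/
lemma HasLeftDeriv.hasFDerivAt_chart {c : F → S} {w : F →L[ℝ] E} {q : F} (h : HasLeftDeriv c w q)
    {p : S} (hp : p⁻¹ * c q ∈ (oneChart E S).source) :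
    HasFDerivAt (fun q' => oneChart E S (p⁻¹ * c q'))
      (leftField E S (oneChart E S (p⁻¹ * c q)) ∘L w) q := by
  have := topologicalGroup_of_lieGroup 𝓘(ℝ, E) ∞ (G := S)
  have h1 := hasFDerivAt_mulChart_right E S ((oneChart E S).map_source hp)
  have h2 : HasFDerivAt (fun w => mulChart E S (oneChart E S (p⁻¹ * c q), w))
      (leftField E S (oneChart E S (p⁻¹ * c q))) (oneChart E S ((c q)⁻¹ * c q)) := by
    rw [inv_mul_cancel]; exact h1
  have h3 := HasFDerivAt.comp q h2 h.2
  refine h3.congr_of_eventuallyEq ?_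
  have hcont : ContinuousAt (fun q' => (c q)⁻¹ * c q') q := continuousAt_const.mul h.1
  have hmem : ∀ᶠ q' in 𝓝 q, (c q)⁻¹ * c q' ∈ (oneChart E S).source := by
    apply hcont.eventually_mem
    simpa using oneChart_source_mem_nhds E S
  filter_upwards [hmem] with q' hq'
  simp only [Function.comp, mulChart, (oneChart E S).left_inv hp, (oneChart E S).left_inv hq']
  congr 1; group

/-- The Maurer-Cartan equation. -/
theorem leftDeriv_maurerCartan {c : F → S} (hc : ContMDiff 𝓘(ℝ, F) 𝓘(ℝ, E) ∞ c) (q ξ η : F) :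
    fderiv ℝ (leftDeriv E c) q ξ η - fderiv ℝ (leftDeriv E c) q η ξ
      + modelBracket E S (leftDeriv E c q ξ) (leftDeriv E c q η) = 0 := by
  have := topologicalGroup_of_lieGroup 𝓘(ℝ, E) ∞ (G := S)
  set y : F → E := fun q' => oneChart E S ((c q)⁻¹ * c q') with hy
  have hyq : y q = onePt E S := by simp [hy, oneChart_one]
  have hcont : ContinuousAt (fun q' => (c q)⁻¹ * c q') q := continuousAt_const.mul (hc q).continuousAt
  have hmem : ∀ᶠ q' in 𝓝 q, (c q)⁻¹ * c q' ∈ (oneChart E S).source := by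
    apply hcont.eventually_mem
    simpa using oneChart_source_mem_nhds E S
  have hysm : ContDiffAt ℝ ∞ y q := contDiffAt_oneChart_comp (c := fun q' => (c q)⁻¹ * c q') le_rfl
    (contMDiffAt_const.mul (hc q)) (by simpa using one_mem_oneChart_source E S)
  -- Near `q` the map `y` satisfies `dy = leftField (y) ∘ leftDeriv c`. Symmetry of its second
  -- derivative at `q` is the integrability condition, and that is the claimed equation.
  have hfd : fderiv ℝ y =ᶠ[𝓝 q] fun q' => leftField E S (y q') ∘L leftDeriv E c q' := by
    filter_upwards [hmem] with q' hq'
    exact ((ContMDiff.hasLeftDeriv hc q').hasFDerivAt_chart hq').fderiv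
  have hyd : HasFDerivAt y (leftDeriv E c q) q := by
    have := (ContMDiff.hasLeftDeriv hc q).hasFDerivAt_chart (p := c q)
      (by simpa using one_mem_oneChart_source E S)
    simpa [oneChart_one, leftField_onePt] using this
  have hB : HasFDerivAt (fun q' => leftField E S (y q'))
      (fderiv ℝ (leftField E S) (onePt E S) ∘L leftDeriv E c q) q := by
    have h1 : HasFDerivAt (leftField E S) (fderiv ℝ (leftField E S) (onePt E S)) (y q) := by
      rw [hyq]
      exact ((contDiffAt_leftField E S (onePt_mem_target E S)).differentiableAt
        (by simp)).hasFDerivAt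
    exact HasFDerivAt.comp q h1 hyd
  have hw : HasFDerivAt (leftDeriv E c) (fderiv ℝ (leftDeriv E c) q) q :=
    ((contDiff_leftDeriv hc).differentiable (by simp) q).hasFDerivAt
  have h2 := (hB.clm_comp hw).congr_of_eventuallyEq hfd
  have hsymm : IsSymmSndFDerivAt ℝ y q :=
    hysm.isSymmSndFDerivAt (by simpa using ENat.LEInfty.out)
  have hs := hsymm.eq ξ η
  rw [h2.fderiv] at hs
  simp only [hyq, leftField_onePt, add_apply, ContinuousLinearMap.comp_apply,
    ContinuousLinearMap.compL_apply, ContinuousLinearMap.flip_apply,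
    ContinuousLinearMap.id_apply] at hs
  rw [modelBracket_apply]
  rw [← sub_eq_zero] at hs
  rw [← hs]
  abel

end LieGroupLocal

/-! ### Comparison with manifold derivatives and with the Lie bracket -/

section LieGroupBridge

open Filter Topology

variable {E : Type*} [NormedAddCommGroup E] [NormedSpace ℝ E]
  {S : Type*} [TopologicalSpace S] [ChartedSpace E S] [Group S] [LieGroup 𝓘(ℝ, E) ∞ S]
  {F : Type*} [NormedAddCommGroup F] [NormedSpace ℝ F]

lemma hasMFDerivAt_oneChart : HasMFDerivAt 𝓘(ℝ, E) 𝓘(ℝ, E) (oneChart E S) (1 : S)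
    (ContinuousLinearMap.id ℝ E) := by
  have h := (contMDiffAt_oneChart E S (one_mem_oneChart_source E S)).mdifferentiableAt (by simp)
    |>.hasMFDerivAt
  have h2 : mfderiv 𝓘(ℝ, E) 𝓘(ℝ, E) (oneChart E S) (1 : S) = ContinuousLinearMap.id ℝ E :=
    mfderiv_extChartAt_self (I := 𝓘(ℝ, E)) (x := (1 : S))
  rw [h2] at h
  exact h

lemma hasMFDerivAt_oneChart_symm : HasMFDerivAt 𝓘(ℝ, E) 𝓘(ℝ, E) (oneChart E S).symm (onePt E S)
    (ContinuousLinearMap.id ℝ E) := by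
  have h := (contMDiffAt_oneChart_symm E S (onePt_mem_target E S)).mdifferentiableAt (by simp)
    |>.hasMFDerivAt
  have h2 : mfderivWithin 𝓘(ℝ, E) 𝓘(ℝ, E) (oneChart E S).symm (Set.range 𝓘(ℝ, E)) (onePt E S)
      = ContinuousLinearMap.id ℝ E :=
    mfderivWithin_range_extChartAt_symm (I := 𝓘(ℝ, E)) (x := (1 : S))
  simp only [modelWithCornersSelf_coe, Set.range_id, mfderivWithin_univ] at h2
  rw [h2] at h
  exact h

/-- Left translation by `p`, as a linear map from the Lie algebra. -/
def leftMap (E : Type*) [NormedAddCommGroup E] [NormedSpace ℝ E] {S : Type*} [TopologicalSpace S]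
    [ChartedSpace E S] [Group S] (p : S) : E →L[ℝ] TangentSpace 𝓘(ℝ, E) p :=
  mfderiv 𝓘(ℝ, E) 𝓘(ℝ, E) (p * ·) (1 : S)

omit [LieGroup 𝓘(ℝ, E) ∞ S] in
lemma leftMap_apply (p : S) (v : E) :
    leftMap E p v = mulInvariantVectorField (I := 𝓘(ℝ, E)) (G := S) v p := rfl

lemma hasMFDerivAt_mul_left (p : S) : HasMFDerivAt 𝓘(ℝ, E) 𝓘(ℝ, E) (p * ·) (1 : S) (leftMap E p) :=
  ((contMDiff_mul_left (I := 𝓘(ℝ, E)) (n := ∞)).mdifferentiable (by simp) _).hasMFDerivAt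

lemma HasLeftDeriv.hasMFDerivAt {c : F → S} {w : F →L[ℝ] E} {q : F} (h : HasLeftDeriv c w q) :
    HasMFDerivAt 𝓘(ℝ, F) 𝓘(ℝ, E) c q (leftMap E (c q) ∘L w) := by
  have := topologicalGroup_of_lieGroup 𝓘(ℝ, E) ∞ (G := S)
  have h1 : HasMFDerivAt 𝓘(ℝ, F) 𝓘(ℝ, E) (fun q' => oneChart E S ((c q)⁻¹ * c q')) q w :=
    h.2.hasMFDerivAt
  have h2 : HasMFDerivAt 𝓘(ℝ, E) 𝓘(ℝ, E) (oneChart E S).symm (oneChart E S ((c q)⁻¹ * c q))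
    (ContinuousLinearMap.id ℝ E) := by
    rw [inv_mul_cancel]; exact hasMFDerivAt_oneChart_symm
  have h3 : HasMFDerivAt 𝓘(ℝ, E) 𝓘(ℝ, E) (c q * ·)
      ((oneChart E S).symm (oneChart E S ((c q)⁻¹ * c q))) (leftMap E (c q)) := by
    rw [inv_mul_cancel, oneChart_one, oneChart_symm_onePt]
    exact hasMFDerivAt_mul_left _
  have h4 := HasMFDerivAt.comp q h3 (HasMFDerivAt.comp q h2 h1)
  refine (HasMFDerivAt.congr_of_eventuallyEq (f₁ := c) h4 ?_).congr_mfderiv rfl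
  have hcont : ContinuousAt (fun q' => (c q)⁻¹ * c q') q := continuousAt_const.mul h.1
  have hmem : ∀ᶠ q' in 𝓝 q, (c q)⁻¹ * c q' ∈ (oneChart E S).source := by
    apply hcont.eventually_mem
    simpa using oneChart_source_mem_nhds E S
  filter_upwards [hmem] with q' hq'
  simp [Function.comp, (oneChart E S).left_inv hq']

/-- The inverse of left translation, read in the chart at the identity. -/
def leftMapInv (E : Type*) [NormedAddCommGroup E] [NormedSpace ℝ E] {S : Type*} [TopologicalSpace S]
    [ChartedSpace E S] [Group S] (p : S) : TangentSpace 𝓘(ℝ, E) p →L[ℝ] E :=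
  mfderiv 𝓘(ℝ, E) 𝓘(ℝ, E) (fun x => oneChart E S (p⁻¹ * x)) p

lemma hasMFDerivAt_leftMapInv (p : S) :
    HasMFDerivAt 𝓘(ℝ, E) 𝓘(ℝ, E) (fun x => oneChart E S (p⁻¹ * x)) p (leftMapInv E p) := by
  have h1 : ContMDiffAt 𝓘(ℝ, E) 𝓘(ℝ, E) ∞ (p⁻¹ * ·) p :=
    (contMDiff_mul_left (I := 𝓘(ℝ, E)) (n := ∞)) _
  have h2 : ContMDiffAt 𝓘(ℝ, E) 𝓘(ℝ, E) ∞ (oneChart E S) (p⁻¹ * p) :=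
    contMDiffAt_oneChart E S (by simpa using one_mem_oneChart_source E S)
  exact ((h2.comp p h1).mdifferentiableAt (by simp)).hasMFDerivAt

lemma leftMapInv_leftMap (p : S) (v : E) : leftMapInv E p (leftMap E p v) = v := by
  have h1 := hasMFDerivAt_mul_left (E := E) p
  have h2 : HasMFDerivAt 𝓘(ℝ, E) 𝓘(ℝ, E) (fun x => oneChart E S (p⁻¹ * x)) (p * 1)
      (leftMapInv E p) := by
    rw [mul_one]; exact hasMFDerivAt_leftMapInv p
  have h3 := HasMFDerivAt.comp (1 : S) h2 h1
  have h4 : ((fun x => oneChart E S (p⁻¹ * x)) ∘ (p * ·)) = oneChart E S := by ext x; simp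
  rw [h4] at h3
  exact congrArg (fun f : E →L[ℝ] E => f v) (hasMFDerivAt_unique h3 hasMFDerivAt_oneChart)

lemma leftMap_leftMapInv (p : S) (v : TangentSpace 𝓘(ℝ, E) p) :
    leftMap E p (leftMapInv E p v) = v := by
  have := topologicalGroup_of_lieGroup 𝓘(ℝ, E) ∞ (G := S)
  have h1 := hasMFDerivAt_leftMapInv (E := E) p
  have h2 : HasMFDerivAt 𝓘(ℝ, E) 𝓘(ℝ, E) (oneChart E S).symm (oneChart E S (p⁻¹ * p))
    (ContinuousLinearMap.id ℝ E) := by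
    rw [inv_mul_cancel]; exact hasMFDerivAt_oneChart_symm
  have h3 : HasMFDerivAt 𝓘(ℝ, E) 𝓘(ℝ, E) (p * ·)
      ((oneChart E S).symm (oneChart E S (p⁻¹ * p))) (leftMap E p) := by
    rw [inv_mul_cancel, oneChart_one, oneChart_symm_onePt]
    exact hasMFDerivAt_mul_left _
  have h4 := HasMFDerivAt.comp p h3 (HasMFDerivAt.comp p h2 h1)
  have h5 : HasMFDerivAt 𝓘(ℝ, E) 𝓘(ℝ, E) (id : S → S) p (leftMap E p ∘L leftMapInv E p) := by
    refine (HasMFDerivAt.congr_of_eventuallyEq (f₁ := id) h4 ?_).congr_mfderiv rfl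
    have hcont : ContinuousAt (fun q' => p⁻¹ * q') p := continuousAt_const.mul continuousAt_id
    have hmem : ∀ᶠ q' in 𝓝 p, p⁻¹ * q' ∈ (oneChart E S).source := by
      apply hcont.eventually_mem
      simpa using oneChart_source_mem_nhds E S
    filter_upwards [hmem] with q' hq'
    simp [Function.comp, (oneChart E S).left_inv hq']
  exact congrArg (fun f => f v)
    (hasMFDerivAt_unique h5 (hasMFDerivAt_id (I := 𝓘(ℝ, E)) p))

/-- Left translation is an isomorphism from the Lie algebra to the tangent space at `c q`, so the
logarithmic derivative and the manifold derivative determine each other. -/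
lemma hasLeftDeriv_iff {c : F → S} {w : F →L[ℝ] E} {q : F} :
    HasLeftDeriv c w q ↔ HasMFDerivAt 𝓘(ℝ, F) 𝓘(ℝ, E) c q (leftMap E (c q) ∘L w) := by
  refine ⟨HasLeftDeriv.hasMFDerivAt, fun h => ⟨h.continuousAt, ?_⟩⟩
  have h1 := HasMFDerivAt.comp q (hasMFDerivAt_leftMapInv (E := E) (c q)) h
  have h2 : leftMapInv E (c q) ∘L leftMap E (c q) ∘L w = w := by
    ext v; exact leftMapInv_leftMap _ _
  exact (h1.congr_mfderiv h2).hasFDerivAt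

lemma hasLeftDeriv_of_isMIntegralCurve {γ : ℝ → S} {v : E}
    (h : IsMIntegralCurve (I := 𝓘(ℝ, E)) γ
      (fun p => mulInvariantVectorField (I := 𝓘(ℝ, E)) (G := S) v p)) (t : ℝ) :
    HasLeftDeriv γ (ContinuousLinearMap.toSpanSingleton ℝ v) t := by
  rw [hasLeftDeriv_iff]
  exact (h t).congr_mfderiv (ContinuousLinearMap.ext fun s => ((leftMap E (γ t)).map_smul s v).symm)

lemma isMIntegralCurve_of_hasLeftDeriv {γ : ℝ → S} {v : E}
    (h : ∀ t, HasLeftDeriv γ (ContinuousLinearMap.toSpanSingleton ℝ v) t) :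
    IsMIntegralCurve (I := 𝓘(ℝ, E)) γ
      (fun p => mulInvariantVectorField (I := 𝓘(ℝ, E)) (G := S) v p) := by
  intro t
  exact (hasLeftDeriv_iff.1 (h t)).congr_mfderiv
    (ContinuousLinearMap.ext fun s => (leftMap E (γ t)).map_smul s v)

/-- Both sides are the derivative of the product with the fixed left factor `(oneChart E S).symm z`,
taken at the identity in its second factor: the inverse chart turns `mulChart` back into the group
product. -/
lemma mfderiv_oneChart_symm_leftField {z : E} (hz : z ∈ (oneChart E S).target) (v : E) :
    mfderiv 𝓘(ℝ, E) 𝓘(ℝ, E) (oneChart E S).symm z (leftField E S z v) =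
      leftMap E ((oneChart E S).symm z) v := by
  have := topologicalGroup_of_lieGroup 𝓘(ℝ, E) ∞ (G := S)
  set D := mfderiv 𝓘(ℝ, E) 𝓘(ℝ, E) (oneChart E S).symm z with hD
  have hD' : HasMFDerivAt 𝓘(ℝ, E) 𝓘(ℝ, E) (oneChart E S).symm z D :=
    ((contMDiffAt_oneChart_symm E S hz).mdifferentiableAt (by simp)).hasMFDerivAt
  have hz1 : mulChart E S (z, onePt E S) = z := by
    simp [mulChart, oneChart_symm_onePt, (oneChart E S).right_inv hz]
  have h1 : HasMFDerivAt 𝓘(ℝ, E) 𝓘(ℝ, E) (oneChart E S).symm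
      (mulChart E S (z, onePt E S)) D := by rw [hz1]; exact hD'
  have h2 := HasMFDerivAt.comp (onePt E S) h1 (hasFDerivAt_mulChart_right E S hz).hasMFDerivAt
  have h3 : HasMFDerivAt 𝓘(ℝ, E) 𝓘(ℝ, E) ((oneChart E S).symm z * ·)
    ((oneChart E S).symm (onePt E S)) (leftMap E ((oneChart E S).symm z)) := by
    rw [oneChart_symm_onePt]; exact hasMFDerivAt_mul_left _
  have h4 := HasMFDerivAt.comp (onePt E S) h3 hasMFDerivAt_oneChart_symm
  have heq : ((oneChart E S).symm ∘ fun w => mulChart E S (z, w)) =ᶠ[𝓝 (onePt E S)]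
      ((oneChart E S).symm z * ·) ∘ (oneChart E S).symm := by
    have hcont : ContinuousAt (fun w => (oneChart E S).symm z * (oneChart E S).symm w)
        (onePt E S) := h4.continuousAt
    have hmem : (oneChart E S).source ∈
      𝓝 ((oneChart E S).symm z * (oneChart E S).symm (onePt E S)) := by
      rw [oneChart_symm_onePt, mul_one]
      exact (isOpen_oneChart_source E S).mem_nhds ((oneChart E S).map_target hz)
    filter_upwards [hcont.eventually_mem hmem] with w hw
    simp [mulChart, (oneChart E S).left_inv hw]
  have h5 := hasMFDerivAt_unique h2 (h4.congr_of_eventuallyEq heq)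
  exact congrArg (fun f : E →L[ℝ] E => f v) h5

/-- A map into the chart at the identity whose derivative is given by the left-invariant fields
has the corresponding left logarithmic derivative. -/
lemma hasLeftDeriv_oneChart_symm {y : F → E} {w : F →L[ℝ] E} {q : F}
    (hq : y q ∈ (oneChart E S).target) (h : HasFDerivAt y (leftField E S (y q) ∘L w) q) :
    HasLeftDeriv (fun q => (oneChart E S).symm (y q)) w q := by
  rw [hasLeftDeriv_iff]
  have h1 := ((contMDiffAt_oneChart_symm E S hq).mdifferentiableAt (by simp)).hasMFDerivAt
  exact (HasMFDerivAt.comp q h1 h.hasMFDerivAt).congr_mfderiv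
    (ContinuousLinearMap.ext fun v => mfderiv_oneChart_symm_leftField hq (w v))

/-- The bracket of the Lie algebra of `S` in terms of the chart at the identity. -/
lemma bracket_eq_modelBracket [CompleteSpace E] (v w : GroupLieAlgebra 𝓘(ℝ, E) S) :
    ⁅v, w⁆ = (modelBracket E S v w : E) := by
  -- In the chart the invariant field of `v` becomes `z ↦ leftField z v`, so the bracket at the
  -- identity is an antisymmetrized derivative of `leftField`.
  have key : ∀ v : E, VectorField.mpullbackWithin 𝓘(ℝ, E) 𝓘(ℝ, E) (oneChart E S).symm
      (fun p => mulInvariantVectorField (I := 𝓘(ℝ, E)) (G := S) v p) (Set.range 𝓘(ℝ, E))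
      =ᶠ[𝓝 (onePt E S)] fun z => leftField E S z v := by
    intro v
    filter_upwards [(isOpen_oneChart_target E S).mem_nhds (onePt_mem_target E S)] with z hz
    rw [VectorField.mpullbackWithin_apply]
    have hinv := isInvertible_mfderivWithin_extChartAt_symm (I := 𝓘(ℝ, E)) (x := (1 : S)) hz
    change (mfderivWithin 𝓘(ℝ, E) 𝓘(ℝ, E) (oneChart E S).symm (Set.range 𝓘(ℝ, E)) z).IsInvertible
      at hinv
    have h6 : mfderivWithin 𝓘(ℝ, E) 𝓘(ℝ, E) (oneChart E S).symm (Set.range 𝓘(ℝ, E)) z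
        (leftField E S z v) = leftMap E ((oneChart E S).symm z) v := by
      rw [modelWithCornersSelf_coe, Set.range_id, mfderivWithin_univ]
      exact mfderiv_oneChart_symm_leftField hz v
    rw [← leftMap_apply, ← h6]
    exact hinv.inverse_apply_self (leftField E S z v)
  rw [GroupLieAlgebra.bracket_def]
  let V : E → E → E := fun v z => VectorField.mpullbackWithin 𝓘(ℝ, E) 𝓘(ℝ, E) (oneChart E S).symm
      (fun p => mulInvariantVectorField (I := 𝓘(ℝ, E)) (G := S) v p) (Set.range 𝓘(ℝ, E)) z
  have h0 : (mfderiv 𝓘(ℝ, E) 𝓘(ℝ, E) (oneChart E S) (1 : S)).inverse 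
    = ContinuousLinearMap.id ℝ E := by
    have := (hasMFDerivAt_oneChart (E := E) (S := S)).mfderiv
    refine (congrArg ContinuousLinearMap.inverse this).trans ?_
    exact ContinuousLinearMap.inverse_id
  have h1 : (VectorField.mlieBracket 𝓘(ℝ, E) (mulInvariantVectorField v) (mulInvariantVectorField w)
    (1 : S) : E) = VectorField.lieBracketWithin ℝ (V v) (V w)
        ((oneChart E S).symm ⁻¹' Set.univ ∩ Set.range 𝓘(ℝ, E)) (onePt E S) := 
    congrArg (fun f : E →L[ℝ] E => f (VectorField.lieBracketWithin ℝ (V v) (V w)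
        ((oneChart E S).symm ⁻¹' Set.univ ∩ Set.range 𝓘(ℝ, E)) (onePt E S))) h0
  refine h1.trans ?_
  simp only [Set.preimage_univ, modelWithCornersSelf_coe, Set.range_id, Set.inter_self, 
    VectorField.lieBracketWithin_univ]
  have hV : ∀ v : E, V v =ᶠ[𝓝 (onePt E S)] fun z => leftField E S z v := key
  have hd : DifferentiableAt ℝ (leftField E S) (onePt E S) :=
    (contDiffAt_leftField E S (onePt_mem_target E S)).differentiableAt (by simp)
  have hf : ∀ v : E, fderiv ℝ (V v) (onePt E S) = 
      (fderiv ℝ (leftField E S) (onePt E S)).flip v := by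
    intro v
    rw [(hV v).fderiv_eq]
    have := hd.hasFDerivAt.clm_apply (hasFDerivAt_const v (onePt E S))
    simpa using this.fderiv
  have h0 : ∀ v : E, V v (onePt E S) = v := fun v => by
    rw [(hV v).self_of_nhds]; simp only [leftField_onePt]; rfl
  have h2 : ∀ v w : E, VectorField.lieBracket ℝ (V v) (V w) (onePt E S) = modelBracket E S v w := by
    intro v w
    rw [VectorField.lieBracket, hf, hf, h0, h0, modelBracket_apply]
    rfl
  exact h2 v w

end LieGroupBridge

/-! ### Smoothness of composition operators on continuous functions -/

section CompositionOperator

set_option synthInstance.maxHeartbeats 200000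

open Filter Topology

universe u
variable {K : Type*} [TopologicalSpace K] [CompactSpace K]
  {F G : Type u} [NormedAddCommGroup F] [NormedSpace ℝ F]
  [NormedAddCommGroup G] [NormedSpace ℝ G]

/-- Pointwise application of continuous families of linear maps. -/
def ContinuousMap.applyL (K : Type*) [TopologicalSpace K] [CompactSpace K]
    (F G : Type u) [NormedAddCommGroup F] [NormedSpace ℝ F]
    [NormedAddCommGroup G] [NormedSpace ℝ G] :
    C(K, F →L[ℝ] G) →L[ℝ] C(K, F) →L[ℝ] C(K, G) :=
  LinearMap.mkContinuous₂
    (LinearMap.mk₂ ℝ (fun (L : C(K, F →L[ℝ] G)) (γ : C(K, F)) =>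
        (⟨fun t => L t (γ t), L.continuous.clm_apply γ.continuous⟩ : C(K, G)))
      (by intros; ext; simp) (by intros; ext; simp) (by intros; ext; simp) (by intros; ext; simp)) 1
    (by
      intro L γ
      rw [one_mul, ContinuousMap.norm_le _ (by positivity)]
      intro t
      exact (L t).le_of_opNorm_le_of_le (L.norm_coe_le_norm t) (γ.norm_coe_le_norm t))

@[simp] lemma ContinuousMap.applyL_apply (L : C(K, F →L[ℝ] G)) (γ : C(K, F)) (t : K) :
    ContinuousMap.applyL K F G L γ t = L t (γ t) := rfl

/-- `g'` is uniformly continuous on the compact ball of radius `‖γ‖ + 1`, so the mean value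
inequality bounds the remainder at all points of `K` at once. -/
lemma ContinuousMap.hasFDerivAt_comp [ProperSpace F] (g : C(F, G)) (g' : C(F, F →L[ℝ] G))
    (h : ∀ x, HasFDerivAt g (g' x) x) (γ : C(K, F)) :
    HasFDerivAt (fun γ : C(K, F) => g.comp γ) (ContinuousMap.applyL K F G (g'.comp γ)) γ := by
  rw [hasFDerivAt_iff_isLittleO_nhds_zero, Asymptotics.isLittleO_iff]
  intro ε hε
  have hcomp : IsCompact (Metric.closedBall (0 : F) (‖γ‖ + 1)) := isCompact_closedBall _ _
  have huc := hcomp.uniformContinuousOn_of_continuous g'.continuous.continuousOn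
  rw [Metric.uniformContinuousOn_iff] at huc
  obtain ⟨δ, hδ, huc⟩ := huc ε hε
  filter_upwards [Metric.ball_mem_nhds (0 : C(K, F)) (lt_min hδ one_pos)] with η hη
  rw [mem_ball_zero_iff, lt_min_iff] at hη
  rw [ContinuousMap.norm_le _ (by positivity)]
  intro t
  have ht : ‖η t‖ < min δ 1 := (η.norm_coe_le_norm t).trans_lt (lt_min hη.1 hη.2)
  have hγt := γ.norm_coe_le_norm t
  have key := (convex_ball (γ t) (min δ 1)).norm_image_sub_le_of_norm_hasFDerivWithin_le'
    (f := g) (f' := g') (φ := g' (γ t)) (C := ε) (x := γ t) (y := γ t + η t)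
    (fun x _ => (h x).hasFDerivWithinAt) ?_ (Metric.mem_ball_self (lt_min hδ one_pos))
    (by simpa [Metric.mem_ball, dist_eq_norm] using ht)
  · simp only [add_sub_cancel_left] at key
    refine le_trans ?_ (key.trans (mul_le_mul_of_nonneg_left (η.norm_coe_le_norm t) hε.le))
    simp
  · intro x hx
    rw [Metric.mem_ball] at hx
    rw [← dist_eq_norm]
    refine (huc x ?_ (γ t) ?_ (hx.trans_le (min_le_left _ _))).le
    · have := hx.trans_le (min_le_right δ 1)
      rw [dist_eq_norm] at this
      rw [mem_closedBall_zero_iff]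
      calc ‖x‖ = ‖γ t + (x - γ t)‖ := by simp
        _ ≤ ‖γ t‖ + ‖x - γ t‖ := norm_add_le _ _
        _ ≤ ‖γ‖ + 1 := by linarith
    · rw [mem_closedBall_zero_iff]; linarith

/-- The derivative of composition with `g` is composition with `g'` followed by the bounded operator
`applyL`, which allows induction on the order. The target must vary, since the next one is `F →L[ℝ]
G`; hence the common universe of `F` and `G`. -/
lemma ContinuousMap.contDiff_comp_nat [ProperSpace F] (n : ℕ) :
    ∀ {G : Type u} [NormedAddCommGroup G] [NormedSpace ℝ G] (g : C(F, G)), ContDiff ℝ n g →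
      ContDiff ℝ n (fun γ : C(K, F) => g.comp γ) := by
  induction n with
  | zero =>
    intro G _ _ g _
    exact contDiff_zero.2 (ContinuousMap.continuous_postcomp g)
  | succ n ih =>
    intro G _ _ g hg
    obtain ⟨g', hg', hd⟩ := contDiff_succ_iff_hasFDerivAt.1 hg
    let g'' : C(F, F →L[ℝ] G) := ⟨g', hg'.continuous⟩
    refine contDiff_succ_iff_hasFDerivAt.2 ⟨fun γ => ContinuousMap.applyL K F G (g''.comp γ), ?_,
      fun γ => ContinuousMap.hasFDerivAt_comp g g'' hd γ⟩
    exact (ContinuousMap.applyL K F G).contDiff.comp (ih g'' hg')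

/-- The composition operator defined by a smooth function is smooth on spaces of continuous
functions. -/
theorem ContinuousMap.contDiff_comp [ProperSpace F] (g : C(F, G)) (hg : ContDiff ℝ ∞ g) :
    ContDiff ℝ ∞ (fun γ : C(K, F) => g.comp γ) :=
  contDiff_infty.2 fun n => ContinuousMap.contDiff_comp_nat n g (hg.of_le (mod_cast le_top))

end CompositionOperator

/-! ### Smooth dependence of solutions on a parameter -/

section SmoothDependence

set_option synthInstance.maxHeartbeats 200000

open Filter Topology Set

universe u
variable {E : Type u} [NormedAddCommGroup E] [NormedSpace ℝ E]

/-- The primitive vanishing at `0` of a continuous function on `[-2, 2]`. -/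
def primitiveFun (γ : C(Icc (-2 : ℝ) 2, E)) (t : ℝ) : E :=
  ∫ s in (0 : ℝ)..t, IccExtend (by norm_num : (-2 : ℝ) ≤ 2) γ s

omit [NormedSpace ℝ E] in
lemma continuous_IccExtend_coe (γ : C(Icc (-2 : ℝ) 2, E)) :
    Continuous (IccExtend (by norm_num : (-2 : ℝ) ≤ 2) γ) := γ.continuous.Icc_extend'

variable [CompleteSpace E]

lemma hasDerivAt_primitiveFun (γ : C(Icc (-2 : ℝ) 2, E)) (t : ℝ) :
    HasDerivAt (primitiveFun γ) (IccExtend (by norm_num : (-2 : ℝ) ≤ 2) γ t) t :=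
  intervalIntegral.integral_hasDerivAt_right
    ((continuous_IccExtend_coe γ).intervalIntegrable _ _)
    (continuous_IccExtend_coe γ).stronglyMeasurable.stronglyMeasurableAtFilter
    (continuous_IccExtend_coe γ).continuousAt

/-- The primitive vanishing at `0`, as an operator on continuous functions on `[-2, 2]`. -/
def primitiveL (E : Type u) [NormedAddCommGroup E] [NormedSpace ℝ E] [CompleteSpace E] :
    C(Icc (-2 : ℝ) 2, E) →L[ℝ] C(Icc (-2 : ℝ) 2, E) :=
  LinearMap.mkContinuous
    { toFun := fun γ => ⟨fun t => primitiveFun γ t,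
        (continuous_iff_continuousAt.2 fun t => (hasDerivAt_primitiveFun γ t).continuousAt).comp
          continuous_subtype_val⟩
      map_add' := by
        intro γ η; ext t
        simp only [primitiveFun, ContinuousMap.coe_mk, ContinuousMap.add_apply]
        rw [← intervalIntegral.integral_add ((continuous_IccExtend_coe γ).intervalIntegrable _ _)
          ((continuous_IccExtend_coe η).intervalIntegrable _ _)]
        rfl
      map_smul' := by
        intro c γ; ext t
        simp only [primitiveFun, ContinuousMap.coe_mk, ContinuousMap.smul_apply, RingHom.id_apply]
        rw [← intervalIntegral.integral_smul]
        rfl } 2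
    (by
      intro γ
      rw [ContinuousMap.norm_le _ (by positivity)]
      intro t
      have h := intervalIntegral.norm_integral_le_of_norm_le_const (a := (0 : ℝ)) (b := (t : ℝ))
        (C := ‖γ‖) (f := IccExtend (by norm_num : (-2 : ℝ) ≤ 2) γ)
        (fun s _ => γ.norm_coe_le_norm _)
      refine h.trans ?_
      rw [mul_comm]
      refine mul_le_mul_of_nonneg_right ?_ (norm_nonneg _)
      rw [sub_zero]; exact abs_le.2 t.2)

lemma primitiveL_apply (γ : C(Icc (-2 : ℝ) 2, E)) (t : Icc (-2 : ℝ) 2) :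
    primitiveL E γ t = primitiveFun γ t := rfl

omit [CompleteSpace E] in
/-- A smooth function on a neighbourhood of a point agrees near the point with a globally smooth
one. -/
lemma exists_contDiff_eventuallyEq [FiniteDimensional ℝ E] {G : Type*} [NormedAddCommGroup G]
    [NormedSpace ℝ G] {U : Set E} (hU : IsOpen U) {f : E → G} (hf : ∀ z ∈ U, ContDiffAt ℝ ∞ f z)
    {z₀ : E} (hz : z₀ ∈ U) : ∃ g : E → G, ContDiff ℝ ∞ g ∧ g =ᶠ[𝓝 z₀] f := by
  obtain ⟨r, hr, hrU⟩ := Metric.nhds_basis_closedBall.mem_iff.1 (hU.mem_nhds hz)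
  let χ : ContDiffBump z₀ := ⟨r / 2, r, by positivity, by linarith⟩
  refine ⟨fun z => χ z • f z, ?_, ?_⟩
  · rw [contDiff_iff_contDiffAt]
    intro z
    by_cases h : z ∈ U
    · exact χ.contDiff.contDiffAt.smul (hf z h)
    · have h1 : z ∈ (Metric.closedBall z₀ r)ᶜ := fun h' => h (hrU h')
      have h2 : (fun z => χ z • f z) =ᶠ[𝓝 z] fun _ => 0 := by
        filter_upwards [Metric.isClosed_closedBall.isOpen_compl.mem_nhds h1] with y hy
        have : χ y = 0 := χ.zero_of_le_dist (by
          have : ¬ dist y z₀ ≤ r := hy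
          exact (not_le.1 this).le)
        simp [this]
      exact contDiffAt_const.congr_of_eventuallyEq h2
  · filter_upwards [χ.eventuallyEq_one] with z hz
    simp [hz]

/-- Smooth dependence on `v` of the solution of `γ' = B(γ) v`, `γ(0) = z₀`, near `v = 0`. -/
theorem exists_contDiffAt_solution [FiniteDimensional ℝ E] {B : E → E →L[ℝ] E}
    (hB : ContDiff ℝ ∞ B) (z₀ : E) :
    ∃ Γ : E → C(Icc (-2 : ℝ) 2, E), ContDiffAt ℝ ∞ Γ 0 ∧ Γ 0 = ContinuousMap.const _ z₀ ∧
      ∀ᶠ v in 𝓝 0, (Γ v ⟨0, by norm_num⟩ = z₀) ∧ ∀ t (ht : t ∈ Ioo (-2 : ℝ) 2),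
        HasDerivAt (IccExtend (by norm_num : (-2 : ℝ) ≤ 2) (Γ v))
          (B (Γ v ⟨t, Ioo_subset_Icc_self ht⟩) v) t := by
  let Bc : C(E, E →L[ℝ] E) := ⟨B, hB.continuous⟩
  let N : E × C(Icc (-2 : ℝ) 2, E) → C(Icc (-2 : ℝ) 2, E) := fun q =>
    ContinuousMap.applyL (Icc (-2 : ℝ) 2) E E (Bc.comp q.2) (ContinuousMap.const _ q.1)
  have hconst : ContDiff ℝ ∞ (fun v : E => (ContinuousMap.const (Icc (-2 : ℝ) 2) v)) := by
    let L : E →L[ℝ] C(Icc (-2 : ℝ) 2, E) :=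
      LinearMap.mkContinuous ⟨⟨fun v => ContinuousMap.const _ v, by intros; rfl⟩, by intros; rfl⟩ 1
        (by
          intro v
          rw [one_mul, ContinuousMap.norm_le _ (norm_nonneg _)]
          intro t; exact le_rfl)
    exact L.contDiff
  have hN : ContDiff ℝ ∞ N :=
    ((ContinuousMap.applyL (Icc (-2 : ℝ) 2) E E).contDiff.comp
      ((ContinuousMap.contDiff_comp Bc hB).comp contDiff_snd)).clm_apply (hconst.comp contDiff_fst)
  -- Zeros of `H` are solutions of the integral equation. At `v = 0` the integral drops out and `H
  -- (0, γ) = γ - z₀`, so the partial derivative in `γ` is the identity and the implicit function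
  -- theorem applies on the whole interval.
  let H : E × C(Icc (-2 : ℝ) 2, E) → C(Icc (-2 : ℝ) 2, E) := fun q =>
    q.2 - ContinuousMap.const _ z₀ - primitiveL E (N q)
  have hH : ContDiff ℝ ∞ H :=
    (contDiff_snd.sub contDiff_const).sub ((primitiveL E).contDiff.comp hN)
  set u : E × C(Icc (-2 : ℝ) 2, E) := (0, ContinuousMap.const _ z₀) with hu
  have hN0 : ∀ γ, N (0, γ) = 0 := by
    intro γ; ext t
    simp [N]
  have hH0 : ∀ γ, H (0, γ) = γ - ContinuousMap.const _ z₀ := by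
    intro γ; simp [H, hN0]
  have hHu : H u = 0 := by rw [hu, hH0, sub_self]
  have hcd : ContDiffAt ℝ ∞ H u := hH.contDiffAt
  have hinr : fderiv ℝ H u ∘L .inr ℝ E (C(Icc (-2 : ℝ) 2, E)) = ContinuousLinearMap.id ℝ _ := by
    have h1 : HasFDerivAt (fun γ => H (0, γ))
        (fderiv ℝ H u ∘L .inr ℝ E (C(Icc (-2 : ℝ) 2, E))) (ContinuousMap.const _ z₀) :=
      HasFDerivAt.comp (ContinuousMap.const _ z₀) ((hH.differentiable (by simp) u).hasFDerivAt)
        (hasFDerivAt_prodMk_right 0 _)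
    have h2 : HasFDerivAt (fun γ => H (0, γ)) (ContinuousLinearMap.id ℝ _)
        (ContinuousMap.const _ z₀) := by
      simp only [hH0]
      exact (hasFDerivAt_id _).sub_const _
    exact h1.unique h2
  have hinv : (fderiv ℝ H u ∘L .inr ℝ E (C(Icc (-2 : ℝ) 2, E))).IsInvertible := by
    rw [hinr]; exact ⟨ContinuousLinearEquiv.refl ℝ _, rfl⟩
  refine ⟨hcd.implicitFunction (by simp) hinv, hcd.contDiffAt_implicitFunction (by simp) hinv,
    hcd.implicitFunction_apply_self (by simp) hinv, ?_⟩
  filter_upwards [hcd.eventually_apply_implicitFunction (by simp) hinv] with v hv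
  set γ := hcd.implicitFunction (by simp) hinv v with hγ
  rw [hHu] at hv
  have hv' : γ = ContinuousMap.const _ z₀ + primitiveL E (N (v, γ)) := by
    have : γ - ContinuousMap.const _ z₀ - primitiveL E (N (v, γ)) = 0 := hv
    rw [sub_sub, sub_eq_zero] at this
    exact this
  have hpt : ∀ t : Icc (-2 : ℝ) 2, γ t = z₀ + primitiveFun (N (v, γ)) t := fun t => by
    have := congrArg (fun f : C(Icc (-2 : ℝ) 2, E) => f t) hv'
    simpa [primitiveL_apply] using this
  refine ⟨by rw [hpt]; simp [primitiveFun], fun t ht => ?_⟩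
  have h1 : HasDerivAt (fun t => z₀ + primitiveFun (N (v, γ)) t)
      (B (γ ⟨t, Ioo_subset_Icc_self ht⟩) v) t := by
    have := (hasDerivAt_primitiveFun (N (v, γ)) t).const_add z₀
    rwa [IccExtend_of_mem _ _ (Ioo_subset_Icc_self ht)] at this
  refine h1.congr_of_eventuallyEq ?_
  filter_upwards [Ioo_mem_nhds ht.1 ht.2] with s hs
  rw [IccExtend_of_mem _ _ (Ioo_subset_Icc_self hs), hpt]

end SmoothDependence

/-! ### The exponential map: existence, one-parameter groups, smoothness -/

section LieExp

open Filter Topology Set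

universe u
variable {E : Type u} [NormedAddCommGroup E] [NormedSpace ℝ E] [FiniteDimensional ℝ E]
  {S : Type*} [TopologicalSpace S] [T2Space S] [ChartedSpace E S] [Group S]
  [LieGroup 𝓘(ℝ, E) ∞ S]

omit [T2Space S] [FiniteDimensional ℝ E] in
lemma contMDiff_one_mulInvariantVectorField (v : E) :
    ContMDiff 𝓘(ℝ, E) 𝓘(ℝ, E).tangent 1
      (fun p : S => (⟨p, mulInvariantVectorField (I := 𝓘(ℝ, E)) (G := S) v p⟩ :
        TangentBundle 𝓘(ℝ, E) S)) := by
  have : LieGroup 𝓘(ℝ, E) (minSmoothness ℝ 3) S := by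
    rw [minSmoothness_of_isRCLikeNormedField]; infer_instance
  refine (contMDiff_mulInvariantVectorField (I := 𝓘(ℝ, E)) (G := S) v).of_le ?_
  rw [minSmoothness_of_isRCLikeNormedField]
  exact one_le_two

omit [T2Space S] [FiniteDimensional ℝ E] in
lemma isMIntegralCurveOn_of_hasLeftDeriv {γ : ℝ → S} {v : E} {s : Set ℝ}
    (h : ∀ t ∈ s, HasLeftDeriv γ (ContinuousLinearMap.toSpanSingleton ℝ v) t) :
    IsMIntegralCurveOn (I := 𝓘(ℝ, E)) γ
      (fun p => mulInvariantVectorField (I := 𝓘(ℝ, E)) (G := S) v p) s := by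
  intro t ht
  have h1 : HasMFDerivAt 𝓘(ℝ, ℝ) 𝓘(ℝ, E) γ t ((1 : ℝ →L[ℝ] ℝ).smulRight
      (mulInvariantVectorField (I := 𝓘(ℝ, E)) (G := S) v (γ t))) :=
    (hasLeftDeriv_iff.1 (h t ht)).congr_mfderiv
      (ContinuousLinearMap.ext fun s => (leftMap E (γ t)).map_smul s v)
  exact h1.hasMFDerivWithinAt

omit [T2Space S] in
/-- Local existence and smooth dependence on `v` of the one-parameter curves `t ↦ exp (t v)`. -/
lemma exists_local_exp : ∃ e : E → ℝ → S, ContMDiffAt 𝓘(ℝ, E) 𝓘(ℝ, E) ∞ (fun v => e v 1) 0 ∧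
    ∀ᶠ v in 𝓝 (0 : E), e v 0 = 1 ∧ ∀ t ∈ Ioo (-2 : ℝ) 2,
      HasLeftDeriv (e v) (ContinuousLinearMap.toSpanSingleton ℝ v) t := by
  -- `leftField` is known to be smooth on the chart target only, so it is replaced by a global
  -- smooth `B` that agrees with it near `onePt`. For small `v` the solution is uniformly close to
  -- the constant one and stays where the two agree.
  obtain ⟨B, hB, hBeq⟩ := exists_contDiff_eventuallyEq (isOpen_oneChart_target E S)
    (fun z hz => contDiffAt_leftField E S hz) (onePt_mem_target E S)
  obtain ⟨Γ, hΓ, hΓ0, hsol⟩ := exists_contDiffAt_solution hB (onePt E S)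
  have h1 : (1 : ℝ) ∈ Icc (-2 : ℝ) 2 := by norm_num
  refine ⟨fun v t => (oneChart E S).symm (IccExtend (by norm_num : (-2 : ℝ) ≤ 2) (Γ v) t), ?_, ?_⟩
  · let L : C(Icc (-2 : ℝ) 2, E) →L[ℝ] E := ContinuousMap.evalCLM ℝ ⟨1, h1⟩
    have h2 : ContDiffAt ℝ ∞ (fun v => Γ v ⟨1, h1⟩) 0 := L.contDiff.contDiffAt.comp (0 : E) hΓ
    have h3 : ContMDiffAt 𝓘(ℝ, E) 𝓘(ℝ, E) ∞ (oneChart E S).symm (Γ 0 ⟨1, h1⟩) := by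
      rw [hΓ0]; exact contMDiffAt_oneChart_symm E S (onePt_mem_target E S)
    have h4 := h3.comp (0 : E) h2.contMDiffAt
    refine h4.congr_of_eventuallyEq (Eventually.of_forall fun v => ?_)
    simp only [Function.comp]
    rw [IccExtend_of_mem _ _ h1]
  · obtain ⟨r, hr, hball⟩ := Metric.eventually_nhds_iff_ball.1
      (hBeq.and ((isOpen_oneChart_target E S).mem_nhds (onePt_mem_target E S)))
    have hnear : ∀ᶠ v in 𝓝 (0 : E), dist (Γ v) (Γ 0) < r :=
      hΓ.continuousAt.eventually (Metric.ball_mem_nhds _ hr)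
    filter_upwards [hsol, hnear] with v hv hvr
    rw [hΓ0] at hvr
    have hmem : ∀ t, Γ v t ∈ Metric.ball (onePt E S) r := fun t => by
      have := (ContinuousMap.dist_lt_iff hr).1 hvr t
      simpa using this
    refine ⟨?_, fun t ht => ?_⟩
    · rw [IccExtend_of_mem _ _ (by norm_num : (0 : ℝ) ∈ Icc (-2 : ℝ) 2), hv.1, oneChart_symm_onePt]
    · have h5 := hv.2 t ht
      have h6 := hball _ (hmem ⟨t, Ioo_subset_Icc_self ht⟩)
      apply hasLeftDeriv_oneChart_symm
      · rw [IccExtend_of_mem _ _ (Ioo_subset_Icc_self ht)]; exact h6.2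
      · rw [IccExtend_of_mem _ _ (Ioo_subset_Icc_self ht), ← h6.1]
        refine h5.hasFDerivAt.congr_fderiv ?_
        ext
        simp

/-- For a small multiple `k • v` the local solution lives on `(-2, 2)`, and its left translates give
every point an integral curve with that same lifespan; a uniform lifespan implies completeness.
Rescaling time by `k⁻¹` returns to `v`. -/
lemma exists_isMIntegralCurve_one (v : E) : ∃ γ : ℝ → S, γ 0 = 1 ∧
    IsMIntegralCurve (I := 𝓘(ℝ, E)) γ
      (fun p => mulInvariantVectorField (I := 𝓘(ℝ, E)) (G := S) v p) := by
  obtain ⟨e, -, he⟩ := exists_local_exp (E := E) (S := S)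
  have htend : Tendsto (fun k : ℝ => k • v) (𝓝[>] 0) (𝓝 0) := by
    have : Continuous fun k : ℝ => k • v := by fun_prop
    simpa using (this.tendsto 0).mono_left nhdsWithin_le_nhds
  obtain ⟨k, hk, hkpos⟩ := ((htend.eventually he).and self_mem_nhdsWithin).exists
  have hkpos : 0 < k := hkpos
  obtain ⟨γ, hγ0, hγ⟩ := exists_isMIntegralCurve_of_isMIntegralCurveOn
    (contMDiff_one_mulInvariantVectorField (S := S) (k • v)) (ε := 2) (by norm_num)
    (fun p => ⟨fun t => p * e (k • v) t, by simp [hk.1],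
      isMIntegralCurveOn_of_hasLeftDeriv fun t ht => (hk.2 t ht).const_mul p⟩) 1
  refine ⟨γ ∘ (· * k⁻¹), by simp [hγ0], ?_⟩
  apply isMIntegralCurve_of_hasLeftDeriv
  intro t
  have h1 := hasLeftDeriv_of_isMIntegralCurve hγ (t * k⁻¹)
  have h2 := h1.comp (f := fun t => t * k⁻¹) (q := t) ((hasDerivAt_mul_const k⁻¹).hasFDerivAt)
  have h3 : ContinuousLinearMap.toSpanSingleton ℝ v =
      ContinuousLinearMap.toSpanSingleton ℝ (k • v) ∘L ContinuousLinearMap.toSpanSingleton ℝ k⁻¹ := by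
    ext
    simp [smul_smul, hkpos.ne']
  rw [h3]
  exact h2

/-- The one-parameter subgroup generated by `v`. -/
lemma lieExp_curve (v : E) : ∃ γ : ℝ → S, γ 0 = 1 ∧ lieExp (S := S) v = γ 1 ∧
    ∀ t, HasLeftDeriv γ (ContinuousLinearMap.toSpanSingleton ℝ v) t := by
  have h := exists_isMIntegralCurve_one (S := S) v
  refine ⟨h.choose, h.choose_spec.1, ?_, hasLeftDeriv_of_isMIntegralCurve h.choose_spec.2⟩
  unfold lieExp
  exact dif_pos h

omit [FiniteDimensional ℝ E] in
lemma eq_of_hasLeftDeriv {γ γ' : ℝ → S} {v : E} {T : ℝ}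
    (h : ∀ t ∈ Ioo (-T) T, HasLeftDeriv γ (ContinuousLinearMap.toSpanSingleton ℝ v) t)
    (h' : ∀ t ∈ Ioo (-T) T, HasLeftDeriv γ' (ContinuousLinearMap.toSpanSingleton ℝ v) t)
    (h0 : γ 0 = γ' 0) {t : ℝ} (ht : t ∈ Ioo (-T) T) : γ t = γ' t := by
  have hT : 0 < T := by have := ht.1; have := ht.2; linarith
  exact isMIntegralCurveOn_Ioo_eqOn_of_contMDiff_boundaryless (t₀ := 0)
    ⟨by linarith, hT⟩ (contMDiff_one_mulInvariantVectorField (S := S) v)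
    (isMIntegralCurveOn_of_hasLeftDeriv h) (isMIntegralCurveOn_of_hasLeftDeriv h') h0 ht

omit [FiniteDimensional ℝ E] in
lemma eq_of_hasLeftDeriv' {γ γ' : ℝ → S} {v : E}
    (h : ∀ t, HasLeftDeriv γ (ContinuousLinearMap.toSpanSingleton ℝ v) t)
    (h' : ∀ t, HasLeftDeriv γ' (ContinuousLinearMap.toSpanSingleton ℝ v) t)
    (h0 : γ 0 = γ' 0) (t : ℝ) : γ t = γ' t :=
  eq_of_hasLeftDeriv (T := |t| + 1) (fun t _ => h t) (fun t _ => h' t) h0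
    ⟨by linarith [neg_abs_le t], by linarith [le_abs_self t]⟩

/-- By uniqueness of integral curves, a curve with constant logarithmic derivative is a left
translate of a one-parameter group. Identities for `exp` are obtained below by exhibiting such
curves. -/
lemma lieExp_smul_eq {γ : ℝ → S} {v : E}
    (h : ∀ t, HasLeftDeriv γ (ContinuousLinearMap.toSpanSingleton ℝ v) t) (t : ℝ) :
    γ t = γ 0 * lieExp (S := S) (t • v : E) := by
  obtain ⟨γ', h0, h1, hd⟩ := lieExp_curve (S := S) (t • v : E)
  rw [h1]
  have h2 : ∀ s, HasLeftDeriv (fun s => γ (s * t)) (ContinuousLinearMap.toSpanSingleton ℝ (t • v)) s := by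
    intro s
    have := (h (s * t)).comp (f := fun s => s * t) (q := s) ((hasDerivAt_mul_const t).hasFDerivAt)
    convert this using 1
    ext
    simp
  have := eq_of_hasLeftDeriv' h2 (fun s => (hd s).const_mul (γ 0)) (by simp [h0]) 1
  simpa using this

/-- `t ↦ exp (t v)` is the one-parameter group generated by `v`. -/
lemma hasLeftDeriv_lieExp_smul (v : E) (t : ℝ) :
    HasLeftDeriv (fun t : ℝ => lieExp (S := S) (t • v : E))
      (ContinuousLinearMap.toSpanSingleton ℝ v) t := by
  obtain ⟨γ, h0, h1, hd⟩ := lieExp_curve (S := S) v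
  have : (fun t : ℝ => lieExp (S := S) (t • v : E)) = γ := by
    funext t
    rw [lieExp_smul_eq hd t, h0, one_mul]
  rw [this]; exact hd t

lemma lieExp_zero : lieExp (S := S) (0 : E) = 1 := by
  obtain ⟨γ, h0, h1, hd⟩ := lieExp_curve (S := S) (0 : E)
  have := lieExp_smul_eq hd 0
  simpa using this.symm

lemma lieExp_add_smul (v : E) (s t : ℝ) : lieExp (S := S) ((s + t) • v : E) =
    lieExp (S := S) (s • v : E) * lieExp (S := S) (t • v : E) := by
  have h : ∀ t, HasLeftDeriv (fun t : ℝ => lieExp (S := S) ((s + t) • v : E))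
      (ContinuousLinearMap.toSpanSingleton ℝ v) t := fun t => by
    have := (hasLeftDeriv_lieExp_smul (S := S) v (s + t)).comp (f := fun t => s + t) (q := t)
      ((hasDerivAt_id t).const_add s).hasFDerivAt
    convert this using 1
    ext; simp
  simpa using lieExp_smul_eq h t

lemma lieExp_nsmul (v : E) (k : ℕ) : lieExp (S := S) ((k : ℝ) • v : E) = lieExp (S := S) v ^ k := by
  induction k with
  | zero => simp [lieExp_zero]
  | succ k ih => rw [Nat.cast_succ, lieExp_add_smul, ih, one_smul, pow_succ]

/-- Uniqueness identifies the chosen integral curves with the smooth local family of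
`exists_local_exp`. -/
lemma contMDiffAt_lieExp_zero : ContMDiffAt 𝓘(ℝ, E) 𝓘(ℝ, E) ∞ (fun v : E => lieExp (S := S) v) 0 := by
  obtain ⟨e, he, hev⟩ := exists_local_exp (E := E) (S := S)
  refine he.congr_of_eventuallyEq ?_
  filter_upwards [hev] with v hv
  have := eq_of_hasLeftDeriv (T := 2) hv.2 (fun t _ => hasLeftDeriv_lieExp_smul (S := S) v t)
    (by simp [hv.1, lieExp_zero]) (t := 1) (by norm_num)
  simpa using this.symm

/-- The exponential map of a Lie group is smooth. -/
theorem contMDiff_lieExp : ContMDiff 𝓘(ℝ, E) 𝓘(ℝ, E) ∞ (fun v : E => lieExp (S := S) v) := by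
  rw [contMDiff_infty]
  -- A finite order is fixed: smoothness of finite order at a point spreads to a neighbourhood.
  intro n v
  have h0 : ContMDiffAt 𝓘(ℝ, E) 𝓘(ℝ, E) n (fun v : E => lieExp (S := S) v) 0 :=
    contMDiffAt_lieExp_zero.of_le (mod_cast le_top)
  have hev : ∀ᶠ v in 𝓝 (0 : E), ContMDiffAt 𝓘(ℝ, E) 𝓘(ℝ, E) n (fun v : E => lieExp (S := S) v) v :=
    (contMDiffAt_iff_contMDiffAt_nhds (by simp)).1 h0
  have htend : Tendsto (fun k : ℕ => ((k : ℝ) + 1)⁻¹ • v) atTop (𝓝 0) := by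
    have := (tendsto_one_div_add_atTop_nhds_zero_nat (𝕜 := ℝ)).smul_const v
    simpa using this
  obtain ⟨k, hk⟩ := (htend.eventually hev).exists
  have hk0 : ((k : ℝ) + 1) ≠ 0 := by positivity
  -- `v / (k + 1)` lies in the neighbourhood of 0 where smoothness is known, and `exp v` is the `(k
  -- + 1)`-st power of its image.
  have heq : (fun v : E => lieExp (S := S) v) =
      fun v => (lieExp (S := S) (((k : ℝ) + 1)⁻¹ • v : E)) ^ (k + 1) := by
    funext v
    rw [← lieExp_nsmul, Nat.cast_succ, smul_smul, mul_inv_cancel₀ hk0, one_smul]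
  rw [heq]
  have h1 : ContMDiffAt 𝓘(ℝ, E) 𝓘(ℝ, E) n
      (fun v : E => lieExp (S := S) (((k : ℝ) + 1)⁻¹ • v : E)) v :=
    ContMDiffAt.comp v hk (contDiff_const_smul _).contDiffAt.contMDiffAt
  have h2 : ∀ j : ℕ, ContMDiffAt 𝓘(ℝ, E) 𝓘(ℝ, E) n
      (fun v : E => (lieExp (S := S) (((k : ℝ) + 1)⁻¹ • v : E)) ^ j) v := by
    intro j
    induction j with
    | zero => simpa using contMDiffAt_const
    | succ j ih =>
      simp only [pow_succ]
      exact ih.mul h1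
  exact h2 (k + 1)

end LieExp

/-! ### The derivative of the exponential map -/

section DExp

open Filter Topology Set

universe u
variable {E : Type u} [NormedAddCommGroup E] [NormedSpace ℝ E] [FiniteDimensional ℝ E]
  {S : Type*} [TopologicalSpace S] [T2Space S] [ChartedSpace E S] [Group S]
  [LieGroup 𝓘(ℝ, E) ∞ S]

variable (E S) in
/-- The logarithmic derivative `exp(x)⁻¹ d exp_x` of the exponential map. -/
def dexp : E → E →L[ℝ] E := leftDeriv E (fun v : E => lieExp (S := S) v)

variable (S) in
lemma contDiff_dexp : ContDiff ℝ ∞ (dexp E S) := contDiff_leftDeriv contMDiff_lieExp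

variable (S) in
lemma hasLeftDeriv_lieExp (x : E) :
    HasLeftDeriv (fun v : E => lieExp (S := S) v) (dexp E S x) x :=
  contMDiff_lieExp.hasLeftDeriv x

-- Along the ray through `x` the exponential is a one-parameter group, whose logarithmic derivative
-- is constantly `x`.
variable (S) in
lemma dexp_smul_self (x : E) (s : ℝ) : dexp E S (s • x) x = x := by
  have h1 := hasLeftDeriv_lieExp_smul (S := S) x s
  have h2 := (hasLeftDeriv_lieExp S (s • x)).comp (f := fun s : ℝ => s • x) (q := s)
    ((hasDerivAt_id s).smul_const x).hasFDerivAt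
  have h3 := h1.leftDeriv_eq.symm.trans h2.leftDeriv_eq
  have h4 := congrArg (fun f : ℝ →L[ℝ] E => f 1) h3
  simpa using h4.symm

variable (S) in
lemma dexp_self (x : E) : dexp E S x x = x := by simpa using dexp_smul_self S x 1

-- Maurer-Cartan in the directions `x, η` is combined with the derivative along `η` of the radial
-- identity `dexp y y = y`. The factor `s` makes the equation one with constant coefficients and
-- initial value 0.
variable (S) in
lemma hasDerivAt_smul_dexp (x η : E) (s : ℝ) :
    HasDerivAt (fun s : ℝ => s • dexp E S (s • x) η)
      (η - modelBracket E S x (s • dexp E S (s • x) η)) s := by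
  have hd : ∀ y, HasFDerivAt (dexp E S) (fderiv ℝ (dexp E S) y) y := fun y =>
    ((contDiff_dexp S).differentiable (by simp)).differentiableAt.hasFDerivAt
  have hself : fderiv ℝ (dexp E S) (s • x) η (s • x) + dexp E S (s • x) η = η := by
    have h1 := (hd (s • x)).clm_apply (hasFDerivAt_id (s • x))
    have h2 : HasFDerivAt (fun y => dexp E S y y) (ContinuousLinearMap.id ℝ E) (s • x) := by
      simp only [dexp_self]
      exact hasFDerivAt_id (𝕜 := ℝ) (s • x)
    have h3 := congrArg (fun f : E →L[ℝ] E => f η) (h1.unique h2)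
    simpa [add_comm] using h3
  have hMC := leftDeriv_maurerCartan (c := fun v : E => lieExp (S := S) v) contMDiff_lieExp
    (s • x) x η
  change fderiv ℝ (dexp E S) (s • x) x η - fderiv ℝ (dexp E S) (s • x) η x
    + modelBracket E S (dexp E S (s • x) x) (dexp E S (s • x) η) = 0 at hMC
  rw [dexp_smul_self] at hMC
  have h4 : HasDerivAt (fun s : ℝ => dexp E S (s • x)) (fderiv ℝ (dexp E S) (s • x) x) s := by
    have h6 : HasDerivAt (fun s : ℝ => s • x) x s := by
      simpa using (hasDerivAt_id s).smul_const x
    exact (hd (s • x)).comp_hasDerivAt s h6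
  have h5 := (hasDerivAt_id s).smul (h4.clm_apply (hasDerivAt_const s η))
  refine h5.congr_deriv ?_
  simp only [id, one_smul, map_zero, add_zero, map_smul] at hself ⊢
  have e1 : fderiv ℝ (dexp E S) (s • x) x η = fderiv ℝ (dexp E S) (s • x) η x
    - modelBracket E S x (dexp E S (s • x) η) := by
    rw [← sub_eq_zero, ← hMC]; abel
  rw [e1, smul_sub]
  nth_rewrite 4 [← hself]
  abel

/-- The formula `exp(x)⁻¹ d exp_x = (1 - e^{-ad x}) / ad x` on vectors killed by a power of `ad x`. -/
theorem dexp_apply_eq_sum (x η : E) (m : ℕ) (h : (modelBracket E S x ^ m) η = 0) :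
    dexp E S x η = ∑ k ∈ Finset.range m,
      ((-1 : ℝ) ^ k / (k + 1).factorial) • (modelBracket E S x ^ k) η := by
  -- The power series solution of `Y' = η - [x, Y]`, `Y 0 = 0`. It terminates because the `m`-th
  -- power of `ad x` kills `η`; at `s = 1` it is the claimed sum.
  set Y : ℝ → E := fun s => ∑ k ∈ Finset.range m,
    (s ^ (k + 1) * ((-1 : ℝ) ^ k / (k + 1).factorial)) • (modelBracket E S x ^ k) η with hY
  have hYd : ∀ s, HasDerivAt Y (η - modelBracket E S x (Y s)) s := by
    intro s
    have h1 : HasDerivAt Y (∑ k ∈ Finset.range m,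
        (s ^ k * ((-1 : ℝ) ^ k / k.factorial)) • (modelBracket E S x ^ k) η) s := by
      refine HasDerivAt.fun_sum fun k _ => ?_
      refine (((hasDerivAt_pow (k + 1) s).mul_const _).smul_const _).congr_deriv ?_
      congr 1
      rw [Nat.factorial_succ]
      have : ((k : ℝ) + 1) ≠ 0 := by positivity
      push_cast
      field_simp
    refine h1.congr_deriv ?_
    rw [hY]
    simp only [map_sum, map_smul]
    have h2 : ∀ k, modelBracket E S x ((modelBracket E S x ^ k) η) = (modelBracket E S x ^ (k + 1)) η :=
      fun k => by rw [pow_succ']; rfl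
    simp only [h2]
    have h3 := Finset.sum_range_succ' (fun k => (s ^ k * ((-1 : ℝ) ^ k / k.factorial)) •
      (modelBracket E S x ^ k) η) m
    rw [Finset.sum_range_succ, h, smul_zero, add_zero] at h3
    rw [h3, eq_sub_iff_add_eq, add_right_comm, ← Finset.sum_add_distrib, Finset.sum_eq_zero]
    · simp
    · intro k _
      rw [← add_smul]
      convert zero_smul ℝ _ using 2
      rw [pow_succ (-1 : ℝ)]
      ring
  have huniq : (fun s : ℝ => s • dexp E S (s • x) η) = Y :=
    ODE_solution_unique_univ (v := fun _ y => η - modelBracket E S x y) (s := fun _ => univ)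
      (t₀ := 0) (K := ‖modelBracket E S x‖₊)
      (fun _ => by
        refine LipschitzWith.lipschitzOnWith ?_
        refine LipschitzWith.of_dist_le_mul fun a b => ?_
        rw [dist_sub_left, dist_eq_norm, ← map_sub, dist_eq_norm]
        exact (modelBracket E S x).le_opNorm _)
      (fun s => ⟨hasDerivAt_smul_dexp S x η s, mem_univ _⟩) (fun s => ⟨hYd s, mem_univ _⟩)
      (by simp [hY])
  have := congrFun huniq 1
  simpa [hY] using this

end DExp

/-! ### The polynomials P, the grading, and the Bernoulli series -/

section StructPoly

open MvPolynomial

lemma isHomogeneous_linPoly {m : ℕ} {d : Fin m → ℕ}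
    (C : CoordIndex d → CoordIndex d → CoordIndex d → ℝ) (a b : CoordIndex d) :
    (linPoly C a b).IsHomogeneous 1 :=
  IsHomogeneous.sum _ _ _ fun c _ => by
    simpa using (isHomogeneous_C (CoordIndex d) (C c a b)).mul (isHomogeneous_X ℝ c)

lemma isHomogeneous_homPoly {m : ℕ} {d : Fin m → ℕ}
    (C : CoordIndex d → CoordIndex d → CoordIndex d → ℝ) (r : ℕ) (a b : CoordIndex d) :
    (homPoly C r a b).IsHomogeneous (r + 1) := by
  induction r generalizing b with
  | zero => exact isHomogeneous_linPoly C a b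
  | succ r ih => exact IsHomogeneous.sum _ _ _ fun c _ => (ih c).mul (isHomogeneous_linPoly C c b)

lemma totalDegree_structPoly_lt {m : ℕ} {d : Fin m → ℕ} (hm : 0 < m)
    (C : CoordIndex d → CoordIndex d → CoordIndex d → ℝ) (a b : CoordIndex d) :
    (structPoly C a b).totalDegree < m := by
  unfold structPoly
  split_ifs
  · simpa
  · simpa
  · refine lt_of_le_of_lt (totalDegree_finsetSum_le (d := m - 1) fun r hr => ?_) (by omega)
    rw [Finset.mem_Icc] at hr
    refine (totalDegree_mul _ _).trans ?_
    rw [totalDegree_C, zero_add]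
    exact (isHomogeneous_homPoly C (r - 1) a b).totalDegree_le.trans (by omega)

/-- The recursion runs over blocks below that of `b`, and each factor `linPoly C c b` involves only
variables from such blocks. This triangularity later gives global flows and injectivity. -/
lemma eval_homPoly_congr {m : ℕ} {d : Fin m → ℕ}
    (C : CoordIndex d → CoordIndex d → CoordIndex d → ℝ) (r : ℕ) (a b : CoordIndex d)
    {x y : CoordIndex d → ℝ} (h : ∀ c : CoordIndex d, c.1 < b.1 → x c = y c) :
    eval x (homPoly C r a b) = eval y (homPoly C r a b) := by
  have hlin : ∀ a b : CoordIndex d, (∀ c : CoordIndex d, c.1 < b.1 → x c = y c) →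
      eval x (linPoly C a b) = eval y (linPoly C a b) := by
    intro a b h
    simp only [linPoly, map_sum, map_mul, eval_C, eval_X]
    exact Finset.sum_congr rfl fun c hc => by rw [h c (Finset.mem_filter.1 hc).2]
  induction r generalizing b with
  | zero => exact hlin a b h
  | succ r ih =>
    simp only [homPoly, map_sum, map_mul]
    refine Finset.sum_congr rfl fun c hc => ?_
    rw [hlin c b h, ih c fun e he => h e (he.trans (Finset.mem_filter.1 hc).2)]

/-- `P^{iα}_{jβ}` depends on the variables `x^k` with `k < α` only. -/
lemma eval_structPoly_congr {m : ℕ} {d : Fin m → ℕ}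
    (C : CoordIndex d → CoordIndex d → CoordIndex d → ℝ) (a b : CoordIndex d)
    {x y : CoordIndex d → ℝ} (h : ∀ c : CoordIndex d, c.1 < b.1 → x c = y c) :
    eval x (structPoly C a b) = eval y (structPoly C a b) := by
  unfold structPoly
  split_ifs
  · simp
  · simp
  · simp only [map_sum, map_mul, eval_C]
    exact Finset.sum_congr rfl fun r _ => by rw [eval_homPoly_congr C _ a b h]

lemma contDiff_eval {ι : Type*} [Fintype ι] (p : MvPolynomial ι ℝ) :
    ContDiff ℝ ∞ (fun x : ι → ℝ => eval x p) := by
  induction p using MvPolynomial.induction_on with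
  | C a => simpa using contDiff_const
  | add p q hp hq => simpa using hp.add hq
  | mul_X p i hp => simpa using hp.mul (contDiff_apply ℝ ℝ i)

/-- The matrix of `ad x` on `𝔫` (acting on row vectors). -/
def adMatrix {m : ℕ} {d : Fin m → ℕ} (C : CoordIndex d → CoordIndex d → CoordIndex d → ℝ)
    (x : CoordIndex d → ℝ) : Matrix (CoordIndex d) (CoordIndex d) ℝ :=
  Matrix.of fun a b => ∑ c, x c * C c a b

/-- The structure constants respect the grading by the eigenvalues of `ad A`. -/
def IsGraded {m : ℕ} {d : Fin m → ℕ} (C : CoordIndex d → CoordIndex d → CoordIndex d → ℝ)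
    (lam : Fin m → ℝ) : Prop :=
  (∀ i, 0 < d i → 0 < lam i) ∧ StrictMono lam ∧ ∀ a b c, C a b c ≠ 0 → lam c.1 = lam a.1 + lam b.1

variable {m : ℕ} {d : Fin m → ℕ} {C : CoordIndex d → CoordIndex d → CoordIndex d → ℝ}
  {lam : Fin m → ℝ}

/-- The eigenvalue of a nonzero bracket component is a sum of two positive ones, so it exceeds each
of them. -/
lemma IsGraded.lt_left (h : IsGraded C lam) {a b c : CoordIndex d} (hc : C a b c ≠ 0) :
    a.1 < c.1 := by
  rw [← h.2.1.lt_iff_lt, h.2.2 a b c hc]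
  linarith [h.1 b.1 b.2.pos]

lemma IsGraded.lt_right (h : IsGraded C lam) {a b c : CoordIndex d} (hc : C a b c ≠ 0) :
    b.1 < c.1 := by
  rw [← h.2.1.lt_iff_lt, h.2.2 a b c hc]
  linarith [h.1 a.1 a.2.pos]

/-- The restriction `c.1 < b.1` discards only vanishing structure constants. -/
lemma IsGraded.eval_linPoly (h : IsGraded C lam) (a b : CoordIndex d) (x : CoordIndex d → ℝ) :
    eval x (linPoly C a b) = adMatrix C x a b := by
  simp only [linPoly, map_sum, map_mul, eval_C, eval_X, adMatrix, Matrix.of_apply]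
  rw [Finset.sum_filter_of_ne]
  · exact Finset.sum_congr rfl fun c _ => mul_comm _ _
  · intro c _ hc
    exact h.lt_left (left_ne_zero_of_mul hc)

lemma IsGraded.adMatrix_eq_zero (h : IsGraded C lam) {a b : CoordIndex d} (x : CoordIndex d → ℝ)
    (hab : b.1 ≤ a.1) : adMatrix C x a b = 0 := by
  refine Finset.sum_eq_zero fun c _ => ?_
  by_contra hc
  exact absurd (h.lt_right (right_ne_zero_of_mul hc)) (not_lt.2 hab)

/-- Strict triangularity makes the restricted sum in the recursion a full matrix product. The
exponent is `r + 1` because `homPoly C r` stands for `p(x, r + 1)`. -/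
lemma IsGraded.eval_homPoly (h : IsGraded C lam) (r : ℕ) (a b : CoordIndex d)
    (x : CoordIndex d → ℝ) : eval x (homPoly C r a b) = (adMatrix C x ^ (r + 1)) a b := by
  induction r generalizing b with
  | zero => rw [zero_add, pow_one]; exact h.eval_linPoly a b x
  | succ r ih =>
    simp only [homPoly, map_sum, map_mul, ih, h.eval_linPoly]
    rw [Finset.sum_filter_of_ne, pow_succ _ (r + 1), Matrix.mul_apply]
    intro c _ hc
    by_contra hcb
    exact hc (by rw [h.adMatrix_eq_zero x (not_lt.1 hcb), mul_zero])

/-- Each factor raises the block index by at least one; with only `m` blocks the `m`-th power is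
therefore zero. -/
lemma IsGraded.adMatrix_pow_eq_zero (h : IsGraded C lam) (x : CoordIndex d → ℝ) (r : ℕ)
    {a b : CoordIndex d} (hab : (b.1 : ℕ) < a.1 + r) : (adMatrix C x ^ r) a b = 0 := by
  induction r generalizing b with
  | zero =>
    rw [pow_zero, Matrix.one_apply_ne]
    rintro rfl
    simp at hab
  | succ r ih =>
    rw [pow_succ, Matrix.mul_apply]
    refine Finset.sum_eq_zero fun c _ => ?_
    by_cases hc : (c.1 : ℕ) < a.1 + r
    · rw [ih hc, zero_mul]
    · rw [h.adMatrix_eq_zero (a := c) x (by rw [Fin.le_def]; omega), mul_zero]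

lemma IsGraded.adMatrix_pow_m (h : IsGraded C lam) (x : CoordIndex d → ℝ) :
    adMatrix C x ^ m = 0 := by
  ext a b
  exact h.adMatrix_pow_eq_zero x m (by have := b.1.2; omega)

/-- The Kronecker delta is the term `r = 0`, as `B_0 = 1`. For `b.1 ≤ a.1` all terms with `r ≥ 1`
vanish, otherwise the delta does, so the two cases of the definition are one truncated series. -/
lemma IsGraded.eval_structPoly (h : IsGraded C lam) (a b : CoordIndex d) (x : CoordIndex d → ℝ) :
    eval x (structPoly C a b) = ∑ r ∈ Finset.range m,
      ((bernoulli' r : ℝ) / (r.factorial : ℝ)) * (adMatrix C x ^ r) a b := by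
  have hm : 0 < m := a.1.pos
  obtain ⟨k, rfl⟩ : ∃ k, m = k + 1 := ⟨m - 1, by omega⟩
  rw [Finset.sum_range_succ']
  simp only [pow_zero, Nat.factorial_zero, bernoulli'_zero, Rat.cast_one, Nat.cast_one, div_one,
    one_mul]
  unfold structPoly
  split_ifs with h1 h2
  · rw [Finset.sum_eq_zero, h2]
    · simp
    · intro r _
      rw [h.adMatrix_pow_eq_zero x (r + 1) (by rw [Fin.le_def] at h1; omega), mul_zero]
  · rw [Finset.sum_eq_zero, Matrix.one_apply_ne h2]
    · simp
    · intro r _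
      rw [h.adMatrix_pow_eq_zero x (r + 1) (by rw [Fin.le_def] at h1; omega), mul_zero]
  · rw [Matrix.one_apply_ne (by rintro rfl; exact h1 le_rfl), add_zero, map_sum,
      Nat.add_sub_cancel, ← Finset.Ico_add_one_right_eq_Icc, Finset.sum_Ico_eq_sum_range]
    refine Finset.sum_congr (by simp) fun r _ => ?_
    rw [map_mul, eval_C, h.eval_homPoly, add_comm 1 r, Nat.add_sub_cancel]

/-- The power series of `(1 - e^{-T}) / T`. -/
def dexpSeries : PowerSeries ℝ := PowerSeries.mk fun k => (-1 : ℝ) ^ k / (k + 1).factorial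

/-- With `B_1 = 1/2` the generating series is `T e^T / (e^T - 1) = T / (1 - e^{-T})`. The identity
is proved after multiplication by `T e^T`, a nonzero element of a domain. -/
lemma bernoulli'PowerSeries_mul_dexpSeries : bernoulli'PowerSeries ℝ * dexpSeries = 1 := by
  have h1 : PowerSeries.X * dexpSeries = 1 - PowerSeries.evalNegHom (PowerSeries.exp ℝ) := by
    ext n
    cases n with
    | zero =>
      simp only [PowerSeries.evalNegHom, map_sub, PowerSeries.coeff_rescale, PowerSeries.coeff_exp]
      simp
    | succ n =>
      simp [PowerSeries.evalNegHom, dexpSeries, PowerSeries.coeff_succ_X_mul,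
        PowerSeries.coeff_exp, PowerSeries.coeff_one, pow_succ]
      ring
  have h2 := PowerSeries.exp_mul_exp_neg_eq_one (A := ℝ)
  have h3 := bernoulli'PowerSeries_mul_exp_sub_one ℝ
  have h4 : PowerSeries.X * PowerSeries.exp ℝ ≠ 0 := by
    refine mul_ne_zero PowerSeries.X_ne_zero ?_
    intro h0
    rw [h0, zero_mul] at h2
    exact zero_ne_one h2
  refine mul_left_cancel₀ h4 ?_
  calc PowerSeries.X * PowerSeries.exp ℝ * (bernoulli'PowerSeries ℝ * dexpSeries)
      = bernoulli'PowerSeries ℝ * (PowerSeries.exp ℝ * (PowerSeries.X * dexpSeries)) := by ring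
    _ = bernoulli'PowerSeries ℝ * (PowerSeries.exp ℝ - 1) := by rw [h1, mul_sub, h2, mul_one]
    _ = _ := by rw [h3, mul_one]

/-- The truncations of two reciprocal series are inverse modulo `X ^ m`, and `X ^ m` evaluates to `M
^ m = 0`. -/
lemma sum_bernoulli_mul_sum_dexp {R : Type*} [Ring R] [Algebra ℝ R] {M : R} {m : ℕ}
    (hM : M ^ m = 0) :
    (∑ r ∈ Finset.range m, ((bernoulli' r : ℝ) / (r.factorial : ℝ)) • M ^ r) *
      (∑ k ∈ Finset.range m, ((-1 : ℝ) ^ k / (k + 1).factorial) • M ^ k) = 1 := by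
  have e1 : ∀ f : PowerSeries ℝ, Polynomial.aeval M (PowerSeries.trunc m f) =
      ∑ r ∈ Finset.range m, (PowerSeries.coeff r f) • M ^ r := by
    intro f
    rw [PowerSeries.trunc_apply, map_sum, Nat.Ico_zero_eq_range]
    refine Finset.sum_congr rfl fun r _ => ?_
    rw [Polynomial.aeval_monomial, Algebra.smul_def]
  have h1 : Polynomial.X ^ m ∣ PowerSeries.trunc m (bernoulli'PowerSeries ℝ) *
      PowerSeries.trunc m dexpSeries - 1 := by
    rw [Polynomial.X_pow_dvd_iff]
    intro n hn
    have := PowerSeries.coeff_mul_eq_coeff_trunc_mul_trunc (bernoulli'PowerSeries ℝ) dexpSeries hn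
    rw [bernoulli'PowerSeries_mul_dexpSeries, ← Polynomial.coe_mul, Polynomial.coeff_coe] at this
    rw [Polynomial.coeff_sub, ← this, Polynomial.coeff_one, PowerSeries.coeff_one, sub_self]
  obtain ⟨q, hq⟩ := h1
  have h2 := congrArg (Polynomial.aeval M) hq
  rw [map_sub, map_mul, map_mul, map_pow, Polynomial.aeval_X, hM, zero_mul, map_one, sub_eq_zero,
    e1, e1] at h2
  rw [← h2]
  simp [bernoulli'PowerSeries, dexpSeries]

end StructPoly

/-! ### Expansion in an orthonormal family -/

section LinearAlgebra

variable {V : Type*} [AddCommGroup V] [Module ℝ V]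

lemma eq_sum_of_mem_span {ι : Type*} [Fintype ι] [DecidableEq ι] {f : ι → V →ₗ[ℝ] ℝ} {X : ι → V}
    (h : ∀ a b, f a (X b) = if b = a then 1 else 0) {v : V}
    (hv : v ∈ Submodule.span ℝ (Set.range X)) : v = ∑ a, f a v • X a := by
  induction hv using Submodule.span_induction with
  | mem v hv =>
    obtain ⟨b, rfl⟩ := hv
    simp [h]
  | zero => simp
  | add v w _ _ h1 h2 =>
    simp only [map_add, add_smul, Finset.sum_add_distrib]
    exact congrArg₂ (· + ·) h1 h2
  | smul c v _ h =>
    simp only [map_smul, smul_assoc, ← Finset.smul_sum]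
    exact congrArg (c • ·) h

lemma eq_zero_of_finrank_eq_one {W : Submodule ℝ V} (hW : Module.finrank ℝ W = 1) {A w : V}
    (hA : A ∈ W) (hw : w ∈ W) {f : V →ₗ[ℝ] ℝ} (hfA : f A = 1) (hfw : f w = 0) : w = 0 := by
  have hA0 : (⟨A, hA⟩ : W) ≠ 0 := by
    intro h
    have h0 : A = 0 := congrArg Subtype.val h
    simp [h0] at hfA
  obtain ⟨c, hc⟩ := exists_smul_eq_of_finrank_eq_one hW hA0 ⟨w, hw⟩
  have hc' : c • A = w := congrArg Subtype.val hc
  rw [← hc', map_smul, hfA, smul_eq_mul, mul_one] at hfw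
  rw [← hc', hfw, zero_smul]

end LinearAlgebra

/-! ### The Lie algebra in the adapted frame -/

section AdaptedFrame

variable {E : Type*} [NormedAddCommGroup E] [NormedSpace ℝ E]
  {S : Type*} [TopologicalSpace S] [ChartedSpace E S] [Group S]

lemma modelBracket_antisymm (v w : E) : modelBracket E S v w = - modelBracket E S w v := by
  rw [modelBracket_apply, modelBracket_apply]; abel

variable [LieGroup 𝓘(ℝ, E) ∞ S]

/-- The inner product of the Lie algebra. -/
def innerOne (g : RiemMetric E S) : E →L[ℝ] E →L[ℝ] ℝ := g.inner 1

lemma innerOne_symm (g : RiemMetric E S) (v w : E) : innerOne g v w = innerOne g w v := g.symm 1 v w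

variable (S) in
lemma modelBracket_jacobi [CompleteSpace E] (u v w : E) :
    modelBracket E S u (modelBracket E S v w) =
      modelBracket E S (modelBracket E S u v) w + modelBracket E S v (modelBracket E S u w) := by
  have : LieGroup 𝓘(ℝ, E) (minSmoothness ℝ 3) S := by
    rw [minSmoothness_of_isRCLikeNormedField]; infer_instance
  let u' : GroupLieAlgebra 𝓘(ℝ, E) S := u
  let v' : GroupLieAlgebra 𝓘(ℝ, E) S := v
  let w' : GroupLieAlgebra 𝓘(ℝ, E) S := w
  have h := leibniz_lie u' v' w'
  have e : ∀ p q : GroupLieAlgebra 𝓘(ℝ, E) S, ⁅p, q⁆ = modelBracket E S p q :=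
    fun p q => bracket_eq_modelBracket p q
  rw [e v' w', e u' v', e u' w'] at h
  exact (e _ _).symm.trans (h.trans (congrArg₂ (· + ·) (e _ _) (e _ _)))

/-- The properties of an adapted frame, in terms of the model bracket. -/
structure IsModelFrame (g : RiemMetric E S) {m : ℕ} {d : Fin m → ℕ} (lam : Fin m → ℝ)
    (C : CoordIndex d → CoordIndex d → CoordIndex d → ℝ) (A : E) (X : CoordIndex d → E) : Prop where
  inner_A_A : innerOne g A A = 1
  inner_A_X : ∀ a, innerOne g A (X a) = 0
  inner_X_X : ∀ a b, innerOne g (X a) (X b) = if a = b then 1 else 0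
  eq_sum : ∀ v, v = innerOne g v A • A + ∑ a, innerOne g v (X a) • X a
  bracket_A : ∀ a, modelBracket E S A (X a) = lam a.1 • X a
  bracket_X : ∀ a b, modelBracket E S (X a) (X b) = ∑ c, C a b c • X c
  strictMono : StrictMono lam
  lam_pos : ∀ i, 0 < lam i

lemma IsAdaptedFrame.isModelFrame [FiniteDimensional ℝ E] {g : RiemMetric E S} {m : ℕ}
    {d : Fin m → ℕ} {lam : Fin m → ℝ} {A : GroupLieAlgebra 𝓘(ℝ, E) S}
    {X : CoordIndex d → GroupLieAlgebra 𝓘(ℝ, E) S} (hX : IsAdaptedFrame g d lam A X)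
    (hrank : iwasawaRank g = 1) :
    IsModelFrame (S := S) (E := E) g lam (structConst g X) A X := by
  have : CompleteSpace E := FiniteDimensional.complete ℝ E
  obtain ⟨hA, hunit, hpos, hmono, hd, heig, hon, hspan⟩ := hX
  let A' : E := A
  let X' : CoordIndex d → E := X
  let D : Submodule ℝ E := derivedSubspace E S
  let W : Submodule ℝ E := derivedComplement g
  have hW : ∀ w : E, w ∈ W ↔ ∀ Y ∈ D, innerOne g w Y = 0 := fun _ => Iff.rfl
  have hWr : Module.finrank ℝ W = 1 := hrank
  have hDs : Submodule.span ℝ (Set.range X') = D := hspan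
  have hXD : ∀ a, X' a ∈ D := fun a => hDs ▸ Submodule.subset_span ⟨a, rfl⟩
  have hA' : A' ∈ W := hA
  have hAA : innerOne g A' A' = 1 := hunit
  have hAX : ∀ a, innerOne g A' (X' a) = 0 := fun a => (hW A').1 hA' _ (hXD a)
  have hXX : ∀ a b, innerOne g (X' a) (X' b) = if a = b then 1 else 0 := hon
  have hexp : ∀ v ∈ D, v = ∑ a, innerOne g v (X' a) • X' a := by
    intro v hv
    rw [← hDs] at hv
    exact eq_sum_of_mem_span (f := fun a => ((innerOne g).flip (X' a) : E →ₗ[ℝ] ℝ))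
      (fun a b => hXX b a) hv
  have hbr : ∀ v w : E, modelBracket E S v w ∈ D := by
    intro v w
    let v' : GroupLieAlgebra 𝓘(ℝ, E) S := v
    let w' : GroupLieAlgebra 𝓘(ℝ, E) S := w
    have h : ⁅v', w'⁆ ∈ derivedSubspace E S := Submodule.subset_span ⟨v', w', rfl⟩
    rw [bracket_eq_modelBracket] at h
    exact h
  have hpos' : ∀ Y ∈ D, Y ≠ 0 → 0 < innerOne g (modelBracket E S A' Y) Y := by
    intro Y hY hY0
    exact lt_of_lt_of_eq (hpos Y hY hY0)
      (congrArg (fun z : E => innerOne g z Y) (bracket_eq_modelBracket (S := S) A Y))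
  have heig' : ∀ a, modelBracket E S A' (X' a) = lam a.1 • X' a := by
    intro a
    exact (bracket_eq_modelBracket (S := S) A (X a)).symm.trans (heig a)
  refine ⟨hAA, hAX, hXX, fun v => ?_, heig', fun a b => ?_, hmono, fun i => ?_⟩
  · change v = innerOne g v A' • A' + ∑ a, innerOne g v (X' a) • X' a
    -- The remainder is orthogonal to the derived algebra, hence lies in its complement, and it is
    -- orthogonal to `A`. In rank one that complement is the line through `A`, so the remainder
    -- vanishes.
    have hw : v - (innerOne g v A' • A' + ∑ a, innerOne g v (X' a) • X' a) = 0 := by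
      have hXA : ∀ a, innerOne g (X' a) A' = 0 := fun a => by rw [innerOne_symm, hAX]
      refine eq_zero_of_finrank_eq_one hWr hA' ?_ (f := ((innerOne g).flip A' : E →ₗ[ℝ] ℝ)) hAA ?_
      · rw [hW]
        intro Y hY
        rw [hexp Y hY, map_sum]
        refine Finset.sum_eq_zero fun b _ => ?_
        simp [hAX, hXX]
      · simp [hAA, hXA]
    exact sub_eq_zero.1 hw
  · have := hexp _ (hbr (X' a) (X' b))
    refine this.trans (Finset.sum_congr rfl fun c _ => ?_)
    rw [structConst, bracket_eq_modelBracket]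
    rfl
  · let a : CoordIndex d := ⟨i, ⟨0, hd i⟩⟩
    have h1 : innerOne g (X' a) (X' a) = 1 := by rw [hXX, if_pos rfl]
    have h0 : X' a ≠ 0 := by
      intro h
      simp [h] at h1
    have h2 := hpos' (X' a) (hXD a) h0
    rw [heig', map_smul, smul_apply, h1, smul_eq_mul, mul_one] at h2
    exact h2

namespace IsModelFrame

variable {g : RiemMetric E S} {m : ℕ} {d : Fin m → ℕ} {lam : Fin m → ℝ}
  {C : CoordIndex d → CoordIndex d → CoordIndex d → ℝ} {A : E} {X : CoordIndex d → E}
  (hX : IsModelFrame g lam C A X)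
include hX

lemma inner_X_A (a : CoordIndex d) : innerOne g (X a) A = 0 := by
  rw [innerOne_symm, hX.inner_A_X]

lemma inner_sum (f : CoordIndex d → ℝ) (c : CoordIndex d) :
    innerOne g (∑ b, f b • X b) (X c) = f c := by
  simp [hX.inner_X_X]

lemma antisymm (a b c : CoordIndex d) : C a b c = - C b a c := by
  rw [← hX.inner_sum (C a b) c, ← hX.inner_sum (C b a) c, ← hX.bracket_X, ← hX.bracket_X,
    modelBracket_antisymm]
  simp

/-- By the Jacobi identity `ad A` is a derivation, so the bracket of two eigenvectors belongs to the
sum of their eigenvalues; comparison of the `X c` components gives the grading. -/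
lemma isGraded [CompleteSpace E] : IsGraded C lam := by
  refine ⟨fun i _ => hX.lam_pos i, hX.strictMono, fun a b c hc => ?_⟩
  have h1 := modelBracket_jacobi S A (X a) (X b)
  rw [hX.bracket_A, hX.bracket_A, map_smul, map_smul, smul_apply, ← add_smul,
    hX.bracket_X, map_sum, Finset.smul_sum] at h1
  simp only [map_smul, hX.bracket_A, smul_smul] at h1
  have h2 := congrArg (fun v => innerOne g v (X c)) h1
  simp only [hX.inner_sum] at h2
  have h3 : C a b c * (lam c.1 - (lam a.1 + lam b.1)) = 0 := by linarith
  have := (mul_eq_zero.1 h3).resolve_left hc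
  linarith

/-- The powers of `ad x` on the frame. -/
lemma ad_pow (x : CoordIndex d → ℝ) (k : ℕ) (a : CoordIndex d) :
    (modelBracket E S (∑ b, x b • X b) ^ k) (X a) = ∑ b, (adMatrix C x ^ k) a b • X b := by
  induction k with
  | zero => simp [Matrix.one_apply]
  | succ k ih =>
    have h1 : ∀ b, modelBracket E S (∑ c, x c • X c) (X b) = ∑ e, adMatrix C x b e • X e := by
      intro b
      simp only [map_sum, map_smul, sum_apply, smul_apply,
        hX.bracket_X, adMatrix, Matrix.of_apply, Finset.sum_smul, Finset.smul_sum, smul_smul]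
      exact Finset.sum_comm
    rw [pow_succ', mul_apply_eq_comp, ih, map_sum]
    simp only [map_smul, h1, pow_succ, Matrix.mul_apply, Finset.sum_smul, Finset.smul_sum, smul_smul]
    exact Finset.sum_comm

end IsModelFrame

end AdaptedFrame

/-! ### Inverting the derivative of the exponential map -/

section DExpStructPoly

universe u
variable {E : Type u} [NormedAddCommGroup E] [NormedSpace ℝ E] [FiniteDimensional ℝ E]
  {S : Type*} [TopologicalSpace S] [T2Space S] [ChartedSpace E S] [Group S]
  [LieGroup 𝓘(ℝ, E) ∞ S] {g : RiemMetric E S} {m : ℕ} {d : Fin m → ℕ} {lam : Fin m → ℝ}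
  {C : CoordIndex d → CoordIndex d → CoordIndex d → ℝ} {A : E} {X : CoordIndex d → E}

/-- The derivative of `exp` on the vectors `∑_b P_{ab}(x) X_b`. -/
theorem IsModelFrame.dexp_structPoly (hX : IsModelFrame g lam C A X) (x : CoordIndex d → ℝ)
    (a : CoordIndex d) :
    dexp E S (∑ b, x b • X b) (∑ b, MvPolynomial.eval x (structPoly C a b) • X b) = X a := by
  have : CompleteSpace E := FiniteDimensional.complete ℝ E
  set M := adMatrix C x with hM
  have hMm : M ^ m = 0 := hX.isGraded.adMatrix_pow_m x
  -- In the frame, the derivative of `exp` is the series `(1 - e^{-M}) / M` in the nilpotent matrix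
  -- `M`, while the coefficients of `structPoly` form the Bernoulli series in `M`. The two matrices
  -- are inverse to each other.
  have h1 : ∀ b, dexp E S (∑ b, x b • X b) (X b) =
      ∑ c, (∑ k ∈ Finset.range m, ((-1 : ℝ) ^ k / (k + 1).factorial) • M ^ k) b c • X c := by
    intro b
    rw [dexp_apply_eq_sum _ _ m (by rw [hX.ad_pow, ← hM, hMm]; simp)]
    simp only [hX.ad_pow, ← hM, Matrix.sum_apply, Matrix.smul_apply, smul_eq_mul, Finset.sum_smul,
      Finset.smul_sum, smul_smul]
    exact Finset.sum_comm
  have h2 : ∀ b, MvPolynomial.eval x (structPoly C a b) =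
      (∑ r ∈ Finset.range m, ((bernoulli' r : ℝ) / (r.factorial : ℝ)) • M ^ r) a b := by
    intro b
    rw [hX.isGraded.eval_structPoly, Matrix.sum_apply]
    rfl
  simp only [map_sum, map_smul, h1, h2, Finset.smul_sum, smul_smul]
  rw [Finset.sum_comm]
  simp only [← Finset.sum_smul, ← Matrix.mul_apply, sum_bernoulli_mul_sum_dexp hMm]
  simp [Matrix.one_apply]

end DExpStructPoly

/-! ### Right multiplication by one-parameter groups, and conjugation -/

section RightExp

open Filter Topology Set

universe u
variable {E : Type u} [NormedAddCommGroup E] [NormedSpace ℝ E] [FiniteDimensional ℝ E]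
  {S : Type*} [TopologicalSpace S] [T2Space S] [ChartedSpace E S] [Group S]
  [LieGroup 𝓘(ℝ, E) ∞ S] {F : Type*} [NormedAddCommGroup F] [NormedSpace ℝ F]

lemma contMDiff_mul_lieExp {c : F → S} (hc : ContMDiff 𝓘(ℝ, F) 𝓘(ℝ, E) ∞ c) (w : E) :
    ContMDiff 𝓘(ℝ, ℝ × F) 𝓘(ℝ, E) ∞ (fun q : ℝ × F => c q.2 * lieExp (S := S) (q.1 • w : E)) := by
  have h1 : ContMDiff 𝓘(ℝ, ℝ × F) 𝓘(ℝ, F) ∞ (fun q : ℝ × F => q.2) := contDiff_snd.contMDiff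
  have h2 : ContMDiff 𝓘(ℝ, ℝ × F) 𝓘(ℝ, E) ∞ (fun q : ℝ × F => q.1 • w) :=
    (contDiff_fst.smul contDiff_const).contMDiff
  exact (hc.comp h1).mul (contMDiff_lieExp.comp h2)

lemma leftDeriv_mul_lieExp_fst {c : F → S} (hc : ContMDiff 𝓘(ℝ, F) 𝓘(ℝ, E) ∞ c) (w : E)
    (q : ℝ × F) :
    leftDeriv E (fun q : ℝ × F => c q.2 * lieExp (S := S) (q.1 • w : E)) q (1, 0) = w := by
  have h1 := (contMDiff_mul_lieExp hc w).hasLeftDeriv q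
  have h2 := h1.comp (f := fun r : ℝ => (r, q.2)) (q := q.1)
    (hasFDerivAt_prodMk_left q.1 q.2)
  have h3 := (hasLeftDeriv_lieExp_smul (S := S) w q.1).const_mul (c q.2)
  have h4 := congrArg (fun f : ℝ →L[ℝ] E => f 1) (h2.leftDeriv_eq.symm.trans h3.leftDeriv_eq)
  simpa using h4

/-- Right multiplication by `exp(rw)` changes a logarithmic derivative by `Ad(exp(-rw))`, which
solves `y' = -[w, y]`. Maurer-Cartan gives this equation because the logarithmic derivative in the
direction of `r` is the constant `w`. -/
lemma leftDeriv_mul_lieExp_snd {c : F → S} (hc : ContMDiff 𝓘(ℝ, F) 𝓘(ℝ, E) ∞ c) (w : E) (q η : F)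
    {y : ℝ → E} (hy : ∀ r, HasDerivAt y (-modelBracket E S w (y r)) r)
    (hy0 : y 0 = leftDeriv E c q η) (r : ℝ) :
    leftDeriv E (fun q : ℝ × F => c q.2 * lieExp (S := S) (q.1 • w : E)) (r, q) (0, η) = y r := by
  set Φ := fun q : ℝ × F => c q.2 * lieExp (S := S) (q.1 • w : E) with hΦ
  have hsm := contMDiff_mul_lieExp (S := S) hc w
  have hd : ∀ q, HasFDerivAt (leftDeriv E Φ) (fderiv ℝ (leftDeriv E Φ) q) q := fun q =>
    ((contDiff_leftDeriv hsm).differentiable (by simp)).differentiableAt.hasFDerivAt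
  have hz : ∀ r, HasDerivAt (fun r => leftDeriv E Φ (r, q) (0, η))
      (-modelBracket E S w (leftDeriv E Φ (r, q) (0, η))) r := by
    intro r
    have h1 := leftDeriv_maurerCartan hsm (r, q) (1, 0) (0, η)
    rw [leftDeriv_mul_lieExp_fst hc] at h1
    have h2 : fderiv ℝ (leftDeriv E Φ) (r, q) (0, η) (1, 0) = 0 := by
      have h3 := (hd (r, q)).clm_apply (hasFDerivAt_const ((1 : ℝ), (0 : F)) (r, q))
      have h4 : HasFDerivAt (fun q => leftDeriv E Φ q (1, 0)) (0 : ℝ × F →L[ℝ] E) (r, q) := by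
        simp only [hΦ, leftDeriv_mul_lieExp_fst hc]
        exact hasFDerivAt_const _ _
      have h5 := congrArg (fun f : ℝ × F →L[ℝ] E => f (0, η)) (h3.unique h4)
      simpa using h5
    have h6 : HasDerivAt (fun r => leftDeriv E Φ (r, q)) (fderiv ℝ (leftDeriv E Φ) (r, q) (1, 0)) r := by
      have h7 : HasDerivAt (fun r : ℝ => (r, q)) ((1 : ℝ), (0 : F)) r :=
        (hasDerivAt_id r).prodMk (hasDerivAt_const r q)
      exact (hd (r, q)).comp_hasDerivAt r h7
    refine (h6.clm_apply (hasDerivAt_const r ((0 : ℝ), η))).congr_deriv ?_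
    rw [map_zero, add_zero]
    change fderiv ℝ (leftDeriv E Φ) (r, q) (1, 0) (0, η) - fderiv ℝ (leftDeriv E Φ) (r, q) (0, η) (1, 0)
      + modelBracket E S w (leftDeriv E Φ (r, q) (0, η)) = 0 at h1
    rw [h2, sub_zero] at h1
    exact eq_neg_of_add_eq_zero_left h1
  have hz0 : leftDeriv E Φ (0, q) (0, η) = y 0 := by
    rw [hy0]
    have h1 := (hsm.hasLeftDeriv (0, q)).comp (f := fun q : F => ((0 : ℝ), q)) (q := q)
      (hasFDerivAt_prodMk_right 0 q)
    simp only [zero_smul, lieExp_zero, mul_one] at h1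
    have h2 := congrArg (fun f : F →L[ℝ] E => f η) h1.leftDeriv_eq
    simpa using h2.symm
  have huniq : (fun r => leftDeriv E Φ (r, q) (0, η)) = y :=
    ODE_solution_unique_univ (v := fun _ y => -modelBracket E S w y) (s := fun _ => univ)
      (t₀ := 0) (K := ‖modelBracket E S w‖₊)
      (fun _ => by
        refine LipschitzWith.lipschitzOnWith ?_
        refine LipschitzWith.of_dist_le_mul fun a b => ?_
        rw [dist_neg_neg, dist_eq_norm, ← map_sub, dist_eq_norm]
        exact (modelBracket E S w).le_opNorm _)
      (fun s => ⟨hz s, mem_univ _⟩) (fun s => ⟨hy s, mem_univ _⟩) hz0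
  exact congrFun huniq r

/-- `exp(w) exp(sv) exp(-w) = exp(s y(1))` where `y' = [w, y]`, `y(0) = v`. -/
lemma lieExp_conj {w v : E} {y : ℝ → E} (hy : ∀ r, HasDerivAt y (modelBracket E S w (y r)) r)
    (hy0 : y 0 = v) (s : ℝ) :
    lieExp (S := S) w * lieExp (S := S) (s • v : E) = lieExp (S := S) (s • y 1 : E) * lieExp (S := S) w := by
  have hc : ContMDiff 𝓘(ℝ, ℝ) 𝓘(ℝ, E) ∞ (fun s : ℝ => lieExp (S := S) (s • v : E)) := by
    have h2 : ContMDiff 𝓘(ℝ, ℝ) 𝓘(ℝ, E) ∞ (fun q : ℝ => q • v) :=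
      (contDiff_id.smul contDiff_const).contMDiff
    exact contMDiff_lieExp.comp h2
  have hneg : lieExp (S := S) (-w : E) = (lieExp (S := S) w)⁻¹ := by
    have := lieExp_add_smul (S := S) w 1 (-1)
    rw [add_neg_cancel, zero_smul, lieExp_zero, one_smul, neg_one_smul] at this
    exact eq_inv_of_mul_eq_one_right this.symm
  -- The curve `exp(sv) exp(-w)` has the constant logarithmic derivative `y 1`, so it equals
  -- `exp(-w) exp(s y(1))`.
  have hd : ∀ s, HasLeftDeriv (fun s : ℝ => lieExp (S := S) (s • v : E) * lieExp (S := S) (-w : E))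
      (ContinuousLinearMap.toSpanSingleton ℝ (y 1)) s := by
    intro s
    have h1 := ((contMDiff_mul_lieExp hc (-w)).hasLeftDeriv (1, s)).comp
      (f := fun s : ℝ => ((1 : ℝ), s)) (q := s) (hasFDerivAt_prodMk_right 1 s)
    have h2 := leftDeriv_mul_lieExp_snd hc (-w) s 1 (y := y) (fun r => by simpa using hy r)
      (by rw [hy0, (hasLeftDeriv_lieExp_smul v s).leftDeriv_eq]; simp) 1
    have h3 : leftDeriv E (fun q : ℝ × ℝ => lieExp (S := S) (q.2 • v : E) * lieExp (S := S) (q.1 • -w : E))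
        (1, s) ∘L ContinuousLinearMap.inr ℝ ℝ ℝ = ContinuousLinearMap.toSpanSingleton ℝ (y 1) := by
      ext
      simpa using h2
    rw [h3] at h1
    simpa only [one_smul] using h1
  have h4 := lieExp_smul_eq hd s
  simp only [zero_smul, lieExp_zero, one_mul, hneg] at h4
  rw [eq_inv_mul_iff_mul_eq] at h4
  rw [← h4]
  group

lemma lieExp_smul_injective {v w : E}
    (h : ∀ s : ℝ, lieExp (S := S) (s • v : E) = lieExp (S := S) (s • w : E)) : v = w := by
  have h1 := (hasLeftDeriv_lieExp_smul (S := S) v 0).leftDeriv_eq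
  have h2 := (hasLeftDeriv_lieExp_smul (S := S) w 0).leftDeriv_eq
  simp only [h] at h1
  simpa using congrArg (fun f : ℝ →L[ℝ] E => f 1) (h1.symm.trans h2)

omit [FiniteDimensional ℝ E] [T2Space S] [LieGroup 𝓘(ℝ, E) ∞ S] in
/-- The curve `e^{r ad w} v` when `ad w` is nilpotent on `v`. -/
lemma hasDerivAt_exp_ad (w v : E) {m : ℕ} (h : (modelBracket E S w ^ m) v = 0) (r : ℝ) :
    HasDerivAt (fun r : ℝ => ∑ k ∈ Finset.range m, (r ^ k * (1 / (k.factorial : ℝ))) • (modelBracket E S w ^ k) v)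
      (modelBracket E S w (∑ k ∈ Finset.range m, (r ^ k * (1 / (k.factorial : ℝ))) • (modelBracket E S w ^ k) v)) r := by
  cases m with
  | zero =>
    simpa using hasDerivAt_const r (0 : E)
  | succ m =>
    have h1 : HasDerivAt (fun r : ℝ => ∑ k ∈ Finset.range (m + 1),
        (r ^ k * (1 / (k.factorial : ℝ))) • (modelBracket E S w ^ k) v)
        (∑ k ∈ Finset.range (m + 1), ((k : ℝ) * r ^ (k - 1) * (1 / (k.factorial : ℝ))) •
          (modelBracket E S w ^ k) v) r :=
      HasDerivAt.fun_sum fun k _ => ((hasDerivAt_pow k r).mul_const _).smul_const _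
    refine h1.congr_deriv ?_
    have h2 : ∀ k, modelBracket E S w ((modelBracket E S w ^ k) v) = (modelBracket E S w ^ (k + 1)) v :=
      fun k => by rw [pow_succ']; rfl
    simp only [map_sum, map_smul, h2]
    rw [Finset.sum_range_succ', Finset.sum_range_succ, h]
    simp only [Nat.cast_zero, zero_mul, zero_smul, smul_zero, add_zero]
    refine Finset.sum_congr rfl fun k _ => ?_
    congr 1
    rw [Nat.factorial_succ, Nat.add_sub_cancel]
    have : ((k : ℝ) + 1) ≠ 0 := by positivity
    push_cast
    field_simp

end RightExp

/-! ### Triangular differential equations -/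

section TriangularFlow

/-- Global solutions of triangular systems of differential equations. -/
lemma exists_triangular_flow {m : ℕ} {d : Fin m → ℕ} {f : CoordIndex d → (CoordIndex d → ℝ) → ℝ}
    (hf : ∀ b, Continuous (f b))
    (htri : ∀ b x y, (∀ c : CoordIndex d, c.1 < b.1 → x c = y c) → f b x = f b y)
    (x : CoordIndex d → ℝ) : ∃ z : ℝ → CoordIndex d → ℝ, z 0 = x ∧
      ∀ s, HasDerivAt z (fun b => f b (z s)) s := by
  -- Each Picard step makes one more block satisfy the integral equation, since `f b` sees only
  -- lower blocks, which are already correct. After `m` steps the solution is exact for all times.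
  have key : ∀ j : ℕ, ∃ z : ℝ → CoordIndex d → ℝ, Continuous z ∧
      ∀ b : CoordIndex d, (b.1 : ℕ) < j → ∀ s, z s b = x b + ∫ t in (0 : ℝ)..s, f b (z t) := by
    intro j
    induction j with
    | zero => exact ⟨fun _ => x, continuous_const, fun b hb => absurd hb (Nat.not_lt_zero _)⟩
    | succ j ih =>
      obtain ⟨z, hz, hzb⟩ := ih
      refine ⟨fun s b => x b + ∫ t in (0 : ℝ)..s, f b (z t), ?_, fun b hb s => ?_⟩
      · refine continuous_pi fun b => continuous_const.add ?_
        exact intervalIntegral.continuous_primitive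
          (fun a b' => ((hf b).comp hz).intervalIntegrable _ _) 0
      · refine congrArg (x b + ·) (intervalIntegral.integral_congr fun t _ => ?_)
        exact htri b _ _ fun c hc => hzb c (by rw [Fin.lt_def] at hc; omega) t
  obtain ⟨z, hz, hzb⟩ := key m
  refine ⟨z, ?_, fun s => hasDerivAt_pi.2 fun b => ?_⟩
  · funext b
    simpa using hzb b b.1.2 0
  · have h1 : (fun s => z s b) = fun s => x b + ∫ t in (0 : ℝ)..s, f b (z t) :=
      funext (hzb b b.1.2)
    rw [h1]
    exact (intervalIntegral.integral_hasDerivAt_right (((hf b).comp hz).intervalIntegrable _ _)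
      (((hf b).comp hz).stronglyMeasurableAtFilter _ _) ((hf b).comp hz).continuousAt).const_add _

end TriangularFlow

/-! ### The coordinate map and its differential -/

section CoordMap

open Filter Topology Set

universe u
variable {E : Type u} [NormedAddCommGroup E] [NormedSpace ℝ E] [FiniteDimensional ℝ E]
  {S : Type*} [TopologicalSpace S] [T2Space S] [ChartedSpace E S] [Group S]
  [LieGroup 𝓘(ℝ, E) ∞ S] {g : RiemMetric E S} {m : ℕ} {d : Fin m → ℕ} {lam : Fin m → ℝ}
  {C : CoordIndex d → CoordIndex d → CoordIndex d → ℝ} {A : E} {X : CoordIndex d → E}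

variable (S) in
/-- The map `x ↦ exp(∑ x_a X_a)`. -/
def nilMap (X : CoordIndex d → E) (x : CoordIndex d → ℝ) : S := lieExp (S := S) (∑ a, x a • X a : E)

variable (S) in
/-- The map `(u, x) ↦ exp(∑ x_a X_a) exp(u A)`. -/
def coordMap (A : E) (X : CoordIndex d → E) (q : ℝ × (CoordIndex d → ℝ)) : S :=
  nilMap S X q.2 * lieExp (S := S) (q.1 • A : E)

/-- The vector fields `P_a` on the coordinate space. -/
def structVec (C : CoordIndex d → CoordIndex d → CoordIndex d → ℝ) (x : CoordIndex d → ℝ)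
    (a : CoordIndex d) : CoordIndex d → ℝ :=
  fun b => MvPolynomial.eval x (structPoly C a b)

/-- The linear map `x ↦ ∑ x_a X_a`. -/
def frameSum (X : CoordIndex d → E) : (CoordIndex d → ℝ) →L[ℝ] E :=
  ∑ a, (ContinuousLinearMap.proj a : (CoordIndex d → ℝ) →L[ℝ] ℝ).smulRight (X a)

omit [FiniteDimensional ℝ E] in
lemma frameSum_apply (X : CoordIndex d → E) (x : CoordIndex d → ℝ) :
    frameSum X x = ∑ a, x a • X a := by
  simp [frameSum]

variable (S) in
lemma contMDiff_nilMap (X : CoordIndex d → E) :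
    ContMDiff 𝓘(ℝ, CoordIndex d → ℝ) 𝓘(ℝ, E) ∞ (nilMap S X) := by
  have h := contMDiff_lieExp (S := S).comp (frameSum X).contDiff.contMDiff
  refine h.congr fun x => ?_
  simp only [Function.comp, frameSum_apply]
  rfl

variable (S) in
lemma hasLeftDeriv_nilMap (X : CoordIndex d → E) (x : CoordIndex d → ℝ) :
    HasLeftDeriv (nilMap S X) (dexp E S (∑ a, x a • X a) ∘L frameSum X) x := by
  have h := (hasLeftDeriv_lieExp S (frameSum X x)).comp (f := frameSum X) (q := x)
    (frameSum X).hasFDerivAt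
  simp only [frameSum_apply] at h
  exact h

variable (S) in
lemma contMDiff_coordMap (A : E) (X : CoordIndex d → E) :
    ContMDiff 𝓘(ℝ, ℝ × (CoordIndex d → ℝ)) 𝓘(ℝ, E) ∞ (coordMap S A X) :=
  contMDiff_mul_lieExp (contMDiff_nilMap S X) A

variable (S) in
lemma leftDeriv_coordMap_fst (A : E) (X : CoordIndex d → E) (q : ℝ × (CoordIndex d → ℝ)) :
    leftDeriv E (coordMap S A X) q (1, 0) = A :=
  leftDeriv_mul_lieExp_fst (contMDiff_nilMap S X) A q

namespace IsModelFrame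

variable (hX : IsModelFrame g lam C A X)
include hX

/-- At `u = 0` this is `dexp_structPoly`; then `Ad(exp(-uA))` scales the eigenvector `X a` by `e^{-u
λ_a}`. -/
lemma leftDeriv_coordMap_structVec (u : ℝ) (x : CoordIndex d → ℝ) (a : CoordIndex d) :
    leftDeriv E (coordMap S A X) (u, x) (0, structVec C x a) = Real.exp (-u * lam a.1) • X a := by
  refine leftDeriv_mul_lieExp_snd (contMDiff_nilMap S X) A x _
    (y := fun u => Real.exp (-u * lam a.1) • X a) (fun r => ?_) ?_ u
  · rw [map_smul, hX.bracket_A]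
    have h1 : HasDerivAt (fun r : ℝ => -r * lam a.1) (-1 * lam a.1) r :=
      (hasDerivAt_id r).neg.mul_const _
    refine (h1.exp.smul_const (X a)).congr_deriv ?_
    rw [smul_smul, ← neg_smul]
    congr 1
    ring
  · rw [(hasLeftDeriv_nilMap S X x).leftDeriv_eq]
    simp only [ContinuousLinearMap.comp_apply, frameSum_apply]
    rw [neg_zero, zero_mul, Real.exp_zero, one_smul]
    exact (hX.dexp_structPoly x a).symm

/-- The Lie algebra is isomorphic to the coordinate space. -/
def frameEquiv : E ≃ₗ[ℝ] ℝ × (CoordIndex d → ℝ) where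
  toFun v := (innerOne g v A, fun a => innerOne g v (X a))
  map_add' v w := by ext <;> simp
  map_smul' c v := by ext <;> simp
  invFun q := q.1 • A + ∑ a, q.2 a • X a
  left_inv v := (hX.eq_sum v).symm
  right_inv q := by
    ext
    · simp [hX.inner_A_A, hX.inner_X_A]
    · simp [hX.inner_A_X, hX.inner_X_X]

/-- The image contains `A` and nonzero multiples of all `X a`, so the map is onto, and the
dimensions agree by `frameEquiv`. -/
lemma bijective_leftDeriv_coordMap (q : ℝ × (CoordIndex d → ℝ)) :
    Function.Bijective (leftDeriv E (coordMap S A X) q) := by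
  have hs : Function.Surjective
      (leftDeriv E (coordMap S A X) q : (ℝ × (CoordIndex d → ℝ)) →ₗ[ℝ] E) := by
    intro v
    refine ⟨innerOne g v A • ((1 : ℝ), (0 : CoordIndex d → ℝ)) + ∑ a, innerOne g v (X a) •
      Real.exp (q.1 * lam a.1) • ((0 : ℝ), structVec C q.2 a), ?_⟩
    rw [map_add, map_smul, map_sum]
    simp only [map_smul, ContinuousLinearMap.coe_coe, leftDeriv_coordMap_fst]
    have h1 : ∀ a, leftDeriv E (coordMap S A X) q (0, structVec C q.2 a) =
        Real.exp (-q.1 * lam a.1) • X a := hX.leftDeriv_coordMap_structVec q.1 q.2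
    simp only [h1, smul_smul, ← Real.exp_add]
    conv_rhs => rw [hX.eq_sum v]
    congr 1
    refine Finset.sum_congr rfl fun a _ => ?_
    congr 1
    rw [show q.1 * lam a.1 + -q.1 * lam a.1 = 0 by ring, Real.exp_zero, mul_one]
  have hi := (LinearMap.injective_iff_surjective_of_finrank_eq_finrank
    hX.frameEquiv.finrank_eq.symm).2 hs
  exact ⟨hi, hs⟩

/-- The derivative of the coordinate map, as an isomorphism. -/
def coordDeriv (q : ℝ × (CoordIndex d → ℝ)) : (ℝ × (CoordIndex d → ℝ)) ≃L[ℝ] E :=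
  (LinearEquiv.ofBijective
    (leftDeriv E (coordMap S A X) q : (ℝ × (CoordIndex d → ℝ)) →ₗ[ℝ] E)
    (hX.bijective_leftDeriv_coordMap q)).toContinuousLinearEquiv

lemma coe_coordDeriv (q : ℝ × (CoordIndex d → ℝ)) :
    (hX.coordDeriv q : (ℝ × (CoordIndex d → ℝ)) →L[ℝ] E) = leftDeriv E (coordMap S A X) q := by
  ext <;> rfl

/-- The coordinate map is a local diffeomorphism. -/
lemma exists_local_inverse (q : ℝ × (CoordIndex d → ℝ)) :
    ∃ G : S → ℝ × (CoordIndex d → ℝ),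
      ContMDiffAt 𝓘(ℝ, E) 𝓘(ℝ, ℝ × (CoordIndex d → ℝ)) ∞ G (coordMap S A X q) ∧
      ∀ᶠ p in 𝓝 (coordMap S A X q), coordMap S A X (G p) = p := by
  set Φ := coordMap S A X with hΦ
  -- Translation by `(Φ q)⁻¹` moves the image point to the identity, where the fixed chart applies
  -- and the derivative is the logarithmic one. The inverse function theorem is applied to this map.
  set f : ℝ × (CoordIndex d → ℝ) → E := fun q' => oneChart E S ((Φ q)⁻¹ * Φ q') with hf
  have hfs : ContDiffAt ℝ ∞ f q :=
    contDiffAt_oneChart_comp le_rfl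
      ((contMDiff_mul_left (I := 𝓘(ℝ, E)) (n := ∞) (a := (Φ q)⁻¹)).contMDiffAt.comp q
        (contMDiff_coordMap S A X).contMDiffAt)
      (by rw [inv_mul_cancel]; exact one_mem_oneChart_source E S)
  have hfd : HasFDerivAt f (hX.coordDeriv q : (ℝ × (CoordIndex d → ℝ)) →L[ℝ] E) q := by
    rw [coe_coordDeriv]
    exact ((contMDiff_coordMap S A X).hasLeftDeriv q).2
  set e := hfs.toOpenPartialHomeomorph f hfd (by simp) with he
  have hinv : ContDiffAt ℝ ∞ e.symm (f q) := hfs.to_localInverse hfd (by simp)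
  have hfq : f q = onePt E S := by simp [hf, onePt]
  have hmul : ContMDiffAt 𝓘(ℝ, E) 𝓘(ℝ, E) ∞ (fun p => oneChart E S ((Φ q)⁻¹ * p)) (Φ q) := by
    have h1 : ContMDiffAt 𝓘(ℝ, E) 𝓘(ℝ, E) ∞ (fun p : S => (Φ q)⁻¹ * p) (Φ q) :=
      contMDiff_mul_left.contMDiffAt
    refine ContMDiffAt.comp (Φ q) ?_ h1
    rw [inv_mul_cancel]
    exact contMDiffAt_oneChart E S (one_mem_oneChart_source E S)
  have hval : oneChart E S ((Φ q)⁻¹ * Φ q) = f q := rfl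
  refine ⟨fun p => e.symm (oneChart E S ((Φ q)⁻¹ * p)), ?_, ?_⟩
  · refine ContMDiffAt.comp (g := e.symm) (Φ q) ?_ hmul
    exact hinv.contMDiffAt
  · have hsq : e.symm (f q) = q := e.left_inv (hfs.mem_toOpenPartialHomeomorph_source hfd (by simp))
    have hGc : ContinuousAt (fun p => e.symm (oneChart E S ((Φ q)⁻¹ * p))) (Φ q) :=
      ContinuousAt.comp (g := e.symm) (hval ▸ hinv.continuousAt) hmul.continuousAt
    have hsource : ∀ p : S, Tendsto (fun p' : S => (Φ q)⁻¹ * p') (𝓝 p) (𝓝 ((Φ q)⁻¹ * p)) := fun p =>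
      (contMDiff_mul_left (I := 𝓘(ℝ, E)) (n := ∞) (a := (Φ q)⁻¹)).continuous.tendsto p
    have e1 : ∀ᶠ p in 𝓝 (Φ q), (Φ q)⁻¹ * p ∈ (oneChart E S).source := by
      have := hsource (Φ q)
      rw [inv_mul_cancel] at this
      exact this.eventually (oneChart_source_mem_nhds E S)
    have e2 : ∀ᶠ p in 𝓝 (Φ q), oneChart E S ((Φ q)⁻¹ * p) ∈ e.target := by
      refine hmul.continuousAt.eventually (e.open_target.mem_nhds ?_)
      exact hfs.image_mem_toOpenPartialHomeomorph_target hfd (by simp)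
    have e3 : ∀ᶠ p in 𝓝 (Φ q), (Φ q)⁻¹ * Φ (e.symm (oneChart E S ((Φ q)⁻¹ * p))) ∈
        (oneChart E S).source := by
      have h1 : ContinuousAt (fun p => Φ (e.symm (oneChart E S ((Φ q)⁻¹ * p)))) (Φ q) :=
        ContinuousAt.comp (g := Φ) (contMDiff_coordMap S A X).continuous.continuousAt hGc
      have h2 := (hsource (Φ (e.symm (oneChart E S ((Φ q)⁻¹ * Φ q))))).comp h1
      rw [hval, hsq, inv_mul_cancel] at h2
      exact h2.eventually (oneChart_source_mem_nhds E S)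
    filter_upwards [e1, e2, e3] with p h1 h2 h3
    have h4 : f (e.symm (oneChart E S ((Φ q)⁻¹ * p))) = oneChart E S ((Φ q)⁻¹ * p) := e.right_inv h2
    exact mul_left_cancel ((oneChart E S).injOn h3 h1 h4)

end IsModelFrame

end CoordMap

/-! ### Global bijectivity of the coordinate map -/

section CoordMap

open Filter Topology Set

universe u
variable {E : Type u} [NormedAddCommGroup E] [NormedSpace ℝ E] [FiniteDimensional ℝ E]
  {S : Type*} [TopologicalSpace S] [T2Space S] [ChartedSpace E S] [Group S]
  [LieGroup 𝓘(ℝ, E) ∞ S] {g : RiemMetric E S} {m : ℕ} {d : Fin m → ℕ} {lam : Fin m → ℝ}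
  {C : CoordIndex d → CoordIndex d → CoordIndex d → ℝ} {A : E} {X : CoordIndex d → E}

lemma sum_range_eq_add_of_pos {m : ℕ} (hm : 0 < m) (f : ℕ → ℝ) :
    ∑ j ∈ Finset.range m, f j = ∑ j ∈ Finset.range (m - 1), f (j + 1) + f 0 := by
  obtain ⟨k, rfl⟩ : ∃ k, m = k + 1 := ⟨m - 1, by omega⟩
  rw [Finset.sum_range_succ', Nat.add_sub_cancel]

/-- This is `Ad(exp w) = e^{ad w}`, a finite sum on vectors killed by a power of `ad w`. -/
lemma lieExp_conj_of_nilpotent {w v : E} {k : ℕ} (h : (modelBracket E S w ^ k) v = 0) (s : ℝ) :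
    lieExp (S := S) w * lieExp (S := S) (s • v : E) =
      lieExp (S := S) (s • ∑ j ∈ Finset.range k, (1 / (j.factorial : ℝ)) • (modelBracket E S w ^ j) v : E)
        * lieExp (S := S) w := by
  cases k with
  | zero =>
    have h0 : v = 0 := h
    simp [h0, lieExp_zero]
  | succ k =>
    have h0 : ∑ j ∈ Finset.range (k + 1),
        ((0 : ℝ) ^ j * (1 / (j.factorial : ℝ))) • (modelBracket E S w ^ j) v = v := by
      rw [Finset.sum_range_succ']; simp
    have := lieExp_conj (S := S) (hasDerivAt_exp_ad w v h) h0 s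
    simpa only [one_pow, one_mul] using this

namespace IsModelFrame

variable (hX : IsModelFrame g lam C A X)
include hX

lemma lieExp_smul_A_conj (u s : ℝ) (a : CoordIndex d) :
    lieExp (S := S) (u • A : E) * lieExp (S := S) (s • X a : E) =
      lieExp (S := S) (s • Real.exp (u * lam a.1) • X a : E) * lieExp (S := S) (u • A : E) := by
  have hy : ∀ r : ℝ, HasDerivAt (fun r : ℝ => Real.exp (r * (u * lam a.1)) • X a)
      (modelBracket E S (u • A) (Real.exp (r * (u * lam a.1)) • X a)) r := by
    intro r
    rw [map_smul, map_smul, smul_apply, hX.bracket_A]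
    have h1 : HasDerivAt (fun r : ℝ => r * (u * lam a.1)) (u * lam a.1) r := hasDerivAt_mul_const _
    refine (h1.exp.smul_const (X a)).congr_deriv ?_
    rw [smul_smul, smul_smul, mul_assoc]
  simpa only [one_mul] using lieExp_conj hy (by simp) s

omit [T2Space S] in
lemma ad_pow_X_eq_zero (x : CoordIndex d → ℝ) (a : CoordIndex d) :
    (modelBracket E S (∑ b, x b • X b) ^ m) (X a) = 0 := by
  have : CompleteSpace E := FiniteDimensional.complete ℝ E
  rw [hX.ad_pow, hX.isGraded.adMatrix_pow_m]
  simp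

omit [FiniteDimensional ℝ E] [T2Space S] in
lemma ad_pow_succ_A (x : CoordIndex d → ℝ) (k : ℕ) :
    (modelBracket E S (∑ b, x b • X b) ^ (k + 1)) A =
      -∑ c, (∑ a, x a * lam a.1 * (adMatrix C x ^ k) a c) • X c := by
  have h1 : modelBracket E S (∑ b, x b • X b) A = -∑ a, (x a * lam a.1) • X a := by
    rw [modelBracket_antisymm, map_sum]
    simp only [map_smul, hX.bracket_A, smul_smul]
  rw [pow_succ, mul_apply_eq_comp, h1, map_neg, map_sum]
  simp only [map_smul, hX.ad_pow, Finset.smul_sum, Finset.sum_smul, smul_smul]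
  rw [Finset.sum_comm]

/-- Conjugation by the points of the group on the frame vectors. -/
lemma coordMap_mul_X (q : ℝ × (CoordIndex d → ℝ)) (s : ℝ) (a : CoordIndex d) :
    coordMap S A X q * lieExp (S := S) (s • X a : E) =
      lieExp (S := S) (s • Real.exp (q.1 * lam a.1) • ∑ j ∈ Finset.range m,
        (1 / (j.factorial : ℝ)) • (modelBracket E S (∑ b, q.2 b • X b) ^ j) (X a) : E)
        * coordMap S A X q := by
  have h1 := lieExp_conj_of_nilpotent (hX.ad_pow_X_eq_zero q.2 a) (s * Real.exp (q.1 * lam a.1))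
  rw [coordMap, mul_assoc, hX.lieExp_smul_A_conj, ← mul_assoc, smul_smul, nilMap, h1, mul_assoc,
    smul_smul]

lemma coordMap_mul_A (q : ℝ × (CoordIndex d → ℝ)) (s : ℝ) :
    coordMap S A X q * lieExp (S := S) (s • A : E) =
      lieExp (S := S) (s • ∑ j ∈ Finset.range (m + 1),
        (1 / (j.factorial : ℝ)) • (modelBracket E S (∑ b, q.2 b • X b) ^ j) A : E)
        * coordMap S A X q := by
  have : CompleteSpace E := FiniteDimensional.complete ℝ E
  have h1 : (modelBracket E S (∑ b, q.2 b • X b) ^ (m + 1)) A = 0 := by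
    rw [hX.ad_pow_succ_A, hX.isGraded.adMatrix_pow_m]
    simp
  have h2 := lieExp_conj_of_nilpotent h1 s
  rw [coordMap, mul_assoc, ← lieExp_add_smul, add_comm, lieExp_add_smul, ← mul_assoc, nilMap, h2,
    mul_assoc]

/-- Equal points have the same adjoint action. Its value on some `X a` determines `u`; its value on
`A`, which `exp(uA)` fixes, determines `x`. -/
lemma coordMap_injective [Nonempty (CoordIndex d)] : Function.Injective (coordMap S A X) := by
  have : CompleteSpace E := FiniteDimensional.complete ℝ E
  intro q q' h
  have hG := hX.isGraded
  -- The `X a` component of the conjugate of `X a` is `e^{u λ_a}`: positive powers of `ad x` have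
  -- zero diagonal.
  have hu : q.1 = q'.1 := by
    obtain ⟨a⟩ := ‹Nonempty (CoordIndex d)›
    have h1 : Real.exp (q.1 * lam a.1) • ∑ j ∈ Finset.range m,
        (1 / (j.factorial : ℝ)) • (modelBracket E S (∑ b, q.2 b • X b) ^ j) (X a) =
        Real.exp (q'.1 * lam a.1) • ∑ j ∈ Finset.range m,
        (1 / (j.factorial : ℝ)) • (modelBracket E S (∑ b, q'.2 b • X b) ^ j) (X a) := by
      refine lieExp_smul_injective (S := S) fun s => ?_
      have h2 := hX.coordMap_mul_X q s a
      rw [h, hX.coordMap_mul_X q' s a] at h2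
      exact (mul_right_cancel h2).symm
    have h2 : ∀ x : CoordIndex d → ℝ, innerOne g (∑ j ∈ Finset.range m,
        (1 / (j.factorial : ℝ)) • (modelBracket E S (∑ b, x b • X b) ^ j) (X a)) (X a) = 1 := by
      intro x
      simp only [hX.ad_pow]
      simp only [map_sum, map_smul, sum_apply, smul_apply, hX.inner_X_X]
      rw [sum_range_eq_add_of_pos a.1.pos, Finset.sum_eq_zero]
      · simp
      · intro j _
        simp [hG.adMatrix_pow_eq_zero x (j + 1) (a := a) (b := a) (by omega)]
    have h3 := congrArg (fun v => innerOne g v (X a)) h1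
    simp only [map_smul, smul_apply, h2, smul_eq_mul, mul_one, Real.exp_eq_exp] at h3
    exact mul_right_cancel₀ (hX.lam_pos a.1).ne' h3
  refine Prod.ext hu ?_
  have h1 : ∑ j ∈ Finset.range (m + 1),
      (1 / (j.factorial : ℝ)) • (modelBracket E S (∑ b, q.2 b • X b) ^ j) A =
      ∑ j ∈ Finset.range (m + 1),
      (1 / (j.factorial : ℝ)) • (modelBracket E S (∑ b, q'.2 b • X b) ^ j) A := by
    refine lieExp_smul_injective (S := S) fun s => ?_
    have h2 := hX.coordMap_mul_A q s
    rw [h, hX.coordMap_mul_A q' s] at h2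
    exact (mul_right_cancel h2).symm
  have h2 : ∀ (x : CoordIndex d → ℝ) c, innerOne g (∑ j ∈ Finset.range (m + 1),
      (1 / (j.factorial : ℝ)) • (modelBracket E S (∑ b, x b • X b) ^ j) A) (X c) =
      -∑ j ∈ Finset.range m, (1 / ((j + 1).factorial : ℝ)) *
        ∑ a, x a * lam a.1 * (adMatrix C x ^ j) a c := by
    intro x c
    rw [Finset.sum_range_succ']
    simp only [hX.ad_pow_succ_A]
    simp only [map_add, map_sum, map_smul, map_neg, add_apply, sum_apply, smul_apply,
      neg_apply, hX.inner_X_X]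
    simp [hX.inner_A_X]
  have h3 : ∀ c, ∑ j ∈ Finset.range m, (1 / ((j + 1).factorial : ℝ)) *
        ∑ a, q.2 a * lam a.1 * (adMatrix C q.2 ^ j) a c =
      ∑ j ∈ Finset.range m, (1 / ((j + 1).factorial : ℝ)) *
        ∑ a, q'.2 a * lam a.1 * (adMatrix C q'.2 ^ j) a c := by
    intro c
    have := congrArg (fun v => innerOne g v (X c)) h1
    simp only [h2] at this
    exact neg_injective this
  -- In the `X c` component of the conjugate of `A` the term `j = 0` is `λ_c x_c` up to sign, and
  -- the others involve lower blocks only, so `x` is recovered block by block.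
  have h4 : ∀ k : ℕ, ∀ c : CoordIndex d, (c.1 : ℕ) < k → q.2 c = q'.2 c := by
    intro k
    induction k with
    | zero => exact fun c hc => absurd hc (Nat.not_lt_zero _)
    | succ k ih =>
      intro c hc
      have h5 := h3 c
      rw [sum_range_eq_add_of_pos c.1.pos, sum_range_eq_add_of_pos c.1.pos] at h5
      have h6 : ∀ j a, q.2 a * lam a.1 * (adMatrix C q.2 ^ (j + 1)) a c =
          q'.2 a * lam a.1 * (adMatrix C q'.2 ^ (j + 1)) a c := by
        intro j a
        by_cases ha : (a.1 : ℕ) < k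
        · rw [ih a ha, ← hG.eval_homPoly, ← hG.eval_homPoly,
            eval_homPoly_congr C j a c fun e he => ih e (by rw [Fin.lt_def] at he; omega)]
        · rw [hG.adMatrix_pow_eq_zero _ _ (by omega), hG.adMatrix_pow_eq_zero _ _ (by omega),
            mul_zero, mul_zero]
      simp only [h6] at h5
      have h7 := add_left_cancel h5
      simp only [pow_zero, Matrix.one_apply] at h7
      simp at h7
      exact h7.resolve_right (hX.lam_pos c.1).ne'
  exact funext fun c => h4 m c c.1.2

/-- The nilpotent part of the group is closed under multiplication. -/
lemma exists_nilMap_mul (x y : CoordIndex d → ℝ) : ∃ z, nilMap S X x * nilMap S X y = nilMap S X z := by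
  -- Right multiplication by `exp(s ∑ y_a X_a)` is the flow of the field `∑ y_a P_a` in the
  -- coordinates. Its triangular coefficients make the flow exist up to time 1.
  obtain ⟨z, hz0, hz⟩ := exists_triangular_flow
    (f := fun b z => ∑ a, y a * MvPolynomial.eval z (structPoly C a b))
    (fun b => continuous_finsetSum _ fun a _ => continuous_const.mul (contDiff_eval _).continuous)
    (fun b z z' h => Finset.sum_congr rfl fun a _ => by rw [eval_structPoly_congr C a b h]) x
  refine ⟨z 1, ?_⟩
  have h1 : ∀ s, HasLeftDeriv (fun s => nilMap S X (z s))
      (ContinuousLinearMap.toSpanSingleton ℝ (∑ a, y a • X a)) s := by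
    intro s
    have h2 := (hasLeftDeriv_nilMap S X (z s)).comp (f := z) (q := s) (hz s).hasFDerivAt
    convert h2 using 1
    ext
    simp only [ContinuousLinearMap.comp_apply, ContinuousLinearMap.toSpanSingleton_apply, one_smul,
      frameSum_apply, Finset.sum_smul, mul_smul]
    rw [Finset.sum_comm]
    simp only [← Finset.smul_sum, map_sum, map_smul]
    simp only [← map_sum, ← map_smul, hX.dexp_structPoly]
  have h3 := lieExp_smul_eq h1 1
  rw [one_smul, hz0] at h3
  exact h3.symm

/-- Moving `exp(uA)` to the right past `nilMap` scales the coordinate `x_a` by `e^{u λ_a}`. Then the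
two nilpotent factors multiply by `exists_nilMap_mul`, and the multiples of `A` add up. -/
lemma exists_coordMap_mul (q q' : ℝ × (CoordIndex d → ℝ)) :
    ∃ r, coordMap S A X q * coordMap S A X q' = coordMap S A X r := by
  have hy : ∀ r : ℝ, HasDerivAt (fun r : ℝ => ∑ a, (q'.2 a * Real.exp (r * (q.1 * lam a.1))) • X a)
      (modelBracket E S (q.1 • A) (∑ a, (q'.2 a * Real.exp (r * (q.1 * lam a.1))) • X a)) r := by
    intro r
    simp only [map_sum, map_smul, smul_apply, hX.bracket_A]
    refine HasDerivAt.fun_sum fun a _ => ?_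
    have h1 : HasDerivAt (fun r : ℝ => r * (q.1 * lam a.1)) (q.1 * lam a.1) r := hasDerivAt_mul_const _
    refine ((h1.exp.const_mul (q'.2 a)).smul_const (X a)).congr_deriv ?_
    rw [smul_smul, smul_smul]
    congr 1
    ring
  have h1 : lieExp (S := S) (q.1 • A : E) * nilMap S X q'.2 =
      nilMap S X (fun a => q'.2 a * Real.exp (q.1 * lam a.1)) * lieExp (S := S) (q.1 • A : E) := by
    have h0 : ∑ a, (q'.2 a * Real.exp (0 * (q.1 * lam a.1))) • X a = ∑ a, q'.2 a • X a := by
      simp only [zero_mul, Real.exp_zero, mul_one]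
    have h2 := lieExp_conj (S := S) hy h0 1
    simp only [one_mul, one_smul] at h2
    exact h2
  obtain ⟨z, hz⟩ := hX.exists_nilMap_mul (S := S) q.2 (fun a => q'.2 a * Real.exp (q.1 * lam a.1))
  refine ⟨(q.1 + q'.1, z), ?_⟩
  have key : ∀ a u b v : S, a * u * (b * v) = a * (u * b) * v := fun a u b v => by group
  refine (key _ _ _ _).trans ((congrArg (fun t => nilMap S X q.2 * t * _) h1).trans ?_)
  rw [← mul_assoc, hz, mul_assoc, ← lieExp_add_smul]
  rfl

/-- The range is open by the local inverses and closed under products. If `p` is outside it and `p'`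
is close to `p`, then `p'⁻¹ * p` lies in the range, so `p'` cannot: the complement is open too, and
no inverses in the range are needed. -/
lemma coordMap_surjective [ConnectedSpace S] : Function.Surjective (coordMap S A X) := by
  have hmulL : ∀ a : S, Continuous fun p : S => a * p := fun a =>
    (contMDiff_mul_left (I := 𝓘(ℝ, E)) (n := ∞) (a := a)).continuous
  have hmul1 : ∀ p ∈ range (coordMap S A X), ∀ p' ∈ range (coordMap S A X),
      p * p' ∈ range (coordMap S A X) := by
    rintro _ ⟨q, rfl⟩ _ ⟨q', rfl⟩
    obtain ⟨r, hr⟩ := hX.exists_coordMap_mul (S := S) q q'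
    exact ⟨r, hr.symm⟩
  have hopen : IsOpen (range (coordMap S A X)) := by
    rw [isOpen_iff_mem_nhds]
    rintro _ ⟨q, rfl⟩
    obtain ⟨G, -, hG⟩ := hX.exists_local_inverse (S := S) q
    filter_upwards [hG] with p hp
    exact ⟨G p, hp⟩
  have hclosed : IsClosed (range (coordMap S A X)) := by
    rw [← isOpen_compl_iff, isOpen_iff_mem_nhds]
    intro p hp
    have : IsTopologicalGroup S := topologicalGroup_of_lieGroup 𝓘(ℝ, E) ∞
    have h1 : ∀ᶠ p' in 𝓝 p, p'⁻¹ * p ∈ range (coordMap S A X) := by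
      have h2 : Continuous fun p' : S => p'⁻¹ * p := by fun_prop
      refine h2.continuousAt.eventually (hopen.mem_nhds ?_)
      refine ⟨0, ?_⟩
      simp [coordMap, nilMap, lieExp_zero]
    filter_upwards [h1] with p' hp' hmem
    exact hp (by simpa using hmul1 p' hmem _ hp')
  exact range_eq_univ.1 (IsClopen.eq_univ ⟨hclosed, hopen⟩ ⟨_, mem_range_self 0⟩)

/-- The coordinate map is a diffeomorphism. -/
theorem exists_inverse [Nonempty (CoordIndex d)] [ConnectedSpace S] :
    ∃ Ψ : S → ℝ × (CoordIndex d → ℝ),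
      ContMDiff 𝓘(ℝ, E) 𝓘(ℝ, ℝ × (CoordIndex d → ℝ)) ∞ Ψ ∧
      (∀ p, coordMap S A X (Ψ p) = p) ∧ ∀ q, Ψ (coordMap S A X q) = q := by
  have hbij : Function.Bijective (coordMap S A X) := ⟨hX.coordMap_injective, hX.coordMap_surjective⟩
  let e := Equiv.ofBijective _ hbij
  refine ⟨e.symm, fun p => ?_, fun p => e.apply_symm_apply p, fun q => e.symm_apply_apply q⟩
  obtain ⟨q, rfl⟩ := hbij.2 p
  obtain ⟨G, hG, hGe⟩ := hX.exists_local_inverse (S := S) q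
  refine hG.congr_of_eventuallyEq ?_
  filter_upwards [hGe] with p hp
  exact hbij.1 ((e.apply_symm_apply p).trans hp.symm)

end IsModelFrame

end CoordMap

/-! ### Left-invariant fields and the left trivialization -/

section LeftInvariantFields

open Filter Topology Set

variable {E : Type*} [NormedAddCommGroup E] [NormedSpace ℝ E]
  {S : Type*} [TopologicalSpace S] [ChartedSpace E S] [Group S] [LieGroup 𝓘(ℝ, E) ∞ S]

/-- The left-invariant vector field defined by `v`. -/
def invField (E : Type*) [NormedAddCommGroup E] [NormedSpace ℝ E] (S : Type*) [TopologicalSpace S]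
    [ChartedSpace E S] [Group S] (v : E) (p : S) : TangentSpace 𝓘(ℝ, E) p := leftMap E p v

/-- A vector field in the left trivialization of the tangent bundle. -/
def leftCoord (Y : (p : S) → TangentSpace 𝓘(ℝ, E) p) (p : S) : E := leftMapInv E p (Y p)

lemma leftMap_leftCoord (Y : (p : S) → TangentSpace 𝓘(ℝ, E) p) (p : S) :
    leftMap E p (leftCoord Y p) = Y p := leftMap_leftMapInv p (Y p)

lemma leftCoord_invField (v : E) (p : S) : leftCoord (invField E S v) p = v :=
  leftMapInv_leftMap p v

lemma mdifferentiableAt_invField (v : E) (p : S) : MDiffAt (T% (invField E S v)) p :=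
  ((contMDiff_one_mulInvariantVectorField (S := S) v) p).mdifferentiableAt one_ne_zero

lemma mlieBracket_invField [CompleteSpace E] (v w : E) (p : S) :
    VectorField.mlieBracket 𝓘(ℝ, E) (invField E S v) (invField E S w) p =
      leftMap E p (modelBracket E S v w) := by
  have : LieGroup 𝓘(ℝ, E) (minSmoothness ℝ 3) S := by
    rw [minSmoothness_of_isRCLikeNormedField]; infer_instance
  have h := congrFun (mulInvariantVector_mlieBracket (I := 𝓘(ℝ, E)) (G := S) v w) p
  have h2 : (VectorField.mlieBracket 𝓘(ℝ, E) (mulInvariantVectorField (I := 𝓘(ℝ, E)) (G := S) v)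
    (mulInvariantVectorField w) 1 : E) = modelBracket E S v w := bracket_eq_modelBracket v w
  exact h.symm.trans (congrArg (fun u : E => leftMap E p u) h2)

variable {g : RiemMetric E S}

lemma inner_leftMap (hg : IsLeftInvariant g) (p : S) (v w : E) :
    g.inner p (leftMap E p v) (leftMap E p w) = innerOne g v w := by
  have key : ∀ q, q = p * 1 → ∀ v' w' : E, (g.inner q : E →L[ℝ] E →L[ℝ] ℝ) v' w' =
      (g.inner (p * 1) : E →L[ℝ] E →L[ℝ] ℝ) v' w' := by
    rintro _ rfl v' w'; rfl
  exact (key p (mul_one p).symm _ _).trans (hg p 1 v w)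

lemma inner_eq_innerOne (hg : IsLeftInvariant g) (p : S) (v w : TangentSpace 𝓘(ℝ, E) p) :
    g.inner p v w = innerOne g (leftMapInv E p v) (leftMapInv E p w) := by
  rw [← inner_leftMap hg p, leftMap_leftMapInv, leftMap_leftMapInv]

/-- The metric evaluated on differentiable vector fields is differentiable. -/
lemma mdifferentiableAt_inner (g : RiemMetric E S) {Y Z : (p : S) → TangentSpace 𝓘(ℝ, E) p} {p : S}
    (hY : MDiffAt (T% Y) p) (hZ : MDiffAt (T% Z) p) :
    MDifferentiableAt 𝓘(ℝ, E) 𝓘(ℝ, ℝ) (fun q => g.inner q (Y q) (Z q)) p := by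
  have : MDifferentiableAt 𝓘(ℝ, E) (𝓘(ℝ, E).prod 𝓘(ℝ, ℝ))
      (fun m => TotalSpace.mk' ℝ (E := Bundle.Trivial S ℝ) m (g.inner m (Y m) (Z m))) p := by
    apply MDifferentiableAt.clm_bundle_apply₂ (F₁ := E) (F₂ := E)
    · exact (g.contMDiff p).mdifferentiableAt (by simp)
    · exact hY
    · exact hZ
  simp only [mdifferentiableAt_totalSpace] at this
  exact this.2

variable {ι : Type*} [Fintype ι] {e : ι → E}

/-- The components are the functions `⟨Y, e_i⟩`, differentiable because the metric is smooth. The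
expansion `he` is the form in which orthonormality of a frame is used from here on. -/
lemma mdifferentiableAt_leftCoord (hg : IsLeftInvariant g)
    (he : ∀ v, v = ∑ i, innerOne g v (e i) • e i)
    {Y : (p : S) → TangentSpace 𝓘(ℝ, E) p} {p : S} (hY : MDiffAt (T% Y) p) :
    MDifferentiableAt 𝓘(ℝ, E) 𝓘(ℝ, E) (leftCoord Y) p := by
  have h1 : leftCoord Y = fun q => ∑ i, g.inner q (Y q) (invField E S (e i) q) • e i := by
    funext q
    rw [he (leftCoord Y q)]
    refine Finset.sum_congr rfl fun i _ => ?_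
    rw [inner_eq_innerOne hg]
    congr 2
    exact (leftMapInv_leftMap q (e i)).symm
  rw [h1]
  have h2 : ∀ i, MDifferentiableAt 𝓘(ℝ, E) 𝓘(ℝ, E)
      (fun q => g.inner q (Y q) (invField E S (e i) q) • e i) p := fun i =>
    MDifferentiableAt.smul (mdifferentiableAt_inner g hY (mdifferentiableAt_invField (e i) p))
      mdifferentiableAt_const
  have h3 : ∀ s : Finset ι, MDifferentiableAt 𝓘(ℝ, E) 𝓘(ℝ, E)
      (fun q => ∑ i ∈ s, g.inner q (Y q) (invField E S (e i) q) • e i) p := by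
    classical
    intro s
    induction s using Finset.induction_on with
    | empty => simpa using mdifferentiableAt_const
    | insert a s ha ih =>
      simp only [Finset.sum_insert ha]
      exact (h2 a).add ih
  exact h3 _

omit [LieGroup 𝓘(ℝ, E) ∞ S] [Group S] in
/-- The product rule for a bilinear form. -/
lemma mvfderiv_bilin (B : E →L[ℝ] E →L[ℝ] ℝ) {y z : S → E} {p : S}
    (hy : MDifferentiableAt 𝓘(ℝ, E) 𝓘(ℝ, E) y p) (hz : MDifferentiableAt 𝓘(ℝ, E) 𝓘(ℝ, E) z p)
    (v : TangentSpace 𝓘(ℝ, E) p) :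
    mvfderiv 𝓘(ℝ, E) (fun q => B (y q) (z q)) p v =
      B (mvfderiv 𝓘(ℝ, E) y p v) (z p) + B (y p) (mvfderiv 𝓘(ℝ, E) z p v) := by
  have hyz : HasMFDerivAt 𝓘(ℝ, E) 𝓘(ℝ, E × E) (fun q => (y q, z q)) p
      ((mfderiv 𝓘(ℝ, E) 𝓘(ℝ, E) y p : E →L[ℝ] E).prod (mfderiv 𝓘(ℝ, E) 𝓘(ℝ, E) z p : E →L[ℝ] E)) :=
    ⟨hy.hasMFDerivAt.1.prodMk hz.hasMFDerivAt.1, hy.hasMFDerivAt.2.prodMk hz.hasMFDerivAt.2⟩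
  have hB : HasMFDerivAt 𝓘(ℝ, E × E) 𝓘(ℝ, ℝ) (fun q : E × E => B q.1 q.2) (y p, z p)
      (B.isBoundedBilinearMap.deriv (y p, z p)) :=
    (B.isBoundedBilinearMap.hasFDerivAt (y p, z p)).hasMFDerivAt
  have h := HasMFDerivAt.comp p hB hyz
  have h2 := congrArg (fun f : E →L[ℝ] ℝ => f v) h.mfderiv
  refine h2.trans ?_
  exact add_comm _ _

end LeftInvariantFields

/-! ### Existence of the Levi-Civita connection of a left-invariant metric -/

section KoszulConnection

open Filter Topology Set

variable {E : Type*} [NormedAddCommGroup E] [NormedSpace ℝ E]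
  {S : Type*} [TopologicalSpace S] [ChartedSpace E S] [Group S] [LieGroup 𝓘(ℝ, E) ∞ S]
  {g : RiemMetric E S} {ι : Type*} [Fintype ι] {e : ι → E}

/-- The covariant derivative `u ↦ ∇_u v` of left-invariant fields, given by the Koszul formula. -/
def koszul (g : RiemMetric E S) (e : ι → E) (v : E) : E →L[ℝ] E :=
  ∑ i, ((1 / 2 : ℝ) • ((innerOne g).flip (e i) ∘L (modelBracket E S).flip v
    - innerOne g (modelBracket E S v (e i))
    + (innerOne g).flip v ∘L modelBracket E S (e i))).smulRight (e i)

lemma koszul_apply (u v : E) : koszul g e v u = ∑ i, ((1 / 2 : ℝ) *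
    (innerOne g (modelBracket E S u v) (e i) - innerOne g (modelBracket E S v (e i)) u
      + innerOne g (modelBracket E S (e i) u) v)) • e i := by
  simp [koszul, mul_add]

lemma inner_koszul (he : ∀ v, v = ∑ i, innerOne g v (e i) • e i) (u v w : E) :
    innerOne g (koszul g e v u) w = (1 / 2 : ℝ) * (innerOne g (modelBracket E S u v) w
      - innerOne g (modelBracket E S v w) u + innerOne g (modelBracket E S w u) v) := by
  conv_rhs => rw [he w]
  rw [koszul_apply]
  simp only [map_sum, map_smul, sum_apply, smul_apply, smul_eq_mul]
  rw [← Finset.sum_sub_distrib, ← Finset.sum_add_distrib, Finset.mul_sum]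
  refine Finset.sum_congr rfl fun i _ => ?_
  rw [innerOne_symm g (e i) w]
  ring

lemma ext_inner (he : ∀ v, v = ∑ i, innerOne g v (e i) • e i) {v w : E}
    (h : ∀ u, innerOne g v u = innerOne g w u) : v = w := by
  rw [he v, he w]
  simp only [h]

lemma koszul_add (v w : E) : koszul g e (v + w) = koszul g e v + koszul g e w := by
  ext u
  simp only [add_apply, koszul_apply, map_add, ← Finset.sum_add_distrib, ← add_smul]
  refine Finset.sum_congr rfl fun i _ => ?_
  congr 1
  ring

lemma koszul_smul (c : ℝ) (v : E) : koszul g e (c • v) = c • koszul g e v := by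
  ext u
  simp only [smul_apply, koszul_apply, map_smul, Finset.smul_sum, smul_smul, smul_eq_mul]
  refine Finset.sum_congr rfl fun i _ => ?_
  congr 1
  ring

variable (g e) in
/-- The Levi-Civita connection in the left trivialization, as a function. -/
def koszulCovFun (Y : (p : S) → TangentSpace 𝓘(ℝ, E) p) (p : S) :
    TangentSpace 𝓘(ℝ, E) p →L[ℝ] TangentSpace 𝓘(ℝ, E) p :=
  leftMap E p ∘L (mvfderiv 𝓘(ℝ, E) (leftCoord Y) p + koszul g e (leftCoord Y p) ∘L leftMapInv E p)

lemma koszulCovFun_apply (Y : (p : S) → TangentSpace 𝓘(ℝ, E) p) (p : S)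
    (v : TangentSpace 𝓘(ℝ, E) p) : koszulCovFun g e Y p v =
      leftMap E p (mvfderiv 𝓘(ℝ, E) (leftCoord Y) p v
        + koszul g e (leftCoord Y p) (leftMapInv E p v)) := rfl

/-- The Levi-Civita connection of a left-invariant metric. -/
def koszulCov (hg : IsLeftInvariant g) (he : ∀ v, v = ∑ i, innerOne g v (e i) • e i) :
    CovariantDerivative 𝓘(ℝ, E) E (fun p : S => TangentSpace 𝓘(ℝ, E) p) where
  toFun := koszulCovFun g e
  isCovariantDerivativeOnUniv :=
    { add := by
        intro Y Z p hY hZ _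
        have h1 : leftCoord (Y + Z) = leftCoord Y + leftCoord Z := by
          funext q
          exact (leftMapInv E q).map_add (Y q) (Z q)
        refine ContinuousLinearMap.ext fun v => ?_
        rw [koszulCovFun_apply, h1, mvfderiv_add (mdifferentiableAt_leftCoord hg he hY)
          (mdifferentiableAt_leftCoord hg he hZ), Pi.add_apply, koszul_add]
        refine Eq.trans ?_ (congrArg₂ (· + ·) (koszulCovFun_apply Y p v).symm
          (koszulCovFun_apply Z p v).symm)
        refine Eq.trans ?_ ((leftMap E p).map_add _ _)
        refine congrArg (leftMap E p) ?_
        simp only [add_apply]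
        abel
      leibniz := by
        intro Y f p hY hf _
        have h1 : leftCoord (f • Y) = f • leftCoord Y := by
          funext q
          exact (leftMapInv E q).map_smul (f q) (Y q)
        refine ContinuousLinearMap.ext fun v => ?_
        rw [koszulCovFun_apply, h1, mvfderiv_smul hf (mdifferentiableAt_leftCoord hg he hY),
          Pi.smul_apply', koszul_smul]
        have h2 : mvfderiv 𝓘(ℝ, E) f p v • Y p =
            leftMap E p (mvfderiv 𝓘(ℝ, E) f p v • leftCoord Y p) := by
          rw [map_smul, leftMap_leftCoord]
        refine Eq.trans ?_ (congrArg₂ (· + ·) (congrArg (f p • ·) (koszulCovFun_apply Y p v).symm)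
          h2.symm)
        refine Eq.trans ?_ (congrArg (· + _) ((leftMap E p).map_smul _ _))
        refine Eq.trans ?_ ((leftMap E p).map_add _ _)
        refine congrArg (leftMap E p) ?_
        simp only [add_apply, smul_apply, ContinuousLinearMap.smulRight_apply, smul_add]
        abel }

lemma koszulCov_invField (hg : IsLeftInvariant g) (he : ∀ v, v = ∑ i, innerOne g v (e i) • e i)
    (p : S) (v w : E) :
    koszulCov hg he (invField E S v) p (leftMap E p w) = leftMap E p (koszul g e v w) := by
  have h1 : leftCoord (invField E S v) = fun _ => v := funext fun q => leftCoord_invField v q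
  have h2 := koszulCovFun_apply (g := g) (e := e) (invField E S v) p (leftMap E p w)
  rw [h1, mvfderiv_const, leftMapInv_leftMap] at h2
  refine h2.trans (congrArg (leftMap E p) ?_)
  exact zero_add _

/-- A left-invariant metric has a Levi-Civita connection. -/
theorem isLeviCivita_koszulCov [FiniteDimensional ℝ E] (hg : IsLeftInvariant g)
    (he : ∀ v, v = ∑ i, innerOne g v (e i) • e i) : IsLeviCivita g (koszulCov hg he) := by
  have : CompleteSpace E := FiniteDimensional.complete ℝ E
  have : IsManifold 𝓘(ℝ, E) 2 S := IsManifold.of_le (n := ∞) (by norm_cast)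
  intro p Y Z hY hZ
  refine ⟨fun v => ?_, ?_⟩
  · have h1 : (fun q => g.inner q (Y q) (Z q)) =
        fun q => innerOne g (leftCoord Y q) (leftCoord Z q) :=
      funext fun q => inner_eq_innerOne hg q (Y q) (Z q)
    rw [h1, mvfderiv_bilin _ (mdifferentiableAt_leftCoord hg he hY)
      (mdifferentiableAt_leftCoord hg he hZ), inner_eq_innerOne hg, inner_eq_innerOne hg]
    change _ = innerOne g (leftMapInv E p (koszulCovFun g e Y p v)) (leftCoord Z p)
      + innerOne g (leftCoord Y p) (leftMapInv E p (koszulCovFun g e Z p v))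
    rw [koszulCovFun_apply, koszulCovFun_apply, leftMapInv_leftMap, leftMapInv_leftMap, map_add,
      map_add, add_apply, inner_koszul he, innerOne_symm g (leftCoord Y p) (koszul _ _ _ _),
      inner_koszul he, modelBracket_antisymm (leftCoord Z p) (leftCoord Y p),
      modelBracket_antisymm (leftCoord Z p) (leftMapInv E p v),
      modelBracket_antisymm (leftCoord Y p) (leftMapInv E p v)]
    simp only [map_neg, neg_apply]
    ring
  · have htor : ∀ v w : E, (koszulCov hg he).torsion p (leftMap E p v) (leftMap E p w) = 0 := by
      intro v w
      have h1 := CovariantDerivative.torsion_apply (koszulCov hg he)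
        (mdifferentiableAt_invField v p) (mdifferentiableAt_invField w p)
      have h2 : modelBracket E S v w = koszul g e w v - koszul g e v w := by
        refine ext_inner he fun u => ?_
        rw [map_sub, sub_apply, inner_koszul he, inner_koszul he, modelBracket_antisymm w v,
          modelBracket_antisymm w u, modelBracket_antisymm u v]
        simp only [map_neg, neg_apply]
        ring
      have e1 := koszulCov_invField hg he p w v
      have e2 := koszulCov_invField hg he p v w
      have e3 := mlieBracket_invField v w p
      refine h1.trans ?_
      have e4 : (koszulCov hg he (invField E S w) p (leftMap E p v) : TangentSpace 𝓘(ℝ, E) p)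
          - koszulCov hg he (invField E S v) p (leftMap E p w)
          - VectorField.mlieBracket 𝓘(ℝ, E) (invField E S v) (invField E S w) p = 0 := by
        rw [e1, e2, e3, h2, map_sub, sub_self]
      exact e4
    have h1 := CovariantDerivative.torsion_apply (koszulCov hg he) hY hZ
    have h2 := htor (leftCoord Y p) (leftCoord Z p)
    rw [leftMap_leftCoord, leftMap_leftCoord] at h2
    rw [h2] at h1
    exact sub_eq_zero.1 h1.symm

end KoszulConnection

/-! ### Gradient, divergence and Laplacian in an invariant frame -/

section LaplaceFormula

open Filter Topology Set

variable {E : Type*} [NormedAddCommGroup E] [NormedSpace ℝ E]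
  {S : Type*} [TopologicalSpace S] [ChartedSpace E S] [Group S] [LieGroup 𝓘(ℝ, E) ∞ S]
  {g : RiemMetric E S} {ι : Type*} [Fintype ι] {e : ι → E}
  {F : Type*} [NormedAddCommGroup F] [NormedSpace ℝ F]

/-- The derivative of a function in the direction of a left-invariant vector field. -/
def lieD (v : E) (f : S → F) (p : S) : F := mvfderiv 𝓘(ℝ, E) f p (leftMap E p v)

lemma eq_sum_inner_invField (hg : IsLeftInvariant g)
    (he : ∀ v, v = ∑ i, innerOne g v (e i) • e i) (p : S) (v : TangentSpace 𝓘(ℝ, E) p) :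
    v = ∑ i, g.inner p v (invField E S (e i) p) • invField E S (e i) p := by
  have h1 := congrArg (leftMap E p) (he (leftMapInv E p v))
  rw [map_sum] at h1
  refine ((leftMap_leftMapInv p v).symm.trans h1).trans (Finset.sum_congr rfl fun i _ => ?_)
  rw [map_smul, inner_eq_innerOne hg p v]
  refine congrArg (fun w : E => innerOne g (leftMapInv E p v) w • invField E S (e i) p) ?_
  exact (leftMapInv_leftMap p (e i)).symm

lemma riemGradient_eq (hg : IsLeftInvariant g) (he : ∀ v, v = ∑ i, innerOne g v (e i) • e i)
    (f : S → ℝ) (p : S) :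
    riemGradient g f p = ∑ i, lieD (e i) f p • invField E S (e i) p := by
  have hexp := eq_sum_inner_invField hg he p
  let b : ι → E := fun i => leftMap E p (e i)
  let G' : (E →L[ℝ] ℝ) →L[ℝ] E := ∑ i, (ContinuousLinearMap.apply ℝ ℝ (b i)).smulRight (b i)
  have hG' : ∀ l, G' l = ∑ i, l (b i) • b i := by
    intro l
    simp [G', sum_apply]
  let G : (TangentSpace 𝓘(ℝ, E) p →L[ℝ] ℝ) →L[ℝ] TangentSpace 𝓘(ℝ, E) p := G'
  have hG : ∀ l, G l = ∑ i, l (invField E S (e i) p) • invField E S (e i) p := hG'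
  -- `ContinuousLinearMap.inverse` is zero on a non-invertible map; the explicit two-sided inverse
  -- `G` rules this case out.
  have h1 : (g.inner p) ∘L G = ContinuousLinearMap.id ℝ _ := by
    refine ContinuousLinearMap.ext fun l => ContinuousLinearMap.ext fun w => ?_
    rw [ContinuousLinearMap.comp_apply, hG, ContinuousLinearMap.id_apply]
    conv_rhs => rw [hexp w]
    simp only [map_sum, map_smul, sum_apply, smul_apply, smul_eq_mul]
    refine Finset.sum_congr rfl fun i _ => ?_
    rw [g.symm p w, mul_comm]
  have h2 : G ∘L (g.inner p) = ContinuousLinearMap.id ℝ _ := by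
    refine ContinuousLinearMap.ext fun v => ?_
    rw [ContinuousLinearMap.comp_apply, hG, ContinuousLinearMap.id_apply]
    exact (hexp v).symm
  rw [riemGradient, ContinuousLinearMap.inverse_eq h1 h2, hG]
  rfl

/-- `T` is the sum of the rank-one maps `v ↦ ⟨T v, e_i⟩ e_i`. -/
lemma trace_eq_sum_inner (hg : IsLeftInvariant g) (he : ∀ v, v = ∑ i, innerOne g v (e i) • e i)
    [FiniteDimensional ℝ E] (p : S) (T : TangentSpace 𝓘(ℝ, E) p →L[ℝ] TangentSpace 𝓘(ℝ, E) p) :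
    LinearMap.trace ℝ (TangentSpace 𝓘(ℝ, E) p)
      (T : TangentSpace 𝓘(ℝ, E) p →ₗ[ℝ] TangentSpace 𝓘(ℝ, E) p) =
      ∑ i, g.inner p (T (invField E S (e i) p)) (invField E S (e i) p) := by
  have hexp := eq_sum_inner_invField hg he p
  have : Module.Finite ℝ (TangentSpace 𝓘(ℝ, E) p) := inferInstanceAs (Module.Finite ℝ E)
  have h1 : (T : TangentSpace 𝓘(ℝ, E) p →ₗ[ℝ] TangentSpace 𝓘(ℝ, E) p) =
      ∑ i, ({ toFun := fun v => g.inner p (T v) (invField E S (e i) p)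
              map_add' := fun v w => by simp only [map_add, add_apply]
              map_smul' := fun c v => by
                simp only [map_smul, smul_apply, RingHom.id_apply] } :
        TangentSpace 𝓘(ℝ, E) p →ₗ[ℝ] ℝ).smulRight (invField E S (e i) p) := by
    refine LinearMap.ext fun v => ?_
    rw [LinearMap.sum_apply]
    exact hexp (T v)
  rw [h1, map_sum]
  refine Finset.sum_congr rfl fun i _ => ?_
  rw [LinearMap.trace_smulRight]
  rfl

variable [FiniteDimensional ℝ E]

/-- Inner products of invariant fields are constant, so compatibility gives `⟨∇_v v, w⟩ = -⟨v, ∇_v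
w⟩` and `⟨∇_w v, v⟩ = 0`; vanishing torsion replaces `∇_v w` by `∇_w v + [v, w]`. The argument holds
for any Levi-Civita connection, hence for the chosen one. -/
lemma inner_cov_invField (hg : IsLeftInvariant g)
    {cov : CovariantDerivative 𝓘(ℝ, E) E (fun p : S => TangentSpace 𝓘(ℝ, E) p)}
    (hcov : IsLeviCivita g cov) (p : S) (v w : E) :
    g.inner p (cov (invField E S v) p (invField E S v p)) (invField E S w p) =
      innerOne g (modelBracket E S w v) v := by
  have : CompleteSpace E := FiniteDimensional.complete ℝ E
  have hv := mdifferentiableAt_invField (S := S) v p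
  have hw := mdifferentiableAt_invField (S := S) w p
  have hconst : ∀ v w u, mvfderiv 𝓘(ℝ, E)
      (fun q => g.inner q (invField E S v q) (invField E S w q)) p u = 0 := by
    intro v w u
    have : (fun q => g.inner q (invField E S v q) (invField E S w q)) = fun _ => innerOne g v w :=
      funext fun q => inner_leftMap hg q v w
    rw [this, mvfderiv_const]
    rfl
  have h1 := (hcov p _ _ hv hw).1 (invField E S v p)
  have h2 := (hcov p _ _ hv hv).1 (invField E S w p)
  have h3 := (hcov p _ _ hv hw).2
  rw [hconst] at h1 h2
  rw [g.symm p (invField E S v p)] at h1 h2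
  have h4 := congrArg (fun u => g.inner p u (invField E S v p)) h3
  simp only [map_sub, sub_apply] at h4
  have h5 : g.inner p (VectorField.mlieBracket 𝓘(ℝ, E) (invField E S v) (invField E S w) p)
      (invField E S v p) = innerOne g (modelBracket E S v w) v :=
    (congrArg (fun u => g.inner p u (invField E S v p)) (mlieBracket_invField v w p)).trans
      (inner_leftMap hg p _ _)
  rw [h5, modelBracket_antisymm v w] at h4
  simp only [map_neg, neg_apply] at h4
  linarith

/-- The Laplace-Beltrami operator of a left-invariant metric in an orthonormal frame of
left-invariant vector fields. -/
theorem laplaceBeltramiReal_eq (hg : IsLeftInvariant g)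
    (he : ∀ v, v = ∑ i, innerOne g v (e i) • e i) {f : S → ℝ}
    (hf : ∀ i, MDifferentiable 𝓘(ℝ, E) 𝓘(ℝ, ℝ) (lieD (e i) f)) (p : S) :
    laplaceBeltramiReal g f p = ∑ i, lieD (e i) (lieD (e i) f) p
      - ∑ j, (∑ i, innerOne g (modelBracket E S (e j) (e i)) (e i)) * lieD (e j) f p := by
  have hex : ∃ cov : CovariantDerivative 𝓘(ℝ, E) E (fun p : S => TangentSpace 𝓘(ℝ, E) p),
      IsLeviCivita g cov := ⟨_, isLeviCivita_koszulCov hg he⟩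
  rw [laplaceBeltramiReal, dif_pos hex]
  have hcov := hex.choose_spec
  set cov := hex.choose
  rw [trace_eq_sum_inner hg he]
  -- The chosen connection is constrained on differentiable fields only, so the coefficients of the
  -- gradient have to be differentiable.
  have hG : MDiffAt (T% (riemGradient g f)) p := by
    have h1 : riemGradient g f = fun q => ∑ i, lieD (e i) f q • invField E S (e i) q :=
      funext fun q => riemGradient_eq hg he f q
    rw [h1]
    exact MDifferentiableAt.sum_section fun i _ =>
      MDifferentiableAt.smul_section (hf i p) (mdifferentiableAt_invField (e i) p)
  have hGinner : ∀ q (w : TangentSpace 𝓘(ℝ, E) q),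
      g.inner q (riemGradient g f q) w = mvfderiv 𝓘(ℝ, E) f q w := by
    intro q w
    rw [riemGradient_eq hg he f q]
    have h1 := congrArg (leftMap E q) (he (leftMapInv E q w))
    rw [map_sum] at h1
    have hw := (leftMap_leftMapInv q w).symm.trans h1
    simp only [map_sum, map_smul, sum_apply, smul_apply, smul_eq_mul]
    refine Eq.trans ?_ (congrArg (mvfderiv 𝓘(ℝ, E) f q) hw).symm
    rw [map_sum]
    refine Finset.sum_congr rfl fun i _ => ?_
    rw [map_smul, map_smul, smul_eq_mul, mul_comm, inner_eq_innerOne hg]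
    refine congrArg (· * lieD (e i) f q) ?_
    refine (innerOne_symm g _ _).trans ?_
    exact congrArg (innerOne g (leftMapInv E q w)) (leftMapInv_leftMap q (e i))
  -- Compatibility gives `⟨∇_{e_i} grad f, e_i⟩ = e_i (e_i f) - df(∇_{e_i} e_i)`, and the last
  -- vector is expanded by `inner_cov_invField`.
  have hterm : ∀ i, g.inner p (cov (riemGradient g f) p (invField E S (e i) p))
      (invField E S (e i) p) = lieD (e i) (lieD (e i) f) p
        - ∑ j, innerOne g (modelBracket E S (e j) (e i)) (e i) * lieD (e j) f p := by
    intro i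
    have h1 := (hcov p _ _ hG (mdifferentiableAt_invField (e i) p)).1 (invField E S (e i) p)
    have h2 : (fun q => g.inner q (riemGradient g f q) (invField E S (e i) q)) = lieD (e i) f :=
      funext fun q => hGinner q _
    rw [h2, hGinner] at h1
    have h3 := congrArg (leftMap E p)
      (he (leftMapInv E p (cov (invField E S (e i)) p (invField E S (e i) p))))
    rw [map_sum] at h3
    have hw := (leftMap_leftMapInv p _).symm.trans h3
    have h4 := congrArg (mvfderiv 𝓘(ℝ, E) f p) hw
    rw [map_sum] at h4
    have h5 : ∑ j, innerOne g (modelBracket E S (e j) (e i)) (e i) * lieD (e j) f p =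
        mvfderiv 𝓘(ℝ, E) f p (cov (invField E S (e i)) p (invField E S (e i) p)) := by
      rw [h4]
      refine Finset.sum_congr rfl fun j _ => ?_
      rw [map_smul, map_smul, smul_eq_mul, ← inner_cov_invField hg hcov p, inner_eq_innerOne hg]
      refine congrArg (fun u : E => innerOne g (leftMapInv E p
        (cov (invField E S (e i)) p (invField E S (e i) p))) u * lieD (e j) f p) ?_
      exact leftMapInv_leftMap p (e j)
    rw [h5]
    have h6 : lieD (e i) (lieD (e i) f) p =
      mvfderiv 𝓘(ℝ, E) (lieD (e i) f) p (invField E S (e i) p) := rfl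
    rw [h6, h1]
    ring
  simp only [hterm, Finset.sum_sub_distrib, Finset.sum_mul]
  rw [Finset.sum_comm]

end LaplaceFormula

/-! ### The frame operator in the coordinates (log t, x) -/

section FrameLaplacian

open Filter Topology Set

variable {m : ℕ} {d : Fin m → ℕ} {lam : Fin m → ℝ}
  {C : CoordIndex d → CoordIndex d → CoordIndex d → ℝ}
  {F F' : Type*} [NormedAddCommGroup F] [NormedSpace ℝ F] [NormedAddCommGroup F'] [NormedSpace ℝ F']

lemma contDiff_structVec (C : CoordIndex d → CoordIndex d → CoordIndex d → ℝ) (a : CoordIndex d) :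
    ContDiff ℝ ∞ fun x => structVec C x a :=
  contDiff_pi.2 fun _ => contDiff_eval _

/-- The left-invariant frame in the coordinates `(u, x)`, where `u = log t`. -/
def frameVec (lam : Fin m → ℝ) (C : CoordIndex d → CoordIndex d → CoordIndex d → ℝ) :
    Option (CoordIndex d) → ℝ × (CoordIndex d → ℝ) → ℝ × (CoordIndex d → ℝ)
  | none, _ => (1, 0)
  | some a, q => (0, Real.exp (q.1 * lam a.1) • structVec C q.2 a)

lemma contDiff_frameVec (i : Option (CoordIndex d)) : ContDiff ℝ ∞ (frameVec lam C i) := by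
  cases i with
  | none => exact contDiff_const
  | some a =>
    refine contDiff_const.prodMk (ContDiff.fun_smul ?_ ((contDiff_structVec C a).comp contDiff_snd))
    exact Real.contDiff_exp.comp (contDiff_fst.mul contDiff_const)

/-- The derivative of a function in the direction of a frame vector field. -/
def frameD (lam : Fin m → ℝ) (C : CoordIndex d → CoordIndex d → CoordIndex d → ℝ)
    (i : Option (CoordIndex d)) (f : ℝ × (CoordIndex d → ℝ) → F) (q : ℝ × (CoordIndex d → ℝ)) : F :=
  fderiv ℝ f q (frameVec lam C i q)

lemma contDiff_frameD {n k : WithTop ℕ∞} (hn : n ≤ ∞) (hk : n + 1 ≤ k) (i : Option (CoordIndex d))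
    {f : ℝ × (CoordIndex d → ℝ) → F} (hf : ContDiff ℝ k f) :
    ContDiff ℝ n (frameD lam C i f) :=
  (hf.fderiv_right hk).clm_apply ((contDiff_frameVec i).of_le hn)

lemma frameD_comp (L : F →L[ℝ] F') (i : Option (CoordIndex d)) {f : ℝ × (CoordIndex d → ℝ) → F}
    (hf : Differentiable ℝ f) :
    frameD lam C i (fun q => L (f q)) = fun q => L (frameD lam C i f q) := by
  funext q
  have h := (L.hasFDerivAt.comp q (hf q).hasFDerivAt).fderiv
  exact congrArg (fun T => T (frameVec lam C i q)) h

/-- The Laplace-Beltrami operator in the coordinates `(u, x)`, where `u = log t`. -/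
def frameLaplace (lam : Fin m → ℝ) (C : CoordIndex d → CoordIndex d → CoordIndex d → ℝ)
    (f : ℝ × (CoordIndex d → ℝ) → F) (q : ℝ × (CoordIndex d → ℝ)) : F :=
  ∑ i, frameD lam C i (frameD lam C i f) q - (∑ a : CoordIndex d, lam a.1) • frameD lam C none f q

/-- Applied to the real and imaginary parts, this passes from real to complex functions. -/
lemma frameLaplace_comp (L : F →L[ℝ] F') {f : ℝ × (CoordIndex d → ℝ) → F} (hf : ContDiff ℝ 2 f)
    (q : ℝ × (CoordIndex d → ℝ)) :
    frameLaplace lam C (fun q => L (f q)) q = L (frameLaplace lam C f q) := by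
  have h1 : ∀ i, Differentiable ℝ (frameD lam C i f) := fun i =>
    (contDiff_frameD (n := 1) (by norm_cast) (by norm_num) i hf).differentiable (by norm_num)
  unfold frameLaplace
  simp only [frameD_comp L _ (hf.differentiable (by norm_num)), frameD_comp L _ (h1 _), map_sub,
    map_sum, map_smul]

end FrameLaplacian

/-! ### Transport of the Laplacian to the coordinates (log t, x) -/

section LaplaceCoordinates

open Filter Topology Set

universe u
variable {E : Type u} [NormedAddCommGroup E] [NormedSpace ℝ E] [FiniteDimensional ℝ E]
  {S : Type*} [TopologicalSpace S] [T2Space S] [ChartedSpace E S] [Group S]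
  [LieGroup 𝓘(ℝ, E) ∞ S] {g : RiemMetric E S} {m : ℕ} {d : Fin m → ℕ} {lam : Fin m → ℝ}
  {C : CoordIndex d → CoordIndex d → CoordIndex d → ℝ} {A : E} {X : CoordIndex d → E}

/-- The orthonormal frame `A, X_a`. -/
def frameElem (A : E) (X : CoordIndex d → E) : Option (CoordIndex d) → E
  | none => A
  | some a => X a

lemma contDiff_comp_coordMap {F : Type*} [NormedAddCommGroup F]
    [NormedSpace ℝ F] {φ : S → F} (hφ : ContMDiff 𝓘(ℝ, E) 𝓘(ℝ, F) 2 φ) (A : E)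
    (X : CoordIndex d → E) : ContDiff ℝ 2 fun q => φ (coordMap S A X q) :=
  (hφ.comp ((contMDiff_coordMap S A X).of_le (by norm_cast))).contDiff

lemma contDiff_comp_coordMap_snd {F : Type*} [NormedAddCommGroup F]
    [NormedSpace ℝ F] {φ : S → F} (hφ : ContMDiff 𝓘(ℝ, E) 𝓘(ℝ, F) 2 φ) (A : E)
    (X : CoordIndex d → E) (u : ℝ) : ContDiff ℝ 2 fun x => φ (coordMap S A X (u, x)) :=
  (contDiff_comp_coordMap hφ A X).comp (contDiff_const.prodMk contDiff_id)

namespace IsModelFrame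

variable (hX : IsModelFrame g lam C A X)
include hX

omit [FiniteDimensional ℝ E] [T2Space S] in
lemma eq_sum_frameElem (v : E) :
    v = ∑ i, innerOne g v (frameElem A X i) • frameElem A X i := by
  rw [Fintype.sum_option]
  exact hX.eq_sum v

-- The trace of `ad A` is the sum of its eigenvalues with multiplicity. For `X b` the trace is zero
-- because the grading excludes `C b a a ≠ 0`.
omit [T2Space S] in
lemma trace_ad (i : Option (CoordIndex d)) :
    ∑ j, innerOne g (modelBracket E S (frameElem A X i) (frameElem A X j)) (frameElem A X j) =
      if i = none then ∑ a : CoordIndex d, lam a.1 else 0 := by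
  have : CompleteSpace E := FiniteDimensional.complete ℝ E
  rw [Fintype.sum_option]
  cases i with
  | none =>
    have h1 : modelBracket E S A A = 0 := by
      have h := modelBracket_antisymm (S := S) A A
      have h2 : (2 : ℝ) • modelBracket E S A A = 0 := by
        rw [two_smul, ← sub_neg_eq_add, ← h, sub_self]
      exact (smul_eq_zero.1 h2).resolve_left two_ne_zero
    simp only [frameElem, h1, hX.bracket_A, map_zero, zero_apply, map_smul, smul_apply,
      hX.inner_X_X, if_true, smul_eq_mul, mul_one, zero_add]
  | some b =>
    have h1 : ∀ a, C b a a = 0 := by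
      intro a
      by_contra h
      exact lt_irrefl _ (hX.isGraded.lt_right h)
    simp only [frameElem, modelBracket_antisymm (X b) A, hX.bracket_A, hX.bracket_X, hX.inner_sum,
      map_neg, map_smul, neg_apply, smul_apply, hX.inner_X_A, h1, smul_zero, neg_zero,
      Finset.sum_const_zero, add_zero, reduceCtorEq, if_false]

/-- The factor `e^{u λ_a}` in `frameVec` compensates the `e^{-u λ_a}` of
`leftDeriv_coordMap_structVec`. -/
lemma leftDeriv_coordMap_frameVec (i : Option (CoordIndex d)) (q : ℝ × (CoordIndex d → ℝ)) :
    leftDeriv E (coordMap S A X) q (frameVec lam C i q) = frameElem A X i := by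
  cases i with
  | none => exact leftDeriv_coordMap_fst S A X q
  | some a =>
    have h1 : frameVec lam C (some a) q = Real.exp (q.1 * lam a.1) • (0, structVec C q.2 a) := by
      simp [frameVec]
    rw [h1, map_smul]
    have h2 := hX.leftDeriv_coordMap_structVec (S := S) q.1 q.2 a
    rw [show ((q.1, q.2) : ℝ × (CoordIndex d → ℝ)) = q from rfl] at h2
    rw [h2, smul_smul, ← Real.exp_add, show q.1 * lam a.1 + -q.1 * lam a.1 = 0 by ring,
      Real.exp_zero, one_smul]
    rfl

lemma lieD_coordMap {F : Type*} [NormedAddCommGroup F] [NormedSpace ℝ F] {f : S → F}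
    (i : Option (CoordIndex d)) (q : ℝ × (CoordIndex d → ℝ))
    (hf : MDifferentiableAt 𝓘(ℝ, E) 𝓘(ℝ, F) f (coordMap S A X q)) :
    lieD (frameElem A X i) f (coordMap S A X q) = frameD lam C i (fun q => f (coordMap S A X q)) q := by
  have h1 := hasLeftDeriv_iff.1 ((contMDiff_coordMap S A X).hasLeftDeriv q)
  have h2 : HasMFDerivAt 𝓘(ℝ, ℝ × (CoordIndex d → ℝ)) 𝓘(ℝ, F) (fun q => f (coordMap S A X q)) q
      ((mfderiv 𝓘(ℝ, E) 𝓘(ℝ, F) f (coordMap S A X q) : E →L[ℝ] F) ∘L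
        (leftMap E (coordMap S A X q) : E →L[ℝ] E) ∘L leftDeriv E (coordMap S A X) q) :=
    HasMFDerivAt.comp q hf.hasMFDerivAt h1
  have h3 := mfderiv_eq_fderiv.symm.trans h2.mfderiv
  rw [← hX.leftDeriv_coordMap_frameVec i q]
  exact (congrArg (fun T : (ℝ × (CoordIndex d → ℝ)) →L[ℝ] F => T (frameVec lam C i q)) h3).symm

variable [Nonempty (CoordIndex d)] [ConnectedSpace S]

/-- In the global coordinates the invariant fields have smooth coefficients, so only one order of
differentiability is lost. This supplies the differentiability asked for by
`laplaceBeltramiReal_eq`. -/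
lemma contMDiff_lieD {F : Type*} [NormedAddCommGroup F] [NormedSpace ℝ F] {f : S → F}
    (hf : ContMDiff 𝓘(ℝ, E) 𝓘(ℝ, F) 2 f) (i : Option (CoordIndex d)) :
    ContMDiff 𝓘(ℝ, E) 𝓘(ℝ, F) 1 (lieD (frameElem A X i) f) := by
  obtain ⟨Ψ, hΨ, hΨ1, -⟩ := hX.exists_inverse (S := S)
  have h1 : lieD (frameElem A X i) f =
      fun p => frameD lam C i (fun q => f (coordMap S A X q)) (Ψ p) := by
    funext p
    rw [← hX.lieD_coordMap (S := S) i (Ψ p) (hf.mdifferentiable (by norm_num) _), hΨ1]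
  rw [h1]
  have h2 : ContDiff ℝ 2 fun q => f (coordMap S A X q) := contDiff_comp_coordMap hf A X
  exact (contDiff_frameD (lam := lam) (C := C) (n := 1) (by norm_cast) (by norm_num) i
    h2).contMDiff.comp (hΨ.of_le (by norm_cast))

lemma laplaceBeltramiReal_coordMap (hg : IsLeftInvariant g) {f : S → ℝ}
    (hf : ContMDiff 𝓘(ℝ, E) 𝓘(ℝ, ℝ) 2 f) (q : ℝ × (CoordIndex d → ℝ)) :
    laplaceBeltramiReal g f (coordMap S A X q) =
      frameLaplace lam C (fun q => f (coordMap S A X q)) q := by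
  have h1 : ∀ i, MDifferentiable 𝓘(ℝ, E) 𝓘(ℝ, ℝ) (lieD (frameElem A X i) f) := fun i =>
    (hX.contMDiff_lieD hf i).mdifferentiable (by norm_num)
  have h2 : ∀ i q, lieD (frameElem A X i) f (coordMap S A X q) =
      frameD lam C i (fun q => f (coordMap S A X q)) q := fun i q =>
    hX.lieD_coordMap i q (hf.mdifferentiable (by norm_num) _)
  rw [laplaceBeltramiReal_eq hg hX.eq_sum_frameElem h1]
  simp only [hX.trace_ad, hX.lieD_coordMap _ _ (h1 _ _), h2, ite_mul, zero_mul, Finset.sum_ite_eq',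
    Finset.mem_univ, if_true]
  rfl

/-- The Laplace-Beltrami operator in the coordinates `(u, x)`. -/
theorem laplaceBeltrami_coordMap (hg : IsLeftInvariant g) {φ : S → ℂ}
    (hφ : ContMDiff 𝓘(ℝ, E) 𝓘(ℝ, ℂ) 2 φ) (q : ℝ × (CoordIndex d → ℝ)) :
    laplaceBeltrami g φ (coordMap S A X q) =
      frameLaplace lam C (fun q => φ (coordMap S A X q)) q := by
  have h2 : ContDiff ℝ 2 fun q => φ (coordMap S A X q) := contDiff_comp_coordMap hφ A X
  have hre : ContMDiff 𝓘(ℝ, E) 𝓘(ℝ, ℝ) 2 fun p => (φ p).re :=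
    Complex.reCLM.contDiff.contMDiff.comp hφ
  have him : ContMDiff 𝓘(ℝ, E) 𝓘(ℝ, ℝ) 2 fun p => (φ p).im :=
    Complex.imCLM.contDiff.contMDiff.comp hφ
  rw [laplaceBeltrami, hX.laplaceBeltramiReal_coordMap hg hre, hX.laplaceBeltramiReal_coordMap hg him]
  have h3 := frameLaplace_comp (lam := lam) (C := C) Complex.reCLM h2 q
  have h4 := frameLaplace_comp (lam := lam) (C := C) Complex.imCLM h2 q
  simp only [Complex.reCLM_apply, Complex.imCLM_apply] at h3 h4
  rw [h3, h4, mul_comm, Complex.re_add_im]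

end IsModelFrame

end LaplaceCoordinates

/-! ### Rules for partial derivatives -/

section CoordPartial

variable {ι : Type*} [Fintype ι] [DecidableEq ι]

lemma coordPartial_eq_fderiv {f : (ι → ℝ) → ℂ} {x : ι → ℝ} (hf : DifferentiableAt ℝ f x) (a : ι) :
    coordPartial a f x = fderiv ℝ f x (Pi.single a 1) := by
  have h1 : HasFDerivAt f (fderiv ℝ f x) (Function.update x a (x a)) := by
    rw [Function.update_eq_self]
    exact hf.hasFDerivAt
  exact (HasFDerivAt.comp_hasDerivAt (x a) h1 (hasDerivAt_update x a (x a))).deriv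

lemma fderiv_apply_eq_sum_coordPartial {f : (ι → ℝ) → ℂ} {x : ι → ℝ} (hf : DifferentiableAt ℝ f x)
    (v : ι → ℝ) : fderiv ℝ f x v = ∑ a, (v a : ℂ) * coordPartial a f x := by
  conv_lhs => rw [← Finset.univ_sum_single v, map_sum]
  refine Finset.sum_congr rfl fun a _ => ?_
  rw [coordPartial_eq_fderiv hf, ← mul_one (v a), ← smul_eq_mul (v a) 1, Pi.single_smul', map_smul,
    smul_eq_mul, mul_one, Complex.real_smul]

lemma contDiff_coordPartial {f : (ι → ℝ) → ℂ} {n k : WithTop ℕ∞} (hf : ContDiff ℝ k f)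
    (hk : n + 1 ≤ k) (a : ι) : ContDiff ℝ n (coordPartial a f) := by
  have h1 : coordPartial a f = fun x => fderiv ℝ f x (Pi.single a 1) :=
    funext fun x => coordPartial_eq_fderiv (hf.differentiable (by
      rintro rfl
      simp at hk) x) a
  rw [h1]
  exact (hf.fderiv_right hk).clm_apply contDiff_const

lemma coordPartial_sum {κ : Type*} (s : Finset κ) {f : κ → (ι → ℝ) → ℂ} {x : ι → ℝ}
    (hf : ∀ k ∈ s, DifferentiableAt ℝ (f k) x) (a : ι) :
    coordPartial a (fun y => ∑ k ∈ s, f k y) x = ∑ k ∈ s, coordPartial a (f k) x := by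
  rw [coordPartial_eq_fderiv (DifferentiableAt.fun_sum hf), fderiv_fun_sum hf, sum_apply]
  exact Finset.sum_congr rfl fun k hk => (coordPartial_eq_fderiv (hf k hk) a).symm

lemma coordPartial_const_mul (c : ℂ) (f : (ι → ℝ) → ℂ) (x : ι → ℝ) (a : ι) :
    coordPartial a (fun y => c * f y) x = c * coordPartial a f x :=
  deriv_const_mul_field c

lemma coordPartial_mul {f h : (ι → ℝ) → ℂ} {x : ι → ℝ} (hf : DifferentiableAt ℝ f x)
    (hh : DifferentiableAt ℝ h x) (a : ι) :
    coordPartial a (fun y => f y * h y) x =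
      coordPartial a f x * h x + f x * coordPartial a h x := by
  rw [coordPartial_eq_fderiv (hf.fun_mul hh), fderiv_fun_mul hf hh, coordPartial_eq_fderiv hf,
    coordPartial_eq_fderiv hh]
  simp only [add_apply, smul_apply, smul_eq_mul]
  ring

lemma coordPartial_comm {f : (ι → ℝ) → ℂ} (hf : ContDiff ℝ 2 f) (a b : ι) (x : ι → ℝ) :
    coordPartial a (coordPartial b f) x = coordPartial b (coordPartial a f) x := by
  have h0 : ∀ b, coordPartial b f = fun x => fderiv ℝ f x (Pi.single b 1) := fun b =>
    funext fun x => coordPartial_eq_fderiv (hf.differentiable (by norm_num) x) b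
  have hd : DifferentiableAt ℝ (fderiv ℝ f) x :=
    (hf.fderiv_right (m := 1) (by norm_num)).differentiable (by norm_num) x
  have h1 : ∀ a b, coordPartial a (coordPartial b f) x =
      fderiv ℝ (fderiv ℝ f) x (Pi.single a 1) (Pi.single b 1) := by
    intro a b
    rw [coordPartial_eq_fderiv ((contDiff_coordPartial (n := 1) hf (by norm_num) b).differentiable
      (by norm_num) x), h0 b, fderiv_clm_apply hd (differentiableAt_const _)]
    simp
  rw [h1, h1]
  exact (hf.contDiffAt.isSymmSndFDerivAt (by simp)).eq _ _

end CoordPartial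

/-! ### Expansion into partial derivatives and the change u = log t -/

section FrameLaplacian

variable {m : ℕ} {d : Fin m → ℕ} {lam : Fin m → ℝ}
  {C : CoordIndex d → CoordIndex d → CoordIndex d → ℝ}

lemma frameD_none {f : ℝ × (CoordIndex d → ℝ) → ℂ} (hf : Differentiable ℝ f) (u : ℝ)
    (x : CoordIndex d → ℝ) : frameD lam C none f (u, x) = deriv (fun s => f (s, x)) u := by
  have h1 : HasDerivAt (fun s : ℝ => (s, x)) ((1 : ℝ), (0 : CoordIndex d → ℝ)) u :=
    (hasDerivAt_id u).prodMk (hasDerivAt_const u x)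
  exact ((hf (u, x)).hasFDerivAt.comp_hasDerivAt u h1).deriv.symm

lemma frameD_some {f : ℝ × (CoordIndex d → ℝ) → ℂ} (hf : Differentiable ℝ f) (u : ℝ)
    (x : CoordIndex d → ℝ) (a : CoordIndex d) :
    frameD lam C (some a) f (u, x) = (Real.exp (u * lam a.1) : ℂ) *
      ∑ c, (structVec C x a c : ℂ) * coordPartial c (fun y => f (u, y)) x := by
  have h1 : HasFDerivAt (fun y : CoordIndex d → ℝ => (u, y))
      (ContinuousLinearMap.inr ℝ ℝ (CoordIndex d → ℝ)) x :=
    (hasFDerivAt_const u x).prodMk (hasFDerivAt_id x)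
  have h2 := (hf (u, x)).hasFDerivAt.comp x h1
  rw [← fderiv_apply_eq_sum_coordPartial (f := fun y => f (u, y)) h2.differentiableAt,
    ← Complex.real_smul, ← map_smul]
  exact (congrArg (fun T : (CoordIndex d → ℝ) →L[ℝ] ℂ =>
    T (Real.exp (u * lam a.1) • structVec C x a)) h2.fderiv).symm

/-- The factor `e^{u λ_a}` is constant in `x`, so it passes through the derivatives in `x`; its two
occurrences give `e^{2 u λ_a}`. -/
lemma frameLaplace_eq {f : ℝ × (CoordIndex d → ℝ) → ℂ} (hf : ContDiff ℝ 2 f) (u : ℝ)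
    (x : CoordIndex d → ℝ) :
    frameLaplace lam C f (u, x) = deriv (deriv fun s => f (s, x)) u
      - ((∑ i, (d i : ℝ) * lam i : ℝ) : ℂ) * deriv (fun s => f (s, x)) u
      + ∑ a, ∑ b, ∑ c, (Real.exp (u * (2 * lam a.1)) : ℂ) * (structVec C x a b : ℂ)
        * coordPartial b (fun y => (structVec C y a c : ℂ) *
            coordPartial c (fun z => f (u, z)) y) x := by
  have hfd : Differentiable ℝ f := hf.differentiable (by norm_num)
  have hD : ∀ i, Differentiable ℝ (frameD lam C i f) := fun i =>
    (contDiff_frameD (n := 1) (by norm_cast) (by norm_num) i hf).differentiable (by norm_num)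
  have hfu : ContDiff ℝ 2 fun y => f (u, y) := hf.comp (contDiff_const.prodMk contDiff_id)
  have hn : (∑ a : CoordIndex d, lam a.1) = ∑ i, (d i : ℝ) * lam i := by
    rw [Fintype.sum_sigma]
    simp
  have h1 : frameD lam C none (frameD lam C none f) (u, x) = deriv (deriv fun s => f (s, x)) u := by
    rw [frameD_none (hD none)]
    refine congrArg (fun k => deriv k u) (funext fun s => frameD_none hfd s x)
  have h2 : ∀ a, frameD lam C (some a) (frameD lam C (some a) f) (u, x) =
      ∑ b, ∑ c, (Real.exp (u * (2 * lam a.1)) : ℂ) * (structVec C x a b : ℂ)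
        * coordPartial b (fun y => (structVec C y a c : ℂ) *
            coordPartial c (fun z => f (u, z)) y) x := by
    intro a
    have hG : ∀ c, Differentiable ℝ fun y => (structVec C y a c : ℂ) *
        coordPartial c (fun z => f (u, z)) y := by
      intro c
      have h3 : ContDiff ℝ ∞ fun y => ((structVec C y a c : ℝ) : ℂ) :=
        Complex.ofRealCLM.contDiff.comp (contDiff_pi.1 (contDiff_structVec C a) c)
      exact (h3.differentiable (by simp)).fun_mul
        ((contDiff_coordPartial (n := 1) hfu (by norm_num) c).differentiable (by norm_num))
    rw [frameD_some (hD _)]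
    simp only [frameD_some hfd, coordPartial_const_mul]
    rw [Finset.mul_sum]
    refine Finset.sum_congr rfl fun b _ => ?_
    rw [coordPartial_sum _ fun c _ => hG c x, Finset.mul_sum, Finset.mul_sum, Finset.mul_sum]
    refine Finset.sum_congr rfl fun c _ => ?_
    rw [show u * (2 * lam a.1) = u * lam a.1 + u * lam a.1 by ring, Real.exp_add]
    push_cast
    ring
  rw [frameLaplace, Fintype.sum_option, h1, hn, frameD_none hfd, Complex.real_smul]
  simp only [h2]
  ring

/-- The change of variables `u = log t`. -/
lemma euler_operator_comp_log {G : ℝ → ℂ} (hG : ContDiff ℝ 2 G) (n : ℂ) {t : ℝ} (ht : 0 < t) :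
    (t : ℂ) ^ 2 * iteratedDeriv 2 (fun s => G (Real.log s)) t
      + (1 - n) * (t : ℂ) * deriv (fun s => G (Real.log s)) t =
    deriv (deriv G) (Real.log t) - n * deriv G (Real.log t) := by
  have h1 : ∀ s : ℝ, 0 < s → HasDerivAt (fun s => G (Real.log s))
      ((s : ℂ)⁻¹ * deriv G (Real.log s)) s := by
    intro s hs
    have := (hG.differentiable (by norm_num) (Real.log s)).hasDerivAt.scomp s
      (Real.hasDerivAt_log hs.ne')
    refine this.congr_deriv ?_
    rw [Complex.real_smul]
    push_cast
    rfl
  have hG' : Differentiable ℝ (deriv G) :=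
    (hG.iterate_deriv' 1 1).differentiable (by norm_num)
  have h2 : HasDerivAt (fun s : ℝ => (s : ℂ)⁻¹ * deriv G (Real.log s))
      (-((t : ℂ) ^ 2)⁻¹ * deriv G (Real.log t) + (t : ℂ)⁻¹ * ((t : ℂ)⁻¹ * deriv (deriv G) (Real.log t))) t := by
    have h3 : HasDerivAt (fun s : ℝ => (s : ℂ)⁻¹) (-((t : ℂ) ^ 2)⁻¹) t := by
      have := (hasDerivAt_inv ht.ne').ofReal_comp
      push_cast at this
      exact this
    have h4 := (hG' (Real.log t)).hasDerivAt.scomp t (Real.hasDerivAt_log ht.ne')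
    refine h3.mul (h4.congr_deriv ?_)
    rw [Complex.real_smul]
    push_cast
    rfl
  have h5 : deriv (fun s => G (Real.log s)) =ᶠ[nhds t]
      fun s : ℝ => (s : ℂ)⁻¹ * deriv G (Real.log s) := by
    filter_upwards [lt_mem_nhds ht] with s hs using (h1 s hs).deriv
  rw [iteratedDeriv_succ, iteratedDeriv_one, h5.deriv_eq, h2.deriv, (h1 t ht).deriv]
  have ht' : (t : ℂ) ≠ 0 := by exact_mod_cast ht.ne'
  field_simp
  ring

end FrameLaplacian

/-! ### Functions of the first one or two blocks of variables -/

section FrameOperator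

variable {ι : Type*} [Fintype ι] [DecidableEq ι] {f : (ι → ℝ) → ℂ} {s : Set ι}

omit [Fintype ι] in
lemma update_eqOn {x y : ι → ℝ} {a : ι} (h : ∀ i ∈ s, i ≠ a → x i = y i) (r : ℝ) :
    ∀ i ∈ s, Function.update x a r i = Function.update y a r i := by
  intro i hi
  by_cases hia : i = a
  · subst hia; simp
  · simp [hia, h i hi hia]

lemma coordPartial_eq_zero (hf : DependsOn f s) {a : ι} (ha : a ∉ s) (x : ι → ℝ) :
    coordPartial a f x = 0 := by
  have h1 : (fun r : ℝ => f (Function.update x a r)) = fun _ => f x := by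
    funext r
    refine hf fun i hi => ?_
    rw [Function.update_of_ne (by rintro rfl; exact ha hi)]
  rw [coordPartial, h1, deriv_const]

lemma dependsOn_coordPartial (hf : DependsOn f s) (a : ι) : DependsOn (coordPartial a f) s := by
  intro x y hxy
  by_cases ha : a ∈ s
  · have h1 : (fun r : ℝ => f (Function.update x a r)) = fun r => f (Function.update y a r) :=
      funext fun r => hf (update_eqOn (fun i hi _ => hxy i hi) r)
    rw [coordPartial, coordPartial, h1, hxy a ha]
  · rw [coordPartial_eq_zero hf ha, coordPartial_eq_zero hf ha]

variable {m : ℕ} {d : Fin m → ℕ} {lam : Fin m → ℝ}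
  {C : CoordIndex d → CoordIndex d → CoordIndex d → ℝ} {f : (CoordIndex d → ℝ) → ℂ}

lemma structVec_of_le {a b : CoordIndex d} (h : b.1 ≤ a.1) (x : CoordIndex d → ℝ) :
    structVec C x a b = if a = b then 1 else 0 := by
  rw [structVec, structPoly, if_pos h]
  split_ifs <;> simp

/-- Between adjacent blocks the powers `r ≥ 2` of `adMatrix` vanish, leaving the term with `B_1 =
1/2`. By the grading only variables of the first block occur in it. -/
lemma IsGraded.structVec_zero_one (hC : IsGraded C lam) (hm : 0 < m) (hm2 : 1 < m)
    (j : Fin (d ⟨0, hm⟩)) (β : Fin (d ⟨1, hm2⟩)) (x : CoordIndex d → ℝ) :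
    structVec C x ⟨⟨0, hm⟩, j⟩ ⟨⟨1, hm2⟩, β⟩ =
      1 / 2 * ∑ l, C ⟨⟨0, hm⟩, l⟩ ⟨⟨0, hm⟩, j⟩ ⟨⟨1, hm2⟩, β⟩ * x ⟨⟨0, hm⟩, l⟩ := by
  rw [structVec, hC.eval_structPoly]
  obtain ⟨k, rfl⟩ : ∃ k, m = k + 2 := ⟨m - 2, by omega⟩
  rw [Finset.sum_range_succ', Finset.sum_range_succ', Finset.sum_eq_zero, pow_zero,
    Matrix.one_apply_ne (by simp [Sigma.ext_iff]), pow_one, bernoulli'_one, adMatrix, Matrix.of_apply,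
    Fintype.sum_sigma, Fintype.sum_eq_single (⟨0, hm⟩ : Fin (k + 2))]
  · simp [mul_comm]
  · intro i hi
    refine Finset.sum_eq_zero fun l _ => ?_
    by_contra h
    have := hC.lt_left (right_ne_zero_of_mul h)
    rw [Fin.lt_def] at this
    refine hi (Fin.ext ?_)
    simp only at this ⊢
    omega
  · intro r _
    rw [hC.adMatrix_pow_eq_zero x (r + 1 + 1) (by simp), mul_zero]

/-- The left-invariant vector fields at `t = 1`, acting on functions of `x`. -/
def frameOp (C : CoordIndex d → CoordIndex d → CoordIndex d → ℝ) (a : CoordIndex d)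
    (f : (CoordIndex d → ℝ) → ℂ) (x : CoordIndex d → ℝ) : ℂ :=
  ∑ c, (structVec C x a c : ℂ) * coordPartial c f x

lemma sum_eq_frameOp_frameOp (hf : ContDiff ℝ 2 f) (T : ℂ) (a : CoordIndex d)
    (x : CoordIndex d → ℝ) :
    ∑ b, ∑ c, T * (structVec C x a b : ℂ) * coordPartial b (fun y => (structVec C y a c : ℂ) *
      coordPartial c f y) x = T * frameOp C a (frameOp C a f) x := by
  have hG : ∀ c, Differentiable ℝ fun y => (structVec C y a c : ℂ) * coordPartial c f y := by
    intro c
    have h3 : ContDiff ℝ ∞ fun y => ((structVec C y a c : ℝ) : ℂ) :=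
      Complex.ofRealCLM.contDiff.comp (contDiff_pi.1 (contDiff_structVec C a) c)
    exact (h3.differentiable (by simp)).fun_mul
      ((contDiff_coordPartial (n := 1) hf (by norm_num) c).differentiable (by norm_num))
  rw [frameOp, Finset.mul_sum]
  refine Finset.sum_congr rfl fun b _ => ?_
  rw [show frameOp C a f = fun y => ∑ c, (structVec C y a c : ℂ) * coordPartial c f y from rfl,
    coordPartial_sum _ fun c _ => hG c x, Finset.mul_sum, Finset.mul_sum]
  exact Finset.sum_congr rfl fun c _ => by ring

/-- Only derivatives along the first block survive, and the first block is never above that of `a`,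
where `P` is the Kronecker delta. -/
lemma frameOp_of_dependsOn_zero (hm : 0 < m)
    (hf : DependsOn f {a : CoordIndex d | a.1 = ⟨0, hm⟩}) (a : CoordIndex d)
    (x : CoordIndex d → ℝ) : frameOp C a f x = coordPartial a f x := by
  rw [frameOp, Finset.sum_eq_single a]
  · rw [structVec_of_le le_rfl, if_pos rfl, Complex.ofReal_one, one_mul]
  · intro c _ hc
    by_cases h : c.1 = ⟨0, hm⟩
    · rw [structVec_of_le (by rw [h, Fin.le_def]; exact Nat.zero_le _), if_neg hc.symm,
        Complex.ofReal_zero, zero_mul]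
    · rw [coordPartial_eq_zero hf h, mul_zero]
  · simp

/-- The Laplace-Beltrami operator on functions of `x^1`. -/
lemma sum_frameOp_of_dependsOn_zero (hm : 0 < m)
    (hf : DependsOn f {a : CoordIndex d | a.1 = ⟨0, hm⟩}) (T : Fin m → ℂ) (x : CoordIndex d → ℝ) :
    ∑ a : CoordIndex d, T a.1 * frameOp C a (frameOp C a f) x =
      T ⟨0, hm⟩ * ∑ j, coordPartial ⟨⟨0, hm⟩, j⟩ (coordPartial ⟨⟨0, hm⟩, j⟩ f) x := by
  have h1 : ∀ a, frameOp C a f = coordPartial a f := fun a =>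
    funext fun x => frameOp_of_dependsOn_zero hm hf a x
  simp only [h1, frameOp_of_dependsOn_zero hm (dependsOn_coordPartial hf _)]
  rw [Fintype.sum_sigma, Fintype.sum_eq_single (⟨0, hm⟩ : Fin m), Finset.mul_sum]
  intro i hi
  refine Finset.sum_eq_zero fun j _ => ?_
  rw [coordPartial_eq_zero (dependsOn_coordPartial hf _) (by exact hi), mul_zero]

variable (hm : 0 < m) (hm2 : 1 < m)

lemma sum_coordIndex_eq_add {F : CoordIndex d → ℂ}
    (hF : ∀ a : CoordIndex d, a.1 ≠ ⟨0, hm⟩ → a.1 ≠ ⟨1, hm2⟩ → F a = 0) :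
    ∑ a, F a = ∑ j, F ⟨⟨0, hm⟩, j⟩ + ∑ β, F ⟨⟨1, hm2⟩, β⟩ := by
  rw [Fintype.sum_sigma, Fintype.sum_eq_add (⟨0, hm⟩ : Fin m) ⟨1, hm2⟩ (by simp)]
  rintro i ⟨h0, h1⟩
  exact Finset.sum_eq_zero fun j _ => hF ⟨i, j⟩ h0 h1

variable (hf : DependsOn f {a : CoordIndex d | a.1 = ⟨0, hm⟩ ∨ a.1 = ⟨1, hm2⟩})
include hf

lemma frameOp_of_one_le {a : CoordIndex d} (ha : (⟨1, hm2⟩ : Fin m) ≤ a.1) (x : CoordIndex d → ℝ) :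
    frameOp C a f x = coordPartial a f x := by
  rw [frameOp, Finset.sum_eq_single a]
  · rw [structVec_of_le le_rfl, if_pos rfl, Complex.ofReal_one, one_mul]
  · intro c _ hc
    by_cases h : c.1 = ⟨0, hm⟩ ∨ c.1 = ⟨1, hm2⟩
    · have h1 : c.1 ≤ a.1 := by
        refine le_trans ?_ ha
        rcases h with h | h <;> rw [h, Fin.le_def]
        exact Nat.zero_le _
      rw [structVec_of_le h1, if_neg hc.symm, Complex.ofReal_zero, zero_mul]
    · rw [coordPartial_eq_zero hf h, mul_zero]
  · simp

lemma frameOp_zero (j : Fin (d ⟨0, hm⟩)) (x : CoordIndex d → ℝ) :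
    frameOp C ⟨⟨0, hm⟩, j⟩ f x = coordPartial ⟨⟨0, hm⟩, j⟩ f x +
      ∑ β, (structVec C x ⟨⟨0, hm⟩, j⟩ ⟨⟨1, hm2⟩, β⟩ : ℂ) * coordPartial ⟨⟨1, hm2⟩, β⟩ f x := by
  rw [frameOp, sum_coordIndex_eq_add hm hm2]
  · congr 1
    rw [Finset.sum_eq_single j]
    · rw [structVec_of_le le_rfl, if_pos rfl, Complex.ofReal_one, one_mul]
    · intro l _ hl
      have h1 : structVec C x ⟨⟨0, hm⟩, j⟩ ⟨⟨0, hm⟩, l⟩ = 0 :=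
        (structVec_of_le (le_refl (⟨0, hm⟩ : Fin m)) x).trans (if_neg (by simpa using hl.symm))
      rw [h1, Complex.ofReal_zero, zero_mul]
    · simp
  · intro a h0 h1
    rw [coordPartial_eq_zero hf (by simp [h0, h1]), mul_zero]

/-- The coefficients between the first two blocks involve the first block of variables only, so the
class of functions is preserved and the field can be applied twice. -/
lemma dependsOn_frameOp (hC : IsGraded C lam) (a : CoordIndex d) :
    DependsOn (frameOp C a f) {a : CoordIndex d | a.1 = ⟨0, hm⟩ ∨ a.1 = ⟨1, hm2⟩} := by
  intro x y hxy
  obtain ⟨i, j⟩ := a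
  by_cases hi : i = ⟨0, hm⟩
  · subst hi
    rw [frameOp_zero hm hm2 hf, frameOp_zero hm hm2 hf, dependsOn_coordPartial hf _ hxy]
    congr 1
    refine Finset.sum_congr rfl fun β _ => ?_
    rw [dependsOn_coordPartial hf _ hxy, hC.structVec_zero_one hm hm2, hC.structVec_zero_one hm hm2]
    have h1 : ∀ l, x ⟨⟨0, hm⟩, l⟩ = y ⟨⟨0, hm⟩, l⟩ := fun l => hxy _ (Or.inl rfl)
    simp only [h1]
  · have h1 : (⟨1, hm2⟩ : Fin m) ≤ i := by
      rw [Fin.le_def]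
      rw [Fin.ext_iff] at hi
      simp only at hi ⊢
      omega
    rw [frameOp_of_one_le hm hm2 hf h1, frameOp_of_one_le hm hm2 hf h1]
    exact dependsOn_coordPartial hf _ hxy

/-- The square of `∂_j + ∑ P_{jβ} ∂_β` has no first-order terms, because none of these derivations
acts on the coefficients `P_{jβ}`. -/
lemma frameOp_frameOp_zero (hC : IsGraded C lam) (hanti : ∀ a b c, C a b c = -C b a c)
    (hf2 : ContDiff ℝ 2 f) (j : Fin (d ⟨0, hm⟩)) (x : CoordIndex d → ℝ) :
    frameOp C ⟨⟨0, hm⟩, j⟩ (frameOp C ⟨⟨0, hm⟩, j⟩ f) x =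
      coordPartial ⟨⟨0, hm⟩, j⟩ (coordPartial ⟨⟨0, hm⟩, j⟩ f) x
      + 2 * ∑ β, (structVec C x ⟨⟨0, hm⟩, j⟩ ⟨⟨1, hm2⟩, β⟩ : ℂ)
        * coordPartial ⟨⟨0, hm⟩, j⟩ (coordPartial ⟨⟨1, hm2⟩, β⟩ f) x
      + ∑ l, ∑ β, (structVec C x ⟨⟨0, hm⟩, j⟩ ⟨⟨1, hm2⟩, l⟩ : ℂ)
        * (structVec C x ⟨⟨0, hm⟩, j⟩ ⟨⟨1, hm2⟩, β⟩ : ℂ)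
        * coordPartial ⟨⟨1, hm2⟩, l⟩ (coordPartial ⟨⟨1, hm2⟩, β⟩ f) x := by
  have hd : ∀ c, Differentiable ℝ (coordPartial c f) := fun c =>
    (contDiff_coordPartial (n := 1) hf2 (by norm_num) c).differentiable (by norm_num)
  have hL : ∀ β, Differentiable ℝ fun y => ((structVec C y ⟨⟨0, hm⟩, j⟩ ⟨⟨1, hm2⟩, β⟩ : ℝ) : ℂ) := by
    intro β
    have h3 : ContDiff ℝ ∞ fun y => ((structVec C y ⟨⟨0, hm⟩, j⟩ ⟨⟨1, hm2⟩, β⟩ : ℝ) : ℂ) :=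
      Complex.ofRealCLM.contDiff.comp (contDiff_pi.1 (contDiff_structVec C _) _)
    exact h3.differentiable (by simp)
  -- `P_{jβ}` contains no variable of the second block, and it does not contain `x_j` since
  -- antisymmetry gives `C j j β = 0`.
  have hdL : ∀ β (c : CoordIndex d), c = ⟨⟨0, hm⟩, j⟩ ∨ c.1 = ⟨1, hm2⟩ → coordPartial c
      (fun y => ((structVec C y ⟨⟨0, hm⟩, j⟩ ⟨⟨1, hm2⟩, β⟩ : ℝ) : ℂ)) x = 0 := by
    intro β c hc
    refine coordPartial_eq_zero (s := {c}ᶜ) (fun y z hyz => ?_) (by simp) x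
    simp only [hC.structVec_zero_one hm hm2]
    congr 2
    refine Finset.sum_congr rfl fun l _ => ?_
    by_cases hl : (⟨⟨0, hm⟩, l⟩ : CoordIndex d) = c
    · rcases hc with hc | hc
      · have h1 := hanti ⟨⟨0, hm⟩, j⟩ ⟨⟨0, hm⟩, j⟩ ⟨⟨1, hm2⟩, β⟩
        have h2 : C ⟨⟨0, hm⟩, j⟩ ⟨⟨0, hm⟩, j⟩ ⟨⟨1, hm2⟩, β⟩ = 0 := by linarith
        rw [hl, hc, h2, zero_mul, zero_mul]
      · rw [← hl] at hc
        simp at hc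
    · rw [hyz _ (by simpa using hl)]
  have hG : ∀ c : CoordIndex d, c = ⟨⟨0, hm⟩, j⟩ ∨ c.1 = ⟨1, hm2⟩ →
      coordPartial c (frameOp C ⟨⟨0, hm⟩, j⟩ f) x = coordPartial c (coordPartial ⟨⟨0, hm⟩, j⟩ f) x +
        ∑ β, (structVec C x ⟨⟨0, hm⟩, j⟩ ⟨⟨1, hm2⟩, β⟩ : ℂ)
          * coordPartial c (coordPartial ⟨⟨1, hm2⟩, β⟩ f) x := by
    intro c hc
    have h1 : ∀ β ∈ Finset.univ, DifferentiableAt ℝ (fun y =>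
        ((structVec C y ⟨⟨0, hm⟩, j⟩ ⟨⟨1, hm2⟩, β⟩ : ℝ) : ℂ) * coordPartial ⟨⟨1, hm2⟩, β⟩ f y) x :=
      fun β _ => (hL β x).fun_mul (hd _ x)
    rw [show frameOp C ⟨⟨0, hm⟩, j⟩ f = _ from funext fun y => frameOp_zero hm hm2 hf j y,
      coordPartial_eq_fderiv ((hd _ x).fun_add (DifferentiableAt.fun_sum h1)),
      fderiv_fun_add (hd _ x) (DifferentiableAt.fun_sum h1), add_apply, ← coordPartial_eq_fderiv (hd _ x),
      ← coordPartial_eq_fderiv (DifferentiableAt.fun_sum h1), coordPartial_sum _ h1]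
    congr 1
    refine Finset.sum_congr rfl fun β _ => ?_
    rw [coordPartial_mul (hL β x) (hd _ x), hdL β c hc, zero_mul, zero_add]
  rw [frameOp_zero hm hm2 (dependsOn_frameOp hm hm2 hf hC _), hG _ (Or.inl rfl)]
  have h1 : ∀ β, coordPartial ⟨⟨1, hm2⟩, β⟩ (frameOp C ⟨⟨0, hm⟩, j⟩ f) x =
      coordPartial ⟨⟨0, hm⟩, j⟩ (coordPartial ⟨⟨1, hm2⟩, β⟩ f) x +
        ∑ l, (structVec C x ⟨⟨0, hm⟩, j⟩ ⟨⟨1, hm2⟩, l⟩ : ℂ)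
          * coordPartial ⟨⟨1, hm2⟩, β⟩ (coordPartial ⟨⟨1, hm2⟩, l⟩ f) x := fun β => by
    rw [hG _ (Or.inr rfl), coordPartial_comm hf2]
  simp only [h1, mul_add, Finset.sum_add_distrib, Finset.mul_sum, two_mul, mul_assoc]
  ring

/-- The Laplace-Beltrami operator on functions of `x^1` and `x^2`. -/
lemma sum_frameOp_of_dependsOn_zero_one (hC : IsGraded C lam) (hanti : ∀ a b c, C a b c = -C b a c)
    (hf2 : ContDiff ℝ 2 f) (T : Fin m → ℂ) (x : CoordIndex d → ℝ) :
    ∑ a : CoordIndex d, T a.1 * frameOp C a (frameOp C a f) x =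
      T ⟨0, hm⟩ * ∑ j, coordPartial ⟨⟨0, hm⟩, j⟩ (coordPartial ⟨⟨0, hm⟩, j⟩ f) x
      + T ⟨0, hm⟩ * ∑ j, ∑ l, ∑ β,
          ((C ⟨⟨0, hm⟩, j⟩ ⟨⟨0, hm⟩, l⟩ ⟨⟨1, hm2⟩, β⟩ * x ⟨⟨0, hm⟩, j⟩ : ℝ) : ℂ)
            * coordPartial ⟨⟨0, hm⟩, l⟩ (coordPartial ⟨⟨1, hm2⟩, β⟩ f) x
      + T ⟨1, hm2⟩ * ∑ l, coordPartial ⟨⟨1, hm2⟩, l⟩ (coordPartial ⟨⟨1, hm2⟩, l⟩ f) x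
      + T ⟨0, hm⟩ / 4 * ∑ j, ∑ r, ∑ s, ∑ l, ∑ β,
          ((C ⟨⟨0, hm⟩, r⟩ ⟨⟨0, hm⟩, j⟩ ⟨⟨1, hm2⟩, l⟩ * C ⟨⟨0, hm⟩, s⟩ ⟨⟨0, hm⟩, j⟩ ⟨⟨1, hm2⟩, β⟩
            * x ⟨⟨0, hm⟩, r⟩ * x ⟨⟨0, hm⟩, s⟩ : ℝ) : ℂ)
            * coordPartial ⟨⟨1, hm2⟩, l⟩ (coordPartial ⟨⟨1, hm2⟩, β⟩ f) x := by
  have h1 : ∀ a : CoordIndex d, (⟨1, hm2⟩ : Fin m) ≤ a.1 →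
      frameOp C a (frameOp C a f) x = coordPartial a (coordPartial a f) x := by
    intro a ha
    rw [frameOp_of_one_le hm hm2 (dependsOn_frameOp hm hm2 hf hC _) ha,
      show frameOp C a f = _ from funext fun y => frameOp_of_one_le hm hm2 hf ha y]
  rw [sum_coordIndex_eq_add hm hm2]
  · have h2 : ∀ β, frameOp C ⟨⟨1, hm2⟩, β⟩ (frameOp C ⟨⟨1, hm2⟩, β⟩ f) x =
        coordPartial ⟨⟨1, hm2⟩, β⟩ (coordPartial ⟨⟨1, hm2⟩, β⟩ f) x := fun β => h1 _ le_rfl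
    -- The factor 2 of the mixed derivatives cancels the 1/2 in `P`.
    have h3 : ∑ j, ∑ l, ∑ β, ((C ⟨⟨0, hm⟩, j⟩ ⟨⟨0, hm⟩, l⟩ ⟨⟨1, hm2⟩, β⟩ * x ⟨⟨0, hm⟩, j⟩ : ℝ) : ℂ)
            * coordPartial ⟨⟨0, hm⟩, l⟩ (coordPartial ⟨⟨1, hm2⟩, β⟩ f) x =
        ∑ j, 2 * ∑ β, (structVec C x ⟨⟨0, hm⟩, j⟩ ⟨⟨1, hm2⟩, β⟩ : ℂ)
          * coordPartial ⟨⟨0, hm⟩, j⟩ (coordPartial ⟨⟨1, hm2⟩, β⟩ f) x := by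
      rw [Finset.sum_comm]
      refine Finset.sum_congr rfl fun l _ => ?_
      rw [Finset.sum_comm, Finset.mul_sum]
      refine Finset.sum_congr rfl fun β _ => ?_
      rw [← Finset.sum_mul, ← Complex.ofReal_sum, hC.structVec_zero_one hm hm2]
      push_cast
      ring
    -- The 4 undoes the two factors 1/2, one from each `P`.
    have h4 : ∀ j, ∑ r, ∑ s, ∑ l, ∑ β,
          ((C ⟨⟨0, hm⟩, r⟩ ⟨⟨0, hm⟩, j⟩ ⟨⟨1, hm2⟩, l⟩ * C ⟨⟨0, hm⟩, s⟩ ⟨⟨0, hm⟩, j⟩ ⟨⟨1, hm2⟩, β⟩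
            * x ⟨⟨0, hm⟩, r⟩ * x ⟨⟨0, hm⟩, s⟩ : ℝ) : ℂ)
            * coordPartial ⟨⟨1, hm2⟩, l⟩ (coordPartial ⟨⟨1, hm2⟩, β⟩ f) x =
        4 * ∑ l, ∑ β, (structVec C x ⟨⟨0, hm⟩, j⟩ ⟨⟨1, hm2⟩, l⟩ : ℂ)
          * (structVec C x ⟨⟨0, hm⟩, j⟩ ⟨⟨1, hm2⟩, β⟩ : ℂ)
          * coordPartial ⟨⟨1, hm2⟩, l⟩ (coordPartial ⟨⟨1, hm2⟩, β⟩ f) x := by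
      intro j
      have h5 : ∀ F : Fin (d ⟨0, hm⟩) → Fin (d ⟨0, hm⟩) → Fin (d ⟨1, hm2⟩) → Fin (d ⟨1, hm2⟩) → ℂ,
          ∑ r, ∑ s, ∑ l, ∑ β, F r s l β = ∑ l, ∑ β, ∑ r, ∑ s, F r s l β := by
        intro F
        calc _ = ∑ r, ∑ l, ∑ s, ∑ β, F r s l β :=
              Finset.sum_congr rfl fun r _ => Finset.sum_comm
          _ = ∑ l, ∑ r, ∑ s, ∑ β, F r s l β := Finset.sum_comm
          _ = ∑ l, ∑ r, ∑ β, ∑ s, F r s l β :=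
              Finset.sum_congr rfl fun l _ => Finset.sum_congr rfl fun r _ => Finset.sum_comm
          _ = _ := Finset.sum_congr rfl fun l _ => Finset.sum_comm
      rw [h5, Finset.mul_sum]
      refine Finset.sum_congr rfl fun l _ => ?_
      rw [Finset.mul_sum]
      refine Finset.sum_congr rfl fun β _ => ?_
      have h6 : ∑ r, ∑ s,
          ((C ⟨⟨0, hm⟩, r⟩ ⟨⟨0, hm⟩, j⟩ ⟨⟨1, hm2⟩, l⟩ * C ⟨⟨0, hm⟩, s⟩ ⟨⟨0, hm⟩, j⟩ ⟨⟨1, hm2⟩, β⟩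
            * x ⟨⟨0, hm⟩, r⟩ * x ⟨⟨0, hm⟩, s⟩ : ℝ) : ℂ) =
          4 * ((structVec C x ⟨⟨0, hm⟩, j⟩ ⟨⟨1, hm2⟩, l⟩ : ℂ)
            * (structVec C x ⟨⟨0, hm⟩, j⟩ ⟨⟨1, hm2⟩, β⟩ : ℂ)) := by
        rw [hC.structVec_zero_one hm hm2, hC.structVec_zero_one hm hm2]
        push_cast
        rw [show ∀ p q : ℂ, 4 * (1 / 2 * p * (1 / 2 * q)) = p * q from fun p q => by ring,
          Finset.sum_mul_sum]
        exact Finset.sum_congr rfl fun r _ => Finset.sum_congr rfl fun s _ => by ring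
      simp only [← Finset.sum_mul]
      rw [h6]
      ring
    simp only [h2, h3, h4, frameOp_frameOp_zero hm hm2 hf hC hanti hf2, ← Finset.mul_sum,
      Finset.sum_add_distrib]
    ring
  · intro a h0 h2
    have h3 : (⟨1, hm2⟩ : Fin m) ≤ a.1 := by
      rw [Fin.le_def]
      rw [ne_eq, Fin.ext_iff] at h0
      simp only at h0 ⊢
      omega
    rw [h1 a h3, coordPartial_eq_zero (dependsOn_coordPartial hf _) (by simp [h0, h2]), mul_zero]

end FrameOperator

end

noncomputable section

/-! ### The formulas in the coordinates (t, x) -/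

section MainTheorem

universe u
variable {E : Type u} [NormedAddCommGroup E] [NormedSpace ℝ E] [FiniteDimensional ℝ E]
  {S : Type*} [TopologicalSpace S] [T2Space S] [ChartedSpace E S] [Group S]
  [LieGroup 𝓘(ℝ, E) ∞ S] {g : RiemMetric E S} {m : ℕ} {d : Fin m → ℕ} {lam : Fin m → ℝ}
  {C : CoordIndex d → CoordIndex d → CoordIndex d → ℝ} {A : E} {X : CoordIndex d → E}

lemma exp_log_mul_eq_rpow {t : ℝ} (ht : 0 < t) (r : ℝ) : Real.exp (Real.log t * r) = t ^ r :=
  (Real.rpow_def_of_pos ht r).symm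

namespace IsModelFrame

variable (hX : IsModelFrame g lam C A X) [Nonempty (CoordIndex d)] [ConnectedSpace S]
include hX

lemma exists_global_coordinates :
    ContMDiffOn 𝓘(ℝ, ℝ × (CoordIndex d → ℝ)) 𝓘(ℝ, E) ∞
        (fun y : ℝ × (CoordIndex d → ℝ) => coordMap S A X (Real.log y.1, y.2))
        (Set.Ioi 0 ×ˢ Set.univ) ∧
      ∃ Ψ : S → ℝ × (CoordIndex d → ℝ),
        ContMDiff 𝓘(ℝ, E) 𝓘(ℝ, ℝ × (CoordIndex d → ℝ)) ∞ Ψ ∧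
        (∀ p, 0 < (Ψ p).1 ∧ coordMap S A X (Real.log (Ψ p).1, (Ψ p).2) = p) ∧
        ∀ t x, 0 < t → Ψ (coordMap S A X (Real.log t, x)) = (t, x) := by
  obtain ⟨Ψ, hΨ, h1, h2⟩ := hX.exists_inverse (S := S)
  refine ⟨?_, fun p => (Real.exp (Ψ p).1, (Ψ p).2), ?_, fun p => ⟨Real.exp_pos _, ?_⟩, fun t x ht => ?_⟩
  · have h3 : ContDiffOn ℝ ∞ (fun y : ℝ × (CoordIndex d → ℝ) => (Real.log y.1, y.2))
        (Set.Ioi 0 ×ˢ Set.univ) := by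
      refine ContDiffOn.prodMk (ContDiffOn.log contDiff_fst.contDiffOn fun y hy => ?_)
        contDiff_snd.contDiffOn
      exact (Set.mem_Ioi.1 hy.1).ne'
    exact (contMDiff_coordMap S A X).comp_contMDiffOn h3.contMDiffOn
  · have h3 : ContDiff ℝ ∞ fun y : ℝ × (CoordIndex d → ℝ) => (Real.exp y.1, y.2) :=
      (Real.contDiff_exp.comp contDiff_fst).prodMk contDiff_snd
    exact h3.contMDiff.comp hΨ
  · simp only [Real.log_exp]
    exact h1 p
  · simp only [h2, Real.exp_log ht]

/-- The Laplace-Beltrami operator in the coordinates `(t, x)`. -/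
lemma laplaceBeltrami_coordMap_log (hg : IsLeftInvariant g) {φ : S → ℂ}
    (hφ : ContMDiff 𝓘(ℝ, E) 𝓘(ℝ, ℂ) 2 φ) {t : ℝ} (ht : 0 < t) (x : CoordIndex d → ℝ) :
    laplaceBeltrami g φ (coordMap S A X (Real.log t, x)) =
        (t : ℂ) ^ 2 * iteratedDeriv 2 (fun s => φ (coordMap S A X (Real.log s, x))) t
        + ((1 - ∑ i, (d i : ℝ) * lam i : ℝ) : ℂ) * (t : ℂ)
            * deriv (fun s => φ (coordMap S A X (Real.log s, x))) t
        + ∑ a, ∑ b, ∑ c, ((t ^ (2 * lam a.1) : ℝ) : ℂ) * (structVec C x a b : ℂ)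
            * coordPartial b (fun y => (structVec C y a c : ℂ)
                * coordPartial c (fun z => φ (coordMap S A X (Real.log t, z))) y) x := by
  have h2 : ContDiff ℝ 2 fun q => φ (coordMap S A X q) := contDiff_comp_coordMap hφ A X
  rw [hX.laplaceBeltrami_coordMap hg hφ, frameLaplace_eq h2]
  have h3 : ContDiff ℝ 2 fun s => φ (coordMap S A X (s, x)) :=
    h2.comp (contDiff_id.prodMk contDiff_const)
  have h4 := euler_operator_comp_log h3 ((∑ i, (d i : ℝ) * lam i : ℝ) : ℂ) ht
  rw [← h4]
  simp only [exp_log_mul_eq_rpow ht]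
  push_cast
  ring

lemma laplaceBeltrami_of_const {φ : S → ℂ} (hg : IsLeftInvariant g)
    (hφ : ContMDiff 𝓘(ℝ, E) 𝓘(ℝ, ℂ) 2 φ) {t : ℝ} (ht : 0 < t) (x : CoordIndex d → ℝ)
    (hconst : ∀ t t' : ℝ, 0 < t → 0 < t' →
      φ (coordMap S A X (Real.log t, x)) = φ (coordMap S A X (Real.log t', x))) :
    laplaceBeltrami g φ (coordMap S A X (Real.log t, x)) =
      ∑ a, ((t ^ (2 * lam a.1) : ℝ) : ℂ) *
        frameOp C a (frameOp C a fun z => φ (coordMap S A X (Real.log t, z))) x := by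
  have h2 : ContDiff ℝ 2 fun q => φ (coordMap S A X q) := contDiff_comp_coordMap hφ A X
  -- Independence is assumed for positive `t`; since `s = log (exp s)` it holds for every real `s`,
  -- and the derivatives in `s` vanish.
  have h3 : (fun s => φ (coordMap S A X (s, x))) = fun _ => φ (coordMap S A X (0, x)) := by
    funext s
    have := hconst (Real.exp s) 1 (Real.exp_pos s) one_pos
    rwa [Real.log_exp, Real.log_one] at this
  have h4 : ContDiff ℝ 2 fun z => φ (coordMap S A X (Real.log t, z)) :=
    contDiff_comp_coordMap_snd hφ A X _
  rw [hX.laplaceBeltrami_coordMap hg hφ, frameLaplace_eq h2, h3]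
  simp only [sum_eq_frameOp_frameOp h4, exp_log_mul_eq_rpow ht, deriv_const', deriv_const, mul_zero,
    sub_zero, zero_add]

end IsModelFrame

end MainTheorem

end

theorem mainTheorem3
    {E : Type*} [NormedAddCommGroup E] [NormedSpace ℝ E] [FiniteDimensional ℝ E]
    {S : Type*} [TopologicalSpace S] [T2Space S] [ChartedSpace E S] [Group S]
    [LieGroup 𝓘(ℝ, E) ∞ S]
    (g : RiemMetric E S) (hS : IsIwasawaType g) (hrank : iwasawaRank g = 1)
    {m : ℕ} (hm : 0 < m) (d : Fin m → ℕ) (lam : Fin m → ℝ)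
    (A : GroupLieAlgebra 𝓘(ℝ, E) S) (X : CoordIndex d → GroupLieAlgebra 𝓘(ℝ, E) S)
    (hX : IsAdaptedFrame g d lam A X) :
    -- `(t, x)` are global coordinates
    (ContMDiffOn 𝓘(ℝ, ℝ × (CoordIndex d → ℝ)) 𝓘(ℝ, E) ∞
        (fun y : ℝ × (CoordIndex d → ℝ) => coordPoint A X y.1 y.2) (Set.Ioi 0 ×ˢ Set.univ) ∧
      ∃ Ψ : S → ℝ × (CoordIndex d → ℝ),
        ContMDiff 𝓘(ℝ, E) 𝓘(ℝ, ℝ × (CoordIndex d → ℝ)) ∞ Ψ ∧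
        (∀ p, 0 < (Ψ p).1 ∧ coordPoint A X (Ψ p).1 (Ψ p).2 = p) ∧
        ∀ t x, 0 < t → Ψ (coordPoint A X t x) = (t, x)) ∧
    -- the polynomials
    (∀ r a b, (homPoly (structConst g X) r a b).IsHomogeneous (r + 1)) ∧
    (∀ a b, (structPoly (structConst g X) a b).totalDegree < m) ∧
    -- the Laplace-Beltrami operator in global coordinates
    (∀ φ : S → ℂ, ContMDiff 𝓘(ℝ, E) 𝓘(ℝ, ℂ) 2 φ → ∀ (t : ℝ) (x : CoordIndex d → ℝ), 0 < t →
      laplaceBeltrami g φ (coordPoint A X t x) =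
        (t : ℂ) ^ 2 * iteratedDeriv 2 (fun s => φ (coordPoint A X s x)) t
        + ((1 - ∑ i, (d i : ℝ) * lam i : ℝ) : ℂ) * (t : ℂ)
            * deriv (fun s => φ (coordPoint A X s x)) t
        + ∑ a, ∑ b, ∑ c, ((t ^ (2 * lam a.1) : ℝ) : ℂ)
            * ((MvPolynomial.eval x (structPoly (structConst g X) a b) : ℝ) : ℂ)
            * coordPartial b (fun y => ((MvPolynomial.eval y (structPoly (structConst g X) a c) : ℝ) : ℂ)
                * coordPartial c (fun z => φ (coordPoint A X t z)) y) x) ∧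
    -- functions of `x^1`
    (∀ h : S → ℂ, ContMDiff 𝓘(ℝ, E) 𝓘(ℝ, ℂ) 2 h →
      (∀ (t t' : ℝ) (x x' : CoordIndex d → ℝ), 0 < t → 0 < t' →
        (∀ j, x ⟨⟨0, hm⟩, j⟩ = x' ⟨⟨0, hm⟩, j⟩) →
        h (coordPoint A X t x) = h (coordPoint A X t' x')) →
      ∀ (t : ℝ) (x : CoordIndex d → ℝ), 0 < t →
        laplaceBeltrami g h (coordPoint A X t x) =
          ((t ^ (2 * lam ⟨0, hm⟩) : ℝ) : ℂ)
            * ∑ j, coordPartial ⟨⟨0, hm⟩, j⟩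
                (coordPartial ⟨⟨0, hm⟩, j⟩ (fun z => h (coordPoint A X t z))) x) ∧
    -- functions of `x^1` and `x^2`
    (∀ (hm2 : 1 < m) (h : S → ℂ), ContMDiff 𝓘(ℝ, E) 𝓘(ℝ, ℂ) 2 h →
      (∀ (t t' : ℝ) (x x' : CoordIndex d → ℝ), 0 < t → 0 < t' →
        (∀ j, x ⟨⟨0, hm⟩, j⟩ = x' ⟨⟨0, hm⟩, j⟩) → (∀ j, x ⟨⟨1, hm2⟩, j⟩ = x' ⟨⟨1, hm2⟩, j⟩) →
        h (coordPoint A X t x) = h (coordPoint A X t' x')) →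
      ∀ (t : ℝ) (x : CoordIndex d → ℝ), 0 < t →
        laplaceBeltrami g h (coordPoint A X t x) =
          ((t ^ (2 * lam ⟨0, hm⟩) : ℝ) : ℂ)
            * ∑ j, coordPartial ⟨⟨0, hm⟩, j⟩
                (coordPartial ⟨⟨0, hm⟩, j⟩ (fun z => h (coordPoint A X t z))) x
          + ((t ^ (2 * lam ⟨0, hm⟩) : ℝ) : ℂ)
            * ∑ j, ∑ l, ∑ β,
                ((structConst g X ⟨⟨0, hm⟩, j⟩ ⟨⟨0, hm⟩, l⟩ ⟨⟨1, hm2⟩, β⟩ * x ⟨⟨0, hm⟩, j⟩ : ℝ) : ℂ)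
                * coordPartial ⟨⟨0, hm⟩, l⟩
                    (coordPartial ⟨⟨1, hm2⟩, β⟩ (fun z => h (coordPoint A X t z))) x
          + ((t ^ (2 * lam ⟨1, hm2⟩) : ℝ) : ℂ)
            * ∑ l, coordPartial ⟨⟨1, hm2⟩, l⟩
                (coordPartial ⟨⟨1, hm2⟩, l⟩ (fun z => h (coordPoint A X t z))) x
          + ((t ^ (2 * lam ⟨0, hm⟩) / 4 : ℝ) : ℂ)
            * ∑ j, ∑ r, ∑ s, ∑ l, ∑ β,
                ((structConst g X ⟨⟨0, hm⟩, r⟩ ⟨⟨0, hm⟩, j⟩ ⟨⟨1, hm2⟩, l⟩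
                  * structConst g X ⟨⟨0, hm⟩, s⟩ ⟨⟨0, hm⟩, j⟩ ⟨⟨1, hm2⟩, β⟩
                  * x ⟨⟨0, hm⟩, r⟩ * x ⟨⟨0, hm⟩, s⟩ : ℝ) : ℂ)
                * coordPartial ⟨⟨1, hm2⟩, l⟩
                    (coordPartial ⟨⟨1, hm2⟩, β⟩ (fun z => h (coordPoint A X t z))) x) := by
  have hF := hX.isModelFrame hrank
  have hne : Nonempty (CoordIndex d) := ⟨⟨⟨0, hm⟩, ⟨0, hX.dim_pos _⟩⟩⟩
  have hsc := hS.simplyConnected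
  -- Connectedness, needed for surjectivity of the coordinates, comes from simple connectedness.
  have hconn : ConnectedSpace S := inferInstance
  have hCg : IsGraded (structConst g X) lam :=
    have : CompleteSpace E := FiniteDimensional.complete ℝ E
    hF.isGraded
  -- `coordPoint A X t x` unfolds to `coordMap S A X (Real.log t, x)` and `structVec` to evaluations
  -- of `structPoly`, so the results in these terms apply as they stand.
  refine ⟨hF.exists_global_coordinates (S := S), isHomogeneous_homPoly _,
    totalDegree_structPoly_lt hm _, fun φ hφ t x ht =>
      hF.laplaceBeltrami_coordMap_log hS.leftInvariant hφ ht x, fun h hh hdep t x ht => ?_,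
    fun hm2 h hh hdep t x ht => ?_⟩
  · refine (hF.laplaceBeltrami_of_const hS.leftInvariant hh ht x
      fun t t' ht ht' => hdep t t' x x ht ht' fun _ => rfl).trans ?_
    exact sum_frameOp_of_dependsOn_zero hm (fun y z hyz => hdep t t y z ht ht fun j => hyz _ rfl)
      (fun i => ((t ^ (2 * lam i) : ℝ) : ℂ)) x
  · refine (hF.laplaceBeltrami_of_const hS.leftInvariant hh ht x
      fun t t' ht ht' => hdep t t' x x ht ht' (fun _ => rfl) fun _ => rfl).trans ?_
    have h2 : ContDiff ℝ 2 fun z => h (coordPoint A X t z) :=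
      contDiff_comp_coordMap_snd (E := E) (S := S) hh A X (Real.log t)
    refine (sum_frameOp_of_dependsOn_zero_one hm hm2 (fun y z hyz => hdep t t y z ht ht
      (fun j => hyz _ (Or.inl rfl)) fun j => hyz _ (Or.inr rfl)) hCg hF.antisymm h2
      (fun i => ((t ^ (2 * lam i) : ℝ) : ℂ)) x).trans ?_
    push_cast
    rfl
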